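/- **Theorem 5.7.** Let $n\ge 1$ be an integer and let $dV$ be Lebesgue measure on $\mathbb C^n$, normalized so that $\int_{\mathbb C^n}e^{-|z|^2}\,dV(z)=1$. For $0<p<\infty$ and real $\alpha$, let $F^p_\alpha$ be the space of entire functions $f$ on $\mathbb C^n$ with $$\|f\|_{F^p_\alpha}=\Big(\int_{\mathbb C^n}\big|f(z)e^{-|z|^2/2}\big|^p\,\frac{dV(z)}{(1+|z|)^\alpha}\Big)^{1/p}<\infty ,$$ and let $F^\infty_\alpha$ be the space of entire functions $f$ with $$\|f\|_{F^\infty_\alpha}=\operatorname*{ess\,sup}_{z\in\mathbb C^n}\frac{|f(z)|e^{-|z|^2/2}}{(1+|z|)^\alpha}<\infty .$$ For real $\gamma$ put $(\psi,\varphi)_\gamma=\int_{\mathbb C^n}\psi(z)\overline{\varphi(z)}\,e^{-|z|^2}|z|^{-\gamma}\,dV(z)$. For an entire function $f$ with homogeneous expansion $f=\sum_{k\ge0}f_k$ and real $s$, put $f_s^-=\sum_{k\le|s|}f_k$ and $f_s^+=f-f_s^-$, and let $$\langle f,g\rangle_\gamma=\begin{cases}(f,g)_\gamma&\text{if }\gamma<2n,\\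 (f_{\gamma/2}^-,g_{\gamma/2}^-)_0+(f_{\gamma/2}^+,g_{\gamma/2}^+)_\gamma&\text{if }\gamma\ge2n.\end{cases}$$ Let $0<p\le1$ and let $\alpha,\beta$ be real numbers. Then $(F^p_{\alpha p})^*=F^\infty_\beta$ with equivalent norms under the pairing $\langle\cdot,\cdot\rangle_{\alpha+\beta}$, that is: 1. for all $f\in F^p_{\alpha p}$ and $g\in F^\infty_\beta$ the integrals defining $\langle f,g\rangle_{\alpha+\beta}$ converge absolutely; 2. the map $g\mapsto\langle\cdot,g\rangle_{\alpha+\beta}$ is a conjugate-linear bijection from $F^\infty_\beta$ onto the space $(F^p_{\alpha p})^*$ of all bounded linear functionals on $F^p_{\alpha p}$ (the linear $\nu$ for which there is a constant $M$ with $|\nu(f)|\le M\|f\|_{F^p_{\alpha p}}$ for all $f$); 3. there are constants $c,C>0$, depending only on $n,p,\alpha,\beta$, such that for all $g\in F^\infty_\beta$ $$c\,\|g\|_{F^\infty_\beta}\le\sup\big\{|\langle f,g\rangle_{\alpha+\beta}|:\ f\in F^p_{\alpha p},\ \|f\|_{F^p_{\alpha p}}\le1\big\}\le C\,\|g\|_{F^\infty_\beta}.$$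 -/

import Mathlib

open MeasureTheory
open scoped ENNReal ComplexConjugate

noncomputable section

namespace FockDuality

/-- `ℂⁿ` with its Hermitian inner product and Euclidean norm. -/
abbrev Cn (n : ℕ) : Type := EuclideanSpace ℂ (Fin n)

/-- Lebesgue measure on `ℂⁿ = ℝ²ⁿ`, normalized so that `∫ e^{-|z|²} dV(z) = 1`. -/
def V (n : ℕ) : Measure (Cn n) := ENNReal.ofReal ((Real.pi ^ n)⁻¹) • volume

/-- `dV_α(z) = dV(z) / (1 + |z|)^α`. -/
def weightedV (n : ℕ) (α : ℝ) : Measure (Cn n) :=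
  (V n).withDensity fun z => ENNReal.ofReal ((1 + ‖z‖) ^ (-α))

/-- `dW_α(z) = dV(z) / |z|^α`. -/
def W (n : ℕ) (α : ℝ) : Measure (Cn n) :=
  (V n).withDensity fun z => ENNReal.ofReal (‖z‖ ^ (-α))

/-- `z ↦ f(z) e^{-|z|²/2}`. -/
def gaussWeighted {n : ℕ} (f : Cn n → ℂ) (z : Cn n) : ℂ :=
  f z * (Real.exp (-‖z‖ ^ 2 / 2) : ℂ)

/-- `z ↦ f(z) e^{-|z|²/2} / (1 + |z|)^α`. -/
def gaussWeightedInf {n : ℕ} (α : ℝ) (f : Cn n → ℂ) (z : Cn n) : ℂ :=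
  gaussWeighted f z * ((1 + ‖z‖) ^ (-α) : ℝ)

/-- The weighted Fock space `F^p_α` for finite exponents `p > 0`: the entire functions `f` with
`∫ |f(z) e^{-|z|²/2}|^p dV_α(z) < ∞`. -/
def FockSpace (n : ℕ) (p α : ℝ) : Submodule ℂ (Cn n → ℂ) where
  carrier := {f | Differentiable ℂ f ∧
    MemLp (gaussWeighted f) (ENNReal.ofReal p) (weightedV n α)}
  zero_mem' := by
    refine ⟨differentiable_const 0, ?_⟩
    have h : gaussWeighted (0 : Cn n → ℂ) = 0 := by
      funext z; simp [gaussWeighted]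
    rw [h]; exact MemLp.zero
  add_mem' := by
    rintro f g ⟨hf, hf'⟩ ⟨hg, hg'⟩
    refine ⟨hf.add hg, ?_⟩
    have h : gaussWeighted (f + g) = gaussWeighted f + gaussWeighted g := by
      funext z; simp [gaussWeighted, add_mul]
    rw [h]; exact hf'.add hg'
  smul_mem' := by
    rintro c f ⟨hf, hf'⟩
    refine ⟨hf.const_smul c, ?_⟩
    have h : gaussWeighted (c • f) = c • gaussWeighted f := by
      funext z; simp [gaussWeighted, mul_assoc]
    rw [h]; exact hf'.const_smul c

/-- The weighted Fock space `F^∞_α`: the entire functions `f` such that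
`|f(z)| e^{-|z|²/2} / (1 + |z|)^α` is essentially bounded. -/
def FockSpaceInf (n : ℕ) (α : ℝ) : Submodule ℂ (Cn n → ℂ) where
  carrier := {f | Differentiable ℂ f ∧ MemLp (gaussWeightedInf α f) ∞ (V n)}
  zero_mem' := by
    refine ⟨differentiable_const 0, ?_⟩
    have h : gaussWeightedInf α (0 : Cn n → ℂ) = 0 := by
      funext z; simp [gaussWeightedInf, gaussWeighted]
    rw [h]; exact MemLp.zero
  add_mem' := by
    rintro f g ⟨hf, hf'⟩ ⟨hg, hg'⟩
    refine ⟨hf.add hg, ?_⟩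
    have h : gaussWeightedInf α (f + g) = gaussWeightedInf α f + gaussWeightedInf α g := by
      funext z; simp [gaussWeightedInf, gaussWeighted, add_mul]
    rw [h]; exact hf'.add hg'
  smul_mem' := by
    rintro c f ⟨hf, hf'⟩
    refine ⟨hf.const_smul c, ?_⟩
    have h : gaussWeightedInf α (c • f) = c • gaussWeightedInf α f := by
      funext z; simp [gaussWeightedInf, gaussWeighted, mul_assoc]
    rw [h]; exact hf'.const_smul c

/-- `‖f‖ = (∫ |f(z) e^{-|z|²/2}|^p dV_α(z))^{1/p}` (a quasi-norm if `p < 1`). -/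
def fockNorm {n : ℕ} {p α : ℝ} (f : FockSpace n p α) : ℝ :=
  (eLpNorm (gaussWeighted (f : Cn n → ℂ)) (ENNReal.ofReal p) (weightedV n α)).toReal

/-- `‖f‖ = ess sup |f(z)| e^{-|z|²/2} / (1 + |z|)^α`. -/
def fockNormInf {n : ℕ} {α : ℝ} (f : FockSpaceInf n α) : ℝ :=
  (eLpNorm (gaussWeightedInf α (f : Cn n → ℂ)) ∞ (V n)).toReal

/-- `fₖ`, the homogeneous part of degree `k` of the Taylor expansion of `f` at the origin:
`fₖ(z) = Dᵏf(0)(z, …, z) / k!`. -/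
def homogPart {n : ℕ} (f : Cn n → ℂ) (k : ℕ) (z : Cn n) : ℂ :=
  (iteratedFDeriv ℂ k f 0 fun _ => z) / (k.factorial : ℂ)

/-- `f_s⁻ = ∑_{k ≤ |s|} fₖ`. -/
def lowPart {n : ℕ} (s : ℝ) (f : Cn n → ℂ) (z : Cn n) : ℂ :=
  ∑ k ∈ Finset.range (⌊|s|⌋₊ + 1), homogPart f k z

/-- `f_s⁺ = f - f_s⁻ = ∑_{k > |s|} fₖ`. -/
def highPart {n : ℕ} (s : ℝ) (f : Cn n → ℂ) (z : Cn n) : ℂ :=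
  f z - lowPart s f z

/-- The integrand `ψ(z) conj(φ(z)) e^{-|z|²}`. -/
def pairIntegrand {n : ℕ} (ψ φ : Cn n → ℂ) (z : Cn n) : ℂ :=
  ψ z * conj (φ z) * (Real.exp (-‖z‖ ^ 2) : ℂ)

/-- `(ψ, φ)_α = ∫ ψ(z) conj(φ(z)) e^{-|z|²} dW_α(z)`. -/
def rawPairing {n : ℕ} (α : ℝ) (ψ φ : Cn n → ℂ) : ℂ :=
  ∫ z, pairIntegrand ψ φ z ∂(W n α)

open Classical in
/-- `⟨f, g⟩_α`, equal to `(f, g)_α` if `α < 2n` and to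
`(f⁻, g⁻)_0 + (f⁺, g⁺)_α` (parts taken at `α / 2`) if `α ≥ 2n`. -/
def pairing {n : ℕ} (α : ℝ) (f g : Cn n → ℂ) : ℂ :=
  if α < 2 * (n : ℝ) then rawPairing α f g
  else rawPairing 0 (lowPart (α / 2) f) (lowPart (α / 2) g)
    + rawPairing α (highPart (α / 2) f) (highPart (α / 2) g)

/-- All integrals in the definition of `⟨f, g⟩_α` converge absolutely. -/
def PairingConverges {n : ℕ} (α : ℝ) (f g : Cn n → ℂ) : Prop :=
  (α < 2 * (n : ℝ) → Integrable (pairIntegrand f g) (W n α)) ∧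
  (2 * (n : ℝ) ≤ α →
    Integrable (pairIntegrand (lowPart (α / 2) f) (lowPart (α / 2) g)) (W n 0) ∧
    Integrable (pairIntegrand (highPart (α / 2) f) (highPart (α / 2) g)) (W n α))

/-- The dual space `(F^p_α)^*`: the linear functionals `ν` on `F^p_α` that are bounded, that is,
`|ν(f)| ≤ C ‖f‖` for some constant `C` and all `f`. -/
def FockDual (n : ℕ) (p α : ℝ) : Submodule ℂ (FockSpace n p α →ₗ[ℂ] ℂ) where
  carrier := {ν | ∃ C : ℝ, ∀ f, ‖ν f‖ ≤ C * fockNorm f}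
  zero_mem' := ⟨0, fun f => by simp⟩
  add_mem' := by
    rintro ν μ ⟨C, hC⟩ ⟨D, hD⟩
    refine ⟨C + D, fun f => ?_⟩
    rw [LinearMap.add_apply, add_mul]
    exact (norm_add_le _ _).trans (add_le_add (hC f) (hD f))
  smul_mem' := by
    rintro c ν ⟨C, hC⟩
    refine ⟨‖c‖ * C, fun f => ?_⟩
    rw [LinearMap.smul_apply, norm_smul, mul_assoc]
    exact mul_le_mul_of_nonneg_left (hC f) (norm_nonneg c)

/-- `‖ν‖ = sup {|ν(f)| : ‖f‖ ≤ 1}`. -/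
def dualNorm {n : ℕ} {p α : ℝ} (ν : FockDual n p α) : ℝ :=
  sSup {x : ℝ | ∃ f : FockSpace n p α, fockNorm f ≤ 1 ∧ x = ‖ν.1 f‖}

end FockDuality

end

/-!
The mean value inequality bounds `|f(z)| e^{-|z|²/2} (1 + |z|)^{-α}` by a multiple of the norm of
`f` in `F^p_{αp}`; as `p ≤ 1`, the space `F^p_{αp}` therefore embeds into `F^1_α`, so that pairing
with `g ∈ F^∞_β` is a bounded functional.

Conversely, let a bounded functional act on the homogeneous parts `⟨·, w⟩ᵏ / k!` of the kernel
`e^{⟨·, w⟩}`. If it is the pairing with `g`, then by rotation invariance its values are the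
conjugates of the `gₖ(w)`, for large `k` multiplied by quotients of Gamma functions. The values of
any bounded functional are the coefficients of a power series whose growth is governed by the norms
of the kernels. Dividing them by the Gamma quotients shifts the polynomial factor in this growth by
a fixed exponent, so the resulting series is a function `g ∈ F^∞_β`, bounded by the norm of the
functional.

It remains to see that a bounded functional which vanishes on the homogeneous parts of all kernels
is zero. By the reproducing formula, each homogeneous part of `f` is an integral of homogeneous
parts of kernels. For `r < 1` the homogeneous expansion of the dilate `f(r ·)` converges in
`F^p_{αp}`, and the dilates converge to `f` in `F^p_{αp}` as `r → 1`.
-/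

noncomputable section

namespace FockDuality

open Real Filter Topology

/-! ### Power series of Fock growth -/

/-- The comparison function `e^{x²/2} (1 + x)^β`, which measures the growth of functions in
`F^∞_β`. -/
def growth (β x : ℝ) : ℝ := Real.exp (x ^ 2 / 2) * (1 + x) ^ β

section Growth
variable {β s x y d : ℝ}

lemma growth_pos (hx : 0 ≤ x) : 0 < growth β x := by
  unfold growth; positivity

lemma growth_zero : growth β 0 = 1 := by simp [growth]

lemma growth_add (hx : 0 ≤ x) : growth (β + s) x = growth β x * (1 + x) ^ s := by
  rw [growth, rpow_add (by positivity), ← mul_assoc, growth]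

lemma growth_sub_one (hx : 0 ≤ x) : growth β x = growth (β - 1) x * (1 + x) := by
  simpa using growth_add (β := β - 1) (s := 1) hx

lemma exists_one_add_rpow_le_exp (s : ℝ) {ε : ℝ} (hε : 0 < ε) :
    ∃ C : ℝ, 0 < C ∧ ∀ x : ℝ, 0 ≤ x → (1 + x) ^ s ≤ C * Real.exp (ε * x ^ 2) := by
  refine ⟨Real.exp (s ^ 2 / (4 * ε)), Real.exp_pos _, fun x hx => ?_⟩
  rw [← Real.exp_add, rpow_def_of_pos (by positivity), Real.exp_le_exp]
  have hlog : Real.log (1 + x) ≤ x := by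
    linarith [Real.log_le_sub_one_of_pos (show 0 < 1 + x by positivity)]
  have hsq : 0 ≤ (2 * ε * x - |s|) ^ 2 / (4 * ε) := by positivity
  have hlog0 : 0 ≤ Real.log (1 + x) := Real.log_nonneg (by linarith)
  calc Real.log (1 + x) * s ≤ Real.log (1 + x) * |s| := by gcongr; exact le_abs_self s
    _ ≤ x * |s| := by gcongr
    _ ≤ x * |s| + (2 * ε * x - |s|) ^ 2 / (4 * ε) := by linarith
    _ = s ^ 2 / (4 * ε) + ε * x ^ 2 := by
      field_simp
      rw [← sq_abs s]; ring

/-- Peetre's inequality. -/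
lemma one_add_rpow_le_mul (s : ℝ) (hx : 0 ≤ x) (hy : 0 ≤ y) (hd : |x - y| ≤ d) :
    (1 + x) ^ s ≤ (1 + y) ^ s * (1 + d) ^ |s| := by
  have hd0 : 0 ≤ d := (abs_nonneg _).trans hd
  obtain ⟨hyx, hxy⟩ := abs_le.mp hd
  rcases le_total 0 s with hs | hs
  · rw [abs_of_nonneg hs, ← mul_rpow (by positivity) (by positivity)]
    refine rpow_le_rpow (by positivity) ?_ hs
    nlinarith [mul_nonneg hy hd0]
  · rw [abs_of_nonpos hs, rpow_neg (by positivity), ← div_eq_mul_inv,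
      ← div_rpow (by positivity) (by positivity)]
    refine rpow_le_rpow_of_nonpos (by positivity) ?_ hs
    rw [div_le_iff₀ (by positivity)]
    nlinarith [mul_nonneg hx hd0]

lemma exists_one_le_growth (β : ℝ) : ∃ C : ℝ, 0 < C ∧ ∀ x : ℝ, 0 ≤ x → 1 ≤ C * growth β x := by
  obtain ⟨C, hC, hle⟩ := exists_one_add_rpow_le_exp (-β) one_half_pos
  refine ⟨C, hC, fun x hx => ?_⟩
  calc 1 = (1 + x) ^ (-β) * (1 + x) ^ β := by rw [← rpow_add (by positivity)]; simp
    _ ≤ C * Real.exp (1 / 2 * x ^ 2) * (1 + x) ^ β := by gcongr; exact hle x hx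
    _ = C * growth β x := by rw [growth]; ring_nf

lemma growth_le_of_sub_le_inv (hx : 0 ≤ x) (hy : 0 ≤ y) (h : |y - x| ≤ (1 + x)⁻¹) :
    growth β y ≤ Real.exp (3 / 2) * 2 ^ |β| * growth β x := by
  have hinv : (1 + x)⁻¹ ≤ 1 := inv_le_one_of_one_le₀ (by linarith)
  have hinvx : (1 + x)⁻¹ * x ≤ 1 := by rw [inv_mul_le_iff₀ (by positivity)]; linarith
  have hpow := one_add_rpow_le_mul β hy hx (h.trans hinv)
  have hyx : y ≤ x + (1 + x)⁻¹ := by linarith [le_abs_self (y - x)]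
  have hsq : y ^ 2 / 2 ≤ 3 / 2 + x ^ 2 / 2 := by
    have : y ^ 2 ≤ (x + (1 + x)⁻¹) ^ 2 := by gcongr
    nlinarith [show 0 ≤ (1 + x)⁻¹ by positivity]
  unfold growth
  calc _ ≤ Real.exp (3 / 2 + x ^ 2 / 2) * ((1 + x) ^ β * (1 + 1) ^ |β|) := by gcongr
    _ = _ := by rw [Real.exp_add]; norm_num; ring

end Growth

lemma circleAverage_conj_pow_mul_pow (j k : ℕ) :
    Real.circleAverage (fun l : ℂ => conj l ^ k * l ^ j) 0 1 = if j = k then 1 else 0 := by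
  have hcongr : Set.EqOn (fun l : ℂ => conj l ^ k * l ^ j) (fun l => l ^ (j - k : ℤ))
      (Metric.sphere 0 |1|) := by
    intro l hl
    have hnorm : ‖l‖ = 1 := by simpa using hl
    have hl0 : l ≠ 0 := norm_ne_zero_iff.mp (by simp [hnorm])
    have hconj : conj l = l⁻¹ := by rw [Complex.inv_def, Complex.normSq_eq_norm_sq, hnorm]; simp
    simp only [hconj, zpow_sub₀ hl0, zpow_natCast]
    rw [inv_pow, mul_comm, div_eq_mul_inv]
  rw [Real.circleAverage_congr_sphere hcongr]
  split_ifs with hjk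
  · simp [hjk, Real.circleAverage_const]
  · rw [Real.circleAverage_eq_circleIntegral one_ne_zero]
    have hint := circleIntegral.integral_sub_zpow_of_ne (n := j - k - 1) (by omega) (0 : ℂ) 0 1
    have hEq : Set.EqOn (fun l : ℂ => (l - 0)⁻¹ • l ^ (j - k : ℤ))
        (fun l => (l - 0) ^ (j - k - 1 : ℤ)) (Metric.sphere 0 1) := by
      intro l hl
      have hl0 : l ≠ 0 := norm_ne_zero_iff.mp (by simp [show ‖l‖ = 1 by simpa using hl])
      simp only [sub_zero, smul_eq_mul]
      rw [zpow_sub_one₀ hl0, mul_comm]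
    rw [circleIntegral.integral_congr zero_le_one hEq, hint, smul_zero]

lemma circleAverage_conj_pow_mul {a : ℕ → ℂ} {F : ℂ → ℂ} (ha : Summable fun k => ‖a k‖)
    (hF : ∀ l : ℂ, ‖l‖ = 1 → HasSum (fun k => a k * l ^ k) (F l)) (k : ℕ) :
    Real.circleAverage (fun l => conj l ^ k * F l) 0 1 = a k := by
  have hnorm (θ : ℝ) : ‖circleMap 0 1 θ‖ = 1 := by simp
  have hsum : HasSum (fun j => Real.circleAverage (fun l => conj l ^ k * (a j * l ^ j)) 0 1)
      (Real.circleAverage (fun l => conj l ^ k * F l) 0 1) := by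
    simp only [Real.circleAverage_def]
    refine HasSum.const_smul _ (intervalIntegral.hasSum_integral_of_dominated_convergence
      (fun j _ => ‖a j‖) (fun j => ?_) (fun j => ae_of_all _ fun θ _ => ?_)
      (ae_of_all _ fun θ _ => ha) intervalIntegrable_const
      (ae_of_all _ fun θ _ => (hF _ (hnorm θ)).mul_left _))
    · have := continuous_circleMap 0 1
      exact Continuous.aestronglyMeasurable (by fun_prop)
    · simp [hnorm]
  have hterm (j : ℕ) : Real.circleAverage (fun l : ℂ => conj l ^ k * (a j * l ^ j)) 0 1
      = if j = k then a k else 0 := by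
    have := Real.circleAverage_fun_smul (f := fun l : ℂ => conj l ^ k * l ^ j) (c := 0) (R := 1)
      (a := a j)
    simp only [smul_eq_mul, circleAverage_conj_pow_mul_pow] at this
    simp only [mul_left_comm _ (a j), this]
    split_ifs with hjk <;> simp [hjk]
  simp only [hterm] at hsum
  exact hsum.unique (hasSum_ite_eq k (a k))

lemma norm_circleAverage_le {f : ℂ → ℂ} {M : ℝ}
    (h : ∀ l : ℂ, ‖l‖ = 1 → ‖f l‖ ≤ M) : ‖Real.circleAverage f 0 1‖ ≤ M := by
  have hint := intervalIntegral.norm_integral_le_of_norm_le_const (a := 0) (b := 2 * π) (C := M)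
    (f := fun θ => f (circleMap 0 1 θ)) (fun θ _ => h _ (by simp))
  have hpi := Real.pi_pos
  rw [sub_zero, abs_of_pos (by positivity)] at hint
  rw [Real.circleAverage_def, norm_smul, Real.norm_of_nonneg (by positivity)]
  calc _ ≤ (2 * π)⁻¹ * (M * (2 * π)) := by gcongr
    _ = M := by field_simp

lemma norm_coeff_le {a : ℕ → ℂ} {F : ℂ → ℂ} {M : ℝ} (ha : Summable fun k => ‖a k‖)
    (hF : ∀ l : ℂ, ‖l‖ = 1 → HasSum (fun k => a k * l ^ k) (F l))
    (hM : ∀ l : ℂ, ‖l‖ = 1 → ‖F l‖ ≤ M) (k : ℕ) : ‖a k‖ ≤ M := by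
  rw [← circleAverage_conj_pow_mul ha hF k]
  exact norm_circleAverage_le fun l hl => by simpa [hl] using hM l hl

/-- The power series `∑ aₖ λᵏ` is entire and bounded by `M e^{|λ|²/2} (1 + |λ|)^β`: membership of
its sum in the one-variable space `F^∞_β`, with norm at most `M`. -/
structure HasGrowth (a : ℕ → ℂ) (β M : ℝ) : Prop where
  summable : ∀ r : ℝ, 0 ≤ r → Summable fun k => ‖a k‖ * r ^ k
  bound : ∀ l : ℂ, ‖∑' k, a k * l ^ k‖ ≤ M * growth β ‖l‖

namespace HasGrowth
variable {a : ℕ → ℂ} {β M : ℝ}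

lemma nonneg (h : HasGrowth a β M) : 0 ≤ M :=
  nonneg_of_mul_nonneg_left ((norm_nonneg _).trans (h.bound 0)) (growth_pos (norm_nonneg _))

lemma mono (h : HasGrowth a β M) {M' : ℝ} (hM : M ≤ M') : HasGrowth a β M' :=
  ⟨h.summable, fun l => (h.bound l).trans
    (mul_le_mul_of_nonneg_right hM (growth_pos (norm_nonneg l)).le)⟩

lemma hasSum (h : HasGrowth a β M) (l : ℂ) :
    HasSum (fun k => a k * l ^ k) (∑' k, a k * l ^ k) := by
  refine (Summable.of_norm ?_).hasSum
  simpa [norm_mul, norm_pow] using h.summable ‖l‖ (norm_nonneg l)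

lemma norm_coeff_mul_pow_le (h : HasGrowth a β M) (k : ℕ) {r : ℝ} (hr : 0 ≤ r) :
    ‖a k‖ * r ^ k ≤ M * growth β r := by
  have := norm_coeff_le (a := fun k => a k * (r : ℂ) ^ k) (F := fun l => ∑' k, a k * (r * l) ^ k)
    (M := M * growth β r) ?_ ?_ ?_ k
  · simpa [abs_of_nonneg hr] using this
  · simpa [abs_of_nonneg hr] using h.summable r hr
  · intro l _
    simpa [mul_pow, mul_assoc] using h.hasSum (r * l)
  · intro l hl
    simpa [hl, abs_of_nonneg hr] using h.bound (r * l)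

lemma norm_coeff_zero_le (h : HasGrowth a β M) : ‖a 0‖ ≤ M := by
  simpa [growth_zero] using h.norm_coeff_mul_pow_le 0 le_rfl

lemma norm_term_le {l w : ℂ} (hw : w ∈ Metric.ball (0 : ℂ) (‖l‖ + 1)) (a : ℕ → ℂ) (k : ℕ) :
    ‖a k * w ^ k‖ ≤ ‖a k‖ * (‖l‖ + 1) ^ k := by
  rw [norm_mul, norm_pow]
  have := (mem_ball_zero_iff.mp hw).le
  gcongr

lemma differentiable (h : HasGrowth a β M) : Differentiable ℂ fun l : ℂ => ∑' k, a k * l ^ k := by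
  intro l
  refine (Complex.differentiableOn_tsum_of_summable_norm (h.summable (‖l‖ + 1) (by positivity))
    (fun i => by fun_prop) Metric.isOpen_ball
    (fun i w hw => norm_term_le hw a i)).differentiableAt (Metric.isOpen_ball.mem_nhds ?_)
  simp

lemma hasSum_deriv (h : HasGrowth a β M) (l : ℂ) :
    HasSum (fun k : ℕ => (k : ℂ) * a k * l ^ k) (l * deriv (fun l : ℂ => ∑' k, a k * l ^ k) l) := by
  have hderiv := Complex.hasSum_deriv_of_summable_norm (F := fun k l => a k * l ^ k)
    (h.summable (‖l‖ + 1) (by positivity)) (fun i => by fun_prop) Metric.isOpen_ball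
    (fun i w hw => norm_term_le hw a i) (show l ∈ Metric.ball 0 (‖l‖ + 1) by simp)
  refine (hderiv.mul_left l).congr_fun fun k => ?_
  rw [deriv_const_mul _ (by fun_prop), deriv_pow_field]
  rcases k with _ | k
  · simp
  · rw [Nat.add_sub_cancel]; ring

/-- Cauchy's estimate on the circle of radius `1 / (1 + |λ|)`, on which `growth` is essentially
constant. -/
lemma norm_deriv_le (h : HasGrowth a β M) (l : ℂ) :
    ‖deriv (fun l : ℂ => ∑' k, a k * l ^ k) l‖ ≤
      M * (Real.exp (3 / 2) * 2 ^ |β|) * (growth β ‖l‖ * (1 + ‖l‖)) := by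
  have hM := h.nonneg
  have hcauchy := Complex.norm_deriv_le_of_forall_mem_sphere_norm_le
    (f := fun l : ℂ => ∑' k, a k * l ^ k) (c := l)
    (C := M * (Real.exp (3 / 2) * 2 ^ |β| * growth β ‖l‖))
    (show 0 < (1 + ‖l‖)⁻¹ by positivity) h.differentiable.diffContOnCl ?_
  · rw [div_inv_eq_mul] at hcauchy
    linarith
  intro w hw
  have hwl : |‖w‖ - ‖l‖| ≤ (1 + ‖l‖)⁻¹ :=
    (abs_norm_sub_norm_le w l).trans_eq (by simpa using hw)
  refine (h.bound w).trans ?_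
  gcongr
  exact growth_le_of_sub_le_inv (norm_nonneg l) (norm_nonneg w) hwl

/-- Multiplying the coefficients by `k + b` is applying the operator `λ d/dλ + b`. -/
lemma natCast_add_mul (h : HasGrowth a β M) (b : ℝ) :
    HasGrowth (fun k => ((k + b : ℝ) : ℂ) * a k) (β + 2)
      ((Real.exp (3 / 2) * 2 ^ |β| + |b|) * M) := by
  have hM := h.nonneg
  constructor
  · intro r hr
    refine Summable.of_nonneg_of_le (fun k => by positivity) (fun k => ?_)
      ((h.summable (2 * r) (by positivity)).mul_left (1 + |b|))
    have hk : |(k : ℝ) + b| ≤ (1 + |b|) * 2 ^ k := by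
      have hk2 : (k : ℝ) ≤ 2 ^ k := by exact_mod_cast Nat.lt_two_pow_self.le
      have h2 : (1 : ℝ) ≤ 2 ^ k := one_le_pow₀ one_le_two
      refine (abs_add_le _ _).trans ?_
      rw [Nat.abs_cast]
      nlinarith [abs_nonneg b]
    rw [norm_mul, Complex.norm_real, Real.norm_eq_abs]
    calc |(k : ℝ) + b| * ‖a k‖ * r ^ k ≤ (1 + |b|) * 2 ^ k * ‖a k‖ * r ^ k := by gcongr
      _ = _ := by rw [mul_pow]; ring
  · intro l
    have hsum : ∑' k : ℕ, ((k + b : ℝ) : ℂ) * a k * l ^ k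
        = l * deriv (fun l : ℂ => ∑' k, a k * l ^ k) l + b * ∑' k, a k * l ^ k := by
      rw [← ((h.hasSum_deriv l).add ((h.hasSum l).mul_left (b : ℂ))).tsum_eq]
      congr 1; funext k; push_cast; ring
    have hg := growth_pos (β := β) (norm_nonneg l)
    have hl := norm_nonneg l
    rw [hsum, growth_add hl, rpow_two]
    calc _ ≤ ‖l‖ * (M * (Real.exp (3 / 2) * 2 ^ |β|) * (growth β ‖l‖ * (1 + ‖l‖)))
          + |b| * (M * growth β ‖l‖) := by
          refine (norm_add_le _ _).trans ?_
          rw [norm_mul, norm_mul, Complex.norm_real, Real.norm_eq_abs]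
          gcongr
          · exact h.norm_deriv_le l
          · exact h.bound l
      _ = M * growth β ‖l‖ * (Real.exp (3 / 2) * 2 ^ |β| * (‖l‖ * (1 + ‖l‖)) + |b| * 1) := by ring
      _ ≤ M * growth β ‖l‖ * (Real.exp (3 / 2) * 2 ^ |β| * (1 + ‖l‖) ^ 2
          + |b| * (1 + ‖l‖) ^ 2) := by
          gcongr <;> nlinarith
      _ = _ := by ring

lemma hasSum_integral_mul_pow (h : HasGrowth a β M) {X : Type*} [MeasurableSpace X]
    {μ : Measure X} {ω τ : X → ℝ} (hω : Integrable ω μ) (hω0 : ∀ᵐ t ∂μ, 0 ≤ ω t)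
    (hτ : Measurable τ) (hτ01 : ∀ᵐ t ∂μ, τ t ∈ Set.Icc 0 1) (l : ℂ) :
    HasSum (fun k : ℕ => ((∫ t, ω t * τ t ^ k ∂μ : ℝ) : ℂ) * a k * l ^ k)
      (∫ t, (ω t : ℂ) * ∑' k, a k * (τ t * l) ^ k ∂μ) := by
  have hnorm (k : ℕ) : ∀ᵐ t ∂μ, ‖(ω t : ℂ) * (a k * (τ t * l) ^ k)‖
      ≤ ω t * (‖a k‖ * ‖l‖ ^ k) := by
    filter_upwards [hω0, hτ01] with t ht0 ht
    rw [norm_mul, Complex.norm_real, Real.norm_of_nonneg ht0, norm_mul, norm_pow, norm_mul,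
      Complex.norm_real, Real.norm_of_nonneg ht.1]
    have := ht.1
    gcongr
    exact mul_le_of_le_one_left (norm_nonneg l) ht.2
  have hswap := hasSum_integral_of_dominated_convergence (μ := μ)
    (F := fun k t => (ω t : ℂ) * (a k * (τ t * l) ^ k))
    (fun k t => ω t * (‖a k‖ * ‖l‖ ^ k))
    (fun k => hω.ofReal.aestronglyMeasurable.mul
      (Measurable.aestronglyMeasurable (by fun_prop)))
    hnorm (ae_of_all _ fun t => (h.summable _ (norm_nonneg l)).mul_left _)
    (by simpa only [tsum_mul_left] using hω.mul_const _)
    (ae_of_all _ fun t => (h.hasSum (τ t * l)).mul_left (ω t : ℂ))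
  refine hswap.congr_fun fun k => ?_
  rw [← integral_complex_ofReal, mul_assoc, ← integral_mul_const]
  congr 1; funext t; push_cast; ring

/-- Multiplying the coefficients by the moments `∫ ω τᵏ` replaces the sum `F` of the power series
by the average `∫ ω(t) F(τ(t) λ)`. -/
lemma integral_mul_pow_mul (h : HasGrowth a β M) {X : Type*} [MeasurableSpace X] {μ : Measure X}
    {ω τ : X → ℝ} (hω : Integrable ω μ) (hω0 : ∀ᵐ t ∂μ, 0 ≤ ω t) (hτ : Measurable τ)
    (hτ01 : ∀ᵐ t ∂μ, τ t ∈ Set.Icc 0 1) {β' C : ℝ}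
    (hint : ∀ x : ℝ, 0 ≤ x → Integrable (fun t => ω t * growth β (τ t * x)) μ)
    (hC : ∀ x : ℝ, 0 ≤ x → ∫ t, ω t * growth β (τ t * x) ∂μ ≤ C * growth β' x) :
    HasGrowth (fun k => ((∫ t, ω t * τ t ^ k ∂μ : ℝ) : ℂ) * a k) β' (C * M) := by
  constructor
  · intro r hr
    refine Summable.of_nonneg_of_le (fun k => by positivity) (fun k => ?_)
      ((h.summable r hr).mul_left (∫ t, ω t ∂μ))
    rw [norm_mul, mul_assoc, Complex.norm_real]
    refine mul_le_mul_of_nonneg_right (norm_integral_le_of_norm_le hω ?_) (by positivity)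
    filter_upwards [hω0, hτ01] with t ht0 ht
    rw [Real.norm_of_nonneg (mul_nonneg ht0 (pow_nonneg ht.1 k))]
    exact mul_le_of_le_one_right ht0 (pow_le_one₀ ht.1 ht.2)
  · intro l
    rw [(h.hasSum_integral_mul_pow hω hω0 hτ hτ01 l).tsum_eq]
    calc _ ≤ ∫ t, M * (ω t * growth β (τ t * ‖l‖)) ∂μ := by
          refine norm_integral_le_of_norm_le ((hint _ (norm_nonneg l)).const_mul M) ?_
          filter_upwards [hω0, hτ01] with t ht0 ht
          have hbound := h.bound (τ t * l)
          rw [norm_mul, Complex.norm_real, Real.norm_of_nonneg ht.1] at hbound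
          rw [norm_mul, Complex.norm_real, Real.norm_of_nonneg ht0, mul_left_comm]
          gcongr
      _ ≤ M * (C * growth β' ‖l‖) := by
          rw [integral_const_mul]
          exact mul_le_mul_of_nonneg_left (hC _ (norm_nonneg l)) h.nonneg
      _ = _ := by ring

lemma norm_tsum_succ_le (h : HasGrowth a β M) {l : ℂ} (hl : ‖l‖ ≤ 1) :
    ‖∑' k, a (k + 1) * l ^ k‖ ≤ M * growth β 2 := by
  have hcoeff (k : ℕ) : ‖a (k + 1) * l ^ k‖ ≤ M * growth β 2 / 2 * (1 / 2) ^ k := by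
    have hCauchy := h.norm_coeff_mul_pow_le (k + 1) zero_le_two
    rw [norm_mul, norm_pow, one_div, inv_pow, ← div_eq_mul_inv, div_div, ← pow_succ',
      le_div_iff₀ (by positivity)]
    refine le_trans ?_ hCauchy
    gcongr
    exact mul_le_of_le_one_right (norm_nonneg _) (pow_le_one₀ (norm_nonneg l) hl)
  refine (tsum_of_norm_bounded (hasSum_geometric_two.mul_left _) hcoeff).trans_eq ?_
  ring

lemma norm_mul_norm_tsum_succ_le (h : HasGrowth a β M) (l : ℂ) :
    ‖l‖ * ‖∑' k, a (k + 1) * l ^ k‖ ≤ M * growth β ‖l‖ + M := by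
  have hmul : l * ∑' k, a (k + 1) * l ^ k = ∑' k, a k * l ^ k - a 0 := by
    rw [(h.hasSum l).summable.tsum_eq_zero_add, ← tsum_mul_left]
    simp only [pow_zero, mul_one, add_sub_cancel_left]
    congr 1; funext k; ring
  rw [← norm_mul, hmul]
  exact (norm_sub_le _ _).trans (add_le_add (h.bound l) h.norm_coeff_zero_le)

end HasGrowth

/-! ### Multipliers of power series -/

lemma integral_beta {s A : ℝ} (hs : 0 < s) (hA : 0 < A) :
    ∫ u in Set.Ioo (0 : ℝ) 1, u ^ (s - 1) * (1 - u) ^ (A - 1)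
      = Real.Gamma s * Real.Gamma A / Real.Gamma (s + A) := by
  have hbeta := Complex.betaIntegral_eq_Gamma_mul_div (s : ℂ) A (by simpa) (by simpa)
  rw [Complex.betaIntegral, intervalIntegral.integral_of_le zero_le_one,
    integral_Ioc_eq_integral_Ioo, ← Complex.ofReal_add, Complex.Gamma_ofReal, Complex.Gamma_ofReal,
    Complex.Gamma_ofReal] at hbeta
  have hreal : ∫ u in Set.Ioo (0 : ℝ) 1, (u : ℂ) ^ ((s : ℂ) - 1) * (1 - (u : ℂ)) ^ ((A : ℂ) - 1)
      = ∫ u in Set.Ioo (0 : ℝ) 1, ((u ^ (s - 1) * (1 - u) ^ (A - 1) : ℝ) : ℂ) := by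
    refine setIntegral_congr_fun measurableSet_Ioo fun u hu => ?_
    rw [Complex.ofReal_mul, Complex.ofReal_cpow hu.1.le,
      Complex.ofReal_cpow (sub_nonneg.mpr hu.2.le)]
    push_cast; rfl
  rw [hreal, integral_complex_ofReal] at hbeta
  exact_mod_cast hbeta

lemma integrableOn_beta {s A : ℝ} (hs : 0 < s) (hA : 0 < A) :
    IntegrableOn (fun u : ℝ => u ^ (s - 1) * (1 - u) ^ (A - 1)) (Set.Ioo 0 1) := by
  refine Integrable.of_integral_ne_zero ?_
  rw [integral_beta hs hA]
  have := Real.Gamma_pos_of_pos hs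
  have := Real.Gamma_pos_of_pos hA
  have := Real.Gamma_pos_of_pos (add_pos hs hA)
  positivity

lemma beta_nonneg (s A : ℝ) {u : ℝ} (hu : u ∈ Set.Ioo (0 : ℝ) 1) :
    0 ≤ u ^ (s - 1) * (1 - u) ^ (A - 1) :=
  mul_nonneg (rpow_nonneg hu.1.le _) (rpow_nonneg (sub_nonneg.mpr hu.2.le) _)

lemma one_div_one_add_sq_rpow_le {s x : ℝ} (hs : 0 ≤ s) (hx : 0 ≤ x) :
    (1 / (1 + x ^ 2 / 4)) ^ s ≤ 5 ^ s * (1 + x) ^ (-(2 * s)) := by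
  rw [rpow_neg (by positivity), rpow_mul (by positivity), rpow_two, ← div_eq_mul_inv,
    ← div_rpow (by norm_num) (by positivity)]
  refine rpow_le_rpow (by positivity) ?_ hs
  rw [div_le_div_iff₀ (by positivity) (by positivity)]
  nlinarith [sq_nonneg (x - 4)]

lemma exists_setIntegral_rpow_mul_exp_le {s : ℝ} (hs : 0 < s) :
    ∃ C : ℝ, 0 < C ∧ ∀ x : ℝ, 0 ≤ x →
      IntegrableOn (fun u : ℝ => u ^ (s - 1) * Real.exp (-(u * x ^ 2 / 4))) (Set.Ioo 0 1) ∧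
      ∫ u in Set.Ioo (0 : ℝ) 1, u ^ (s - 1) * Real.exp (-(u * x ^ 2 / 4))
        ≤ C * (1 + x) ^ (-(2 * s)) := by
  have := Real.Gamma_pos_of_pos hs
  refine ⟨Real.exp 1 * (5 ^ s * Real.Gamma s), by positivity, fun x hx => ?_⟩
  have hr : 0 < 1 + x ^ 2 / 4 := by positivity
  have hΓ := Real.integral_rpow_mul_exp_neg_mul_Ioi hs hr
  have hint : IntegrableOn (fun u : ℝ => Real.exp 1 *
      (u ^ (s - 1) * Real.exp (-((1 + x ^ 2 / 4) * u)))) (Set.Ioi 0) := by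
    refine (Integrable.of_integral_ne_zero ?_).const_mul _
    rw [hΓ]
    positivity
  have hle : ∀ u ∈ Set.Ioo (0 : ℝ) 1, u ^ (s - 1) * Real.exp (-(u * x ^ 2 / 4)) ≤
      Real.exp 1 * (u ^ (s - 1) * Real.exp (-((1 + x ^ 2 / 4) * u))) := by
    intro u hu
    rw [mul_left_comm, ← Real.exp_add]
    have := rpow_nonneg hu.1.le (s - 1)
    gcongr
    linarith [hu.2]
  have hon : IntegrableOn (fun u : ℝ => u ^ (s - 1) * Real.exp (-(u * x ^ 2 / 4)))
      (Set.Ioo 0 1) := by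
    refine Integrable.mono' (hint.mono_set Set.Ioo_subset_Ioi_self)
      (Measurable.aestronglyMeasurable (by fun_prop))
      ((ae_restrict_iff' measurableSet_Ioo).mpr (ae_of_all _ fun u hu => ?_))
    rw [Real.norm_of_nonneg (mul_nonneg (rpow_nonneg hu.1.le _) (Real.exp_pos _).le)]
    exact hle u hu
  refine ⟨hon, ?_⟩
  calc _ ≤ ∫ u in Set.Ioo (0 : ℝ) 1, Real.exp 1 *
          (u ^ (s - 1) * Real.exp (-((1 + x ^ 2 / 4) * u))) :=
        setIntegral_mono_on hon (hint.mono_set Set.Ioo_subset_Ioi_self) measurableSet_Ioo hle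
    _ ≤ ∫ u in Set.Ioi (0 : ℝ), Real.exp 1 *
          (u ^ (s - 1) * Real.exp (-((1 + x ^ 2 / 4) * u))) := by
        refine setIntegral_mono_set hint ((ae_restrict_iff' measurableSet_Ioi).mpr
          (ae_of_all _ fun u (hu : 0 < u) => ?_)) Set.Ioo_subset_Ioi_self.eventuallyLE
        simp only [Pi.zero_apply]; positivity
    _ = Real.exp 1 * ((1 / (1 + x ^ 2 / 4)) ^ s * Real.Gamma s) := by
        rw [integral_const_mul, hΓ]
    _ ≤ Real.exp 1 * (5 ^ s * (1 + x) ^ (-(2 * s)) * Real.Gamma s) := by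
        gcongr
        exact one_div_one_add_sq_rpow_le hs.le hx
    _ = _ := by ring

lemma exists_growth_one_sub_mul_le (β : ℝ) :
    ∃ C : ℝ, 0 < C ∧ ∀ x : ℝ, 0 ≤ x → ∀ u ∈ Set.Ioo (0 : ℝ) 1,
      growth β ((1 - u) * x) ≤ C * growth β x * Real.exp (-(u * x ^ 2 / 4)) := by
  obtain ⟨C, hC, h⟩ := exists_one_add_rpow_le_exp |β| (ε := 1 / 4) (by norm_num)
  refine ⟨C, hC, fun x hx u hu => ?_⟩
  obtain ⟨hu0, hu1⟩ := hu
  have hpeetre := one_add_rpow_le_mul (x := (1 - u) * x) (y := x) (d := u * x) β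
    (mul_nonneg (sub_nonneg.mpr hu1.le) hx) hx (by rw [abs_le]; constructor <;> nlinarith)
  have hexp : Real.exp (((1 - u) * x) ^ 2 / 2) * Real.exp (1 / 4 * (u * x) ^ 2)
      ≤ Real.exp (x ^ 2 / 2) * Real.exp (-(u * x ^ 2 / 4)) := by
    rw [← Real.exp_add, ← Real.exp_add, Real.exp_le_exp]
    have : 0 ≤ u * (1 - u) * x ^ 2 :=
      mul_nonneg (mul_nonneg hu0.le (sub_nonneg.mpr hu1.le)) (sq_nonneg x)
    nlinarith [mul_nonneg hu0.le (sq_nonneg x)]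
  calc growth β ((1 - u) * x)
      ≤ Real.exp (((1 - u) * x) ^ 2 / 2) *
        ((1 + x) ^ β * (C * Real.exp (1 / 4 * (u * x) ^ 2))) := by
        unfold growth
        gcongr
        exact hpeetre.trans (by gcongr; exact h _ (by positivity))
    _ = C * (1 + x) ^ β *
        (Real.exp (((1 - u) * x) ^ 2 / 2) * Real.exp (1 / 4 * (u * x) ^ 2)) := by ring
    _ ≤ C * (1 + x) ^ β * (Real.exp (x ^ 2 / 2) * Real.exp (-(u * x ^ 2 / 4))) := by gcongr
    _ = _ := by rw [growth]; ring

/-- As `A ≥ 1`, the factor `(1 - u)^(A-1)` is at most `1`; the gain `(1 + x)^(-2s)` is due to the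
concentration of `e^{-ux²/4}` on `u ≲ x⁻²`. -/
lemma exists_setIntegral_beta_mul_growth_le (β : ℝ) {s A : ℝ} (hs : 0 < s) (hA : 1 ≤ A) :
    ∃ C : ℝ, 0 < C ∧ ∀ x : ℝ, 0 ≤ x →
      IntegrableOn (fun u : ℝ => u ^ (s - 1) * (1 - u) ^ (A - 1) * growth β ((1 - u) * x))
        (Set.Ioo 0 1) ∧
      ∫ u in Set.Ioo (0 : ℝ) 1, u ^ (s - 1) * (1 - u) ^ (A - 1) * growth β ((1 - u) * x)
        ≤ C * growth (β - 2 * s) x := by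
  obtain ⟨C₁, hC₁, hdecay⟩ := exists_growth_one_sub_mul_le β
  obtain ⟨C₂, hC₂, hint⟩ := exists_setIntegral_rpow_mul_exp_le hs
  refine ⟨C₁ * C₂, by positivity, fun x hx => ?_⟩
  obtain ⟨hon, hle⟩ := hint x hx
  have hg := growth_pos (β := β) hx
  have hg' (u : ℝ) (hu : u ∈ Set.Ioo (0 : ℝ) 1) : 0 < growth β ((1 - u) * x) :=
    growth_pos (mul_nonneg (sub_nonneg.mpr hu.2.le) hx)
  have hpt : ∀ u ∈ Set.Ioo (0 : ℝ) 1,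
      u ^ (s - 1) * (1 - u) ^ (A - 1) * growth β ((1 - u) * x)
        ≤ C₁ * growth β x * (u ^ (s - 1) * Real.exp (-(u * x ^ 2 / 4))) := by
    intro u hu
    have hu0 := rpow_nonneg hu.1.le (s - 1)
    have hu1 : (1 - u) ^ (A - 1) ≤ 1 :=
      rpow_le_one (sub_nonneg.mpr hu.2.le) (by linarith [hu.1]) (by linarith)
    calc _ ≤ u ^ (s - 1) * 1 * (C₁ * growth β x * Real.exp (-(u * x ^ 2 / 4))) := by
          gcongr
          · exact (hg' u hu).le
          · exact hdecay x hx u hu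
      _ = _ := by ring
  have hon' : IntegrableOn
      (fun u : ℝ => u ^ (s - 1) * (1 - u) ^ (A - 1) * growth β ((1 - u) * x)) (Set.Ioo 0 1) := by
    refine Integrable.mono' (hon.const_mul (C₁ * growth β x))
      (Measurable.aestronglyMeasurable (by unfold growth; fun_prop))
      ((ae_restrict_iff' measurableSet_Ioo).mpr (ae_of_all _ fun u hu => ?_))
    rw [Real.norm_of_nonneg (mul_nonneg (beta_nonneg s A hu) (hg' u hu).le)]
    exact hpt u hu
  refine ⟨hon', ?_⟩
  calc _ ≤ ∫ u in Set.Ioo (0 : ℝ) 1,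
          C₁ * growth β x * (u ^ (s - 1) * Real.exp (-(u * x ^ 2 / 4))) :=
        setIntegral_mono_on hon' (hon.const_mul _) measurableSet_Ioo hpt
    _ ≤ C₁ * growth β x * (C₂ * (1 + x) ^ (-(2 * s))) := by
        rw [integral_const_mul]; gcongr
    _ = _ := by rw [sub_eq_add_neg, growth_add hx]; ring

/-- Multiplication of the coefficients of power series by `m` maps, boundedly, functions of growth
exponent `β` to functions of growth exponent `β + δ`, for every `β`. -/
def IsGrowthMultiplier (m : ℕ → ℝ) (δ : ℝ) : Prop :=
  ∀ β : ℝ, ∃ C : ℝ, 0 < C ∧ ∀ (a : ℕ → ℂ) (M : ℝ), HasGrowth a β M →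
    HasGrowth (fun k => (m k : ℂ) * a k) (β + δ) (C * M)

lemma isGrowthMultiplier_natCast_add (b : ℝ) : IsGrowthMultiplier (fun k => k + b) 2 :=
  fun β => ⟨Real.exp (3 / 2) * 2 ^ |β| + |b|, by positivity, fun _ _ h => h.natCast_add_mul b⟩

lemma IsGrowthMultiplier.mul {m₁ m₂ : ℕ → ℝ} {δ₁ δ₂ : ℝ} (h₁ : IsGrowthMultiplier m₁ δ₁)
    (h₂ : IsGrowthMultiplier m₂ δ₂) : IsGrowthMultiplier (fun k => m₁ k * m₂ k) (δ₁ + δ₂) := by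
  intro β
  obtain ⟨C₂, hC₂, h₂⟩ := h₂ β
  obtain ⟨C₁, hC₁, h₁⟩ := h₁ (β + δ₂)
  refine ⟨C₁ * C₂, by positivity, fun a M h => ?_⟩
  simpa only [Complex.ofReal_mul, mul_assoc, add_assoc, add_comm δ₂] using h₁ _ _ (h₂ a M h)

lemma isGrowthMultiplier_beta {s A : ℝ} (hs : 0 < s) (hA : 1 ≤ A) :
    IsGrowthMultiplier (fun k => Real.Gamma (k + A) / Real.Gamma (k + A + s)) (-(2 * s)) := by
  intro β
  have hG := Real.Gamma_pos_of_pos hs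
  obtain ⟨C, hC, hint⟩ := exists_setIntegral_beta_mul_growth_le β hs hA
  have hmoment (k : ℕ) :
      ∫ u in Set.Ioo (0 : ℝ) 1, (Real.Gamma s)⁻¹ * (u ^ (s - 1) * (1 - u) ^ (A - 1)) * (1 - u) ^ k
        = Real.Gamma (k + A) / Real.Gamma (k + A + s) := by
    have hcongr : Set.EqOn (fun u : ℝ => u ^ (s - 1) * (1 - u) ^ (A - 1) * (1 - u) ^ k)
        (fun u => u ^ (s - 1) * (1 - u) ^ (k + A - 1)) (Set.Ioo 0 1) := fun u hu => by
      simp only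
      rw [show (k : ℝ) + A - 1 = (A - 1) + k by ring, rpow_add (sub_pos.mpr hu.2), rpow_natCast,
        mul_assoc]
    simp only [mul_assoc (Real.Gamma s)⁻¹]
    rw [integral_const_mul, setIntegral_congr_fun measurableSet_Ioo hcongr,
      integral_beta hs (by positivity), add_comm s]
    field_simp
  refine ⟨(Real.Gamma s)⁻¹ * C, by positivity, fun a M h => ?_⟩
  have hIoo {P : ℝ → Prop} (hP : ∀ u ∈ Set.Ioo (0 : ℝ) 1, P u) :
      ∀ᵐ u ∂volume.restrict (Set.Ioo (0 : ℝ) 1), P u :=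
    (ae_restrict_iff' measurableSet_Ioo).mpr (ae_of_all _ hP)
  simp only [← hmoment, ← sub_eq_add_neg]
  refine h.integral_mul_pow_mul ((integrableOn_beta hs (by linarith)).const_mul _)
    (hIoo fun u hu => mul_nonneg (inv_nonneg.mpr hG.le) (beta_nonneg s A hu))
    (by fun_prop) (hIoo fun u hu => ⟨by linarith [hu.2], by linarith [hu.1]⟩)
    (fun x hx => ?_) (fun x hx => ?_)
  · simpa only [mul_assoc] using (hint x hx).1.const_mul (Real.Gamma s)⁻¹
  · simp only [mul_assoc (Real.Gamma s)⁻¹]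
    rw [integral_const_mul]
    gcongr
    exact (hint x hx).2

/-- If `A < B` this is a beta multiplier; the general case follows by multiplying and dividing by
the factors `k + B`, `k + B + 1`, …. -/
lemma isGrowthMultiplier_gamma {A B : ℝ} (hA : 1 ≤ A) (hB : 0 < B) :
    IsGrowthMultiplier (fun k => Real.Gamma (k + A) / Real.Gamma (k + B)) (2 * (A - B)) := by
  obtain ⟨N, hN⟩ := exists_nat_gt (A - B)
  replace hN : A < B + N := by linarith
  induction N generalizing B with
  | zero =>
    have h := isGrowthMultiplier_beta (s := B - A) (by simpa using hN) hA
    convert h using 4 <;> ring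
  | succ N ih =>
    have h := (isGrowthMultiplier_natCast_add B).mul
      (ih (B := B + 1) (by linarith) (by push_cast at hN; linarith))
    convert h using 1
    · funext k
      have hk : (k : ℝ) + B ≠ 0 := by positivity
      rw [← add_assoc (k : ℝ) B 1, Real.Gamma_add_one hk]
      field_simp
    · ring

lemma exists_hasGrowth_tail (β : ℝ) :
    ∃ C : ℝ, 0 < C ∧ ∀ (a : ℕ → ℂ) (M : ℝ), HasGrowth a β M →
      HasGrowth (fun k => a (k + 1)) (β - 1) (C * M) := by
  obtain ⟨C₀, hC₀, hone⟩ := exists_one_le_growth β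
  obtain ⟨C₁, hC₁, hone'⟩ := exists_one_le_growth (β - 1)
  have hg2 := growth_pos (β := β) (x := 2) zero_le_two
  refine ⟨growth β 2 * C₁ + 2 * (1 + C₀), by positivity, fun a M h => ?_⟩
  have hM := h.nonneg
  constructor
  · intro r hr
    refine Summable.of_nonneg_of_le (fun k => by positivity) (fun k => ?_)
      ((summable_nat_add_iff 1).mpr (h.summable (r + 1) (by positivity)))
    gcongr
    calc r ^ k ≤ (r + 1) ^ k := by gcongr; linarith
      _ ≤ _ := pow_le_pow_right₀ (by linarith) k.le_succ
  intro l
  have hl := norm_nonneg l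
  have hg := growth_pos (β := β - 1) hl
  rcases le_total ‖l‖ 1 with hl1 | hl1
  · calc _ ≤ M * growth β 2 * 1 := (h.norm_tsum_succ_le hl1).trans_eq (mul_one _).symm
      _ ≤ M * growth β 2 * (C₁ * growth (β - 1) ‖l‖) := by gcongr; exact hone' _ hl
      _ ≤ M * growth β 2 * (C₁ * growth (β - 1) ‖l‖)
          + 2 * (1 + C₀) * M * growth (β - 1) ‖l‖ := le_add_of_nonneg_right (by positivity)
      _ = _ := by ring
  · have hle : ‖l‖ * ‖∑' k, a (k + 1) * l ^ k‖
        ≤ ‖l‖ * (2 * (1 + C₀) * M * growth (β - 1) ‖l‖) := by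
      calc _ ≤ M * growth β ‖l‖ + M * 1 := by simpa using h.norm_mul_norm_tsum_succ_le l
        _ ≤ M * growth β ‖l‖ + M * (C₀ * growth β ‖l‖) := by gcongr; exact hone _ hl
        _ = (1 + C₀) * M * growth (β - 1) ‖l‖ * (1 + ‖l‖) := by rw [growth_sub_one hl]; ring
        _ ≤ (1 + C₀) * M * growth (β - 1) ‖l‖ * (2 * ‖l‖) := by gcongr; linarith
        _ = _ := by ring
    calc _ ≤ 2 * (1 + C₀) * M * growth (β - 1) ‖l‖ := le_of_mul_le_mul_left hle (by linarith)
      _ ≤ growth β 2 * C₁ * M * growth (β - 1) ‖l‖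
          + 2 * (1 + C₀) * M * growth (β - 1) ‖l‖ := le_add_of_nonneg_left (by positivity)
      _ = _ := by ring

lemma exists_hasGrowth_cons (β : ℝ) :
    ∃ C : ℝ, 0 < C ∧ ∀ (a : ℕ → ℂ) (M : ℝ), HasGrowth (fun k => a (k + 1)) (β - 1) M →
      HasGrowth a β (C * ‖a 0‖ + M) := by
  obtain ⟨C, hC, hone⟩ := exists_one_le_growth β
  refine ⟨C, hC, fun a M h => ⟨fun r hr => ?_, fun l => ?_⟩⟩
  · rw [← summable_nat_add_iff 1]
    exact ((h.summable r hr).mul_right r).congr fun k => by ring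
  have hl := norm_nonneg l
  have hsum : HasSum (fun k => a k * l ^ k) (a 0 + l * ∑' k, a (k + 1) * l ^ k) := by
    have := HasSum.zero_add (f := fun k => a k * l ^ k)
      (((h.hasSum l).mul_left l).congr_fun fun k => by ring)
    simpa using this
  rw [hsum.tsum_eq, add_mul]
  refine (norm_add_le _ _).trans (add_le_add ?_ ?_)
  · calc ‖a 0‖ = ‖a 0‖ * 1 := (mul_one _).symm
      _ ≤ ‖a 0‖ * (C * growth β ‖l‖) := by gcongr; exact hone _ hl
      _ = _ := by ring
  · rw [norm_mul]
    calc _ ≤ (1 + ‖l‖) * (M * growth (β - 1) ‖l‖) := by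
          gcongr
          · linarith
          · exact h.bound l
      _ = _ := by rw [growth_sub_one (β := β) hl]; ring

lemma IsGrowthMultiplier.of_succ {m : ℕ → ℝ} {δ : ℝ}
    (h : IsGrowthMultiplier (fun k => m (k + 1)) δ) : IsGrowthMultiplier m δ := by
  intro β
  obtain ⟨C₁, hC₁, htail⟩ := exists_hasGrowth_tail β
  obtain ⟨C₂, hC₂, hm⟩ := h (β - 1)
  obtain ⟨C₃, hC₃, hcons⟩ := exists_hasGrowth_cons (β + δ)
  refine ⟨C₃ * |m 0| + C₂ * C₁, by positivity, fun a M ha => ?_⟩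
  have htail' := hm _ _ (htail a M ha)
  rw [sub_add_eq_add_sub] at htail'
  refine (hcons (fun k => (m k : ℂ) * a k) _ htail').mono ?_
  calc C₃ * ‖(m 0 : ℂ) * a 0‖ + C₂ * (C₁ * M) ≤ C₃ * (|m 0| * M) + C₂ * (C₁ * M) := by
        rw [norm_mul, Complex.norm_real, Real.norm_eq_abs]
        gcongr
        exact ha.norm_coeff_zero_le
    _ = _ := by ring

lemma IsGrowthMultiplier.of_add {m : ℕ → ℝ} {δ : ℝ} (j : ℕ)
    (h : IsGrowthMultiplier (fun k => m (k + j)) δ) : IsGrowthMultiplier m δ := by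
  induction j generalizing m with
  | zero => exact h
  | succ j ih => exact (ih (m := fun k => m (k + 1)) h).of_succ

/-- The coefficient multiplier equal to `1` for `k < j` and to `Γ(k + A) / Γ(k + B)` for `k ≥ j`;
the pairing of two entire functions acts on homogeneous parts by such factors. -/
def gammaMultiplier (j : ℕ) (A B : ℝ) (k : ℕ) : ℝ :=
  if k < j then 1 else Real.Gamma (k + A) / Real.Gamma (k + B)

lemma gammaMultiplier_pos {j : ℕ} {A B : ℝ} (hA : 0 < j + A) (hB : 0 < j + B) (k : ℕ) :
    0 < gammaMultiplier j A B k := by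
  unfold gammaMultiplier
  split_ifs with h
  · exact one_pos
  · have : (j : ℝ) ≤ k := by exact_mod_cast not_lt.mp h
    exact div_pos (Real.Gamma_pos_of_pos (by linarith)) (Real.Gamma_pos_of_pos (by linarith))

lemma gammaMultiplier_mul_swap {j : ℕ} {A B : ℝ} (hA : 0 < j + A) (hB : 0 < j + B) (k : ℕ) :
    gammaMultiplier j A B k * gammaMultiplier j B A k = 1 := by
  unfold gammaMultiplier
  split_ifs with h
  · simp
  · have : (j : ℝ) ≤ k := by exact_mod_cast not_lt.mp h
    have hΓA := (Real.Gamma_pos_of_pos (show 0 < k + A by linarith)).ne'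
    have hΓB := (Real.Gamma_pos_of_pos (show 0 < k + B by linarith)).ne'
    field_simp

theorem isGrowthMultiplier_gammaMultiplier (j : ℕ) (A B : ℝ) :
    IsGrowthMultiplier (gammaMultiplier j A B) (2 * (A - B)) := by
  obtain ⟨N, hN⟩ := exists_nat_gt (max (1 - A) (-B))
  obtain ⟨hNA, hNB⟩ := max_lt_iff.mp hN
  refine IsGrowthMultiplier.of_add (j + N) ?_
  have := j.cast_nonneg (α := ℝ)
  have h := isGrowthMultiplier_gamma (A := j + N + A) (B := j + N + B) (by linarith) (by linarith)
  convert h using 1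
  · funext k
    rw [gammaMultiplier, if_neg (by omega)]
    push_cast
    simp only [add_assoc]
  · ring

/-! ### Radial integrals -/

section Radial
variable {E : Type*} [NormedAddCommGroup E] [NormedSpace ℝ E] [FiniteDimensional ℝ E]
  [Nontrivial E] [MeasurableSpace E] [BorelSpace E] {μ : Measure E} [μ.IsAddHaarMeasure]

lemma integral_radial_smul_homogeneous {F : E → ℂ} {m : ℕ}
    (hF : ∀ (r : ℝ) (z : E), 0 < r → F (r • z) = (r : ℂ) ^ m * F z) (φ : ℝ → ℝ) :
    ∫ z, φ ‖z‖ • F z ∂μ = (∫ ζ : Metric.sphere (0 : E) 1, F ζ ∂μ.toSphere) *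
      ((∫ r in Set.Ioi (0 : ℝ), r ^ (Module.finrank ℝ E - 1) * (φ r * r ^ m) : ℝ) : ℂ) := by
  have hpolar (z : ({0}ᶜ : Set E)) : φ ‖z.1‖ • F z =
      F (homeomorphUnitSphereProd E z).1 * ((φ ‖z.1‖ * ‖z.1‖ ^ m : ℝ) : ℂ) := by
    have hz : (0 : ℝ) < ‖z.1‖ := norm_pos_iff.mpr z.2
    have hsmul : ‖z.1‖ • ((homeomorphUnitSphereProd E z).1 : E) = z := by
      simp [smul_smul, mul_inv_cancel₀ hz.ne']
    have hFz := hF ‖z.1‖ ((homeomorphUnitSphereProd E z).1 : E) hz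
    rw [hsmul] at hFz
    rw [hFz, Complex.real_smul]
    push_cast; ring
  calc ∫ z, φ ‖z‖ • F z ∂μ
      = ∫ z : ({0}ᶜ : Set E), φ ‖z.1‖ • F z ∂(μ.comap (↑)) := by
        rw [integral_subtype_comap (measurableSet_singleton _).compl fun z => φ ‖z‖ • F z,
          restrict_compl_singleton]
    _ = ∫ x : Metric.sphere (0 : E) 1 × Set.Ioi (0 : ℝ), F x.1 * ((φ x.2 * (x.2 : ℝ) ^ m : ℝ) : ℂ)
          ∂μ.toSphere.prod (.volumeIoiPow (Module.finrank ℝ E - 1)) := by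
        rw [← μ.measurePreserving_homeomorphUnitSphereProd.integral_comp
          (Homeomorph.measurableEmbedding _)]
        refine integral_congr_ae (ae_of_all _ fun z => ?_)
        simp only [hpolar, homeomorphUnitSphereProd_apply_snd_coe]
    _ = _ := by
        rw [integral_prod_mul (fun ζ : Metric.sphere (0 : E) 1 => F ζ)
          (fun r : Set.Ioi (0 : ℝ) => ((φ r * (r : ℝ) ^ m : ℝ) : ℂ)), integral_complex_ofReal]
        congr 2
        simp only [Measure.volumeIoiPow, ENNReal.ofReal]
        rw [integral_withDensity_eq_integral_smul
            (measurable_subtype_coe.pow_const _).real_toNNReal,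
          integral_subtype_comap measurableSet_Ioi fun a =>
            Real.toNNReal (a ^ (Module.finrank ℝ E - 1)) • (φ a * a ^ m)]
        refine setIntegral_congr_fun measurableSet_Ioi fun r hr => ?_
        simp only [NNReal.smul_def]
        rw [Real.coe_toNNReal _ (pow_nonneg hr.out.le _), smul_eq_mul]

lemma integrable_norm_rpow_mul_exp {c s : ℝ} (hc : 0 < c)
    (hs : -(Module.finrank ℝ E : ℝ) < s) :
    Integrable (fun z : E => ‖z‖ ^ s * Real.exp (-c * ‖z‖ ^ 2)) μ := by
  have hfin : ((Module.finrank ℝ E - 1 : ℕ) : ℝ) = Module.finrank ℝ E - 1 := by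
    rw [Nat.cast_sub Module.finrank_pos, Nat.cast_one]
  rw [integrable_fun_norm_addHaar μ (f := fun r => r ^ s * Real.exp (-c * r ^ 2))]
  refine (integrableOn_rpow_mul_exp_neg_mul_sq hc
    (s := s + (Module.finrank ℝ E - 1)) (by linarith)).congr_fun
    (fun r (hr : 0 < r) => ?_) measurableSet_Ioi
  simp only [smul_eq_mul]
  rw [rpow_add hr, ← hfin, rpow_natCast]
  ring

lemma integrable_one_add_norm_rpow_mul_exp {c : ℝ} (hc : 0 < c) (s : ℝ) :
    Integrable (fun z : E => Real.exp (-c * ‖z‖ ^ 2) * (1 + ‖z‖) ^ s) μ := by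
  obtain ⟨C, -, h⟩ := exists_one_add_rpow_le_exp s (ε := c / 2) (by positivity)
  have hdim : (0 : ℝ) < Module.finrank ℝ E := by exact_mod_cast Module.finrank_pos
  have hgauss := (integrable_norm_rpow_mul_exp (μ := μ) (c := c / 2) (s := 0) (by positivity)
    (by linarith)).const_mul C
  refine hgauss.mono' (Measurable.aestronglyMeasurable (by fun_prop)) (ae_of_all _ fun z => ?_)
  rw [Real.norm_of_nonneg (by positivity), rpow_zero, one_mul]
  calc _ ≤ Real.exp (-c * ‖z‖ ^ 2) * (C * Real.exp (c / 2 * ‖z‖ ^ 2)) := by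
        gcongr; exact h _ (norm_nonneg z)
    _ = C * (Real.exp (-c * ‖z‖ ^ 2) * Real.exp (c / 2 * ‖z‖ ^ 2)) := by ring
    _ = _ := by rw [← Real.exp_add]; congr 2; ring

end Radial

variable {n : ℕ}

lemma finrank_Cn (n : ℕ) : Module.finrank ℝ (Cn n) = 2 * n := by
  rw [← Module.finrank_mul_finrank ℝ ℂ (Cn n)]
  simp

lemma cast_finrank_Cn (n : ℕ) : (Module.finrank ℝ (Cn n) : ℝ) = 2 * n := by
  rw [finrank_Cn]; push_cast; rfl

instance isAddHaarMeasure_V (n : ℕ) : (V n).IsAddHaarMeasure := by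
  unfold V
  exact Measure.IsAddHaarMeasure.smul _ (by
    simp only [ne_eq, ENNReal.ofReal_eq_zero, inv_nonpos, not_le]; positivity) ENNReal.ofReal_ne_top

lemma integral_exp_neg_norm_sq (n : ℕ) : ∫ z, Real.exp (-‖z‖ ^ 2) ∂(V n) = 1 := by
  have h := GaussianFourier.integral_rexp_neg_mul_sq_norm (V := Cn n) one_pos
  simp only [neg_mul, one_mul, div_one, finrank_Cn] at h
  rw [V, integral_smul_measure, h, ENNReal.toReal_ofReal (by positivity)]
  push_cast
  rw [mul_div_cancel_left₀ _ two_ne_zero, rpow_natCast, smul_eq_mul,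
    inv_mul_cancel₀ (by positivity)]

lemma integral_radial_moment [NeZero n] {k : ℕ} {γ : ℝ} (hk : 0 < k + (n - γ / 2)) :
    ∫ r in Set.Ioi (0 : ℝ), r ^ (2 * n - 1) * ((r ^ (-γ) * Real.exp (-r ^ 2)) * r ^ (2 * k))
      = Real.Gamma (k + (n - γ / 2)) / 2 := by
  have hΓ := integral_rpow_mul_exp_neg_rpow (p := 2) (q := 2 * (k + (n - γ / 2)) - 1) two_pos
    (by linarith)
  rw [show (2 * (k + (n - γ / 2)) - 1 + 1) / 2 = k + (n - γ / 2) by ring] at hΓ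
  rw [div_eq_inv_mul, inv_eq_one_div, ← hΓ]
  refine setIntegral_congr_fun measurableSet_Ioi fun r (hr : 0 < r) => ?_
  have hpow : ((2 * n - 1 : ℕ) : ℝ) = 2 * n - 1 := by
    rw [Nat.cast_sub (by have := NeZero.pos n; omega)]; push_cast; ring
  rw [← rpow_natCast r (2 * n - 1), ← rpow_natCast r (2 * k), hpow, ← rpow_two,
    show 2 * (k + (n - γ / 2)) - 1 = (2 * n - 1) + (-γ) + ((2 * k : ℕ) : ℝ) by push_cast; ring,
    rpow_add hr, rpow_add hr]
  ring

lemma measurePreserving_unit_smul {l : ℂ} (hl : ‖l‖ = 1) :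
    MeasurePreserving (fun z : Cn n => l • z) (V n) (V n) := by
  have hl0 : l ≠ 0 := norm_ne_zero_iff.mp (by simp [hl])
  let e : Cn n ≃ₗᵢ[ℝ] Cn n :=
    { (LinearEquiv.smulOfNeZero ℂ (Cn n) l hl0).restrictScalars ℝ with
      norm_map' := fun z => by
        change ‖l • z‖ = ‖z‖
        rw [norm_smul, hl, one_mul] }
  exact (LinearIsometryEquiv.measurePreserving e).smul_measure _

lemma integral_unit_smul {E : Type*} [NormedAddCommGroup E] [NormedSpace ℝ E] {l : ℂ}
    (hl : ‖l‖ = 1) (F : Cn n → E) : ∫ z, F (l • z) ∂(V n) = ∫ z, F z ∂(V n) :=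
  (measurePreserving_unit_smul hl).integral_comp
    (Homeomorph.smulOfNeZero l (norm_ne_zero_iff.mp (by simp [hl]))).measurableEmbedding F

lemma integrable_comp_circleMap_smul {E : Type*} [NormedAddCommGroup E] {F : Cn n → E}
    (hF : Integrable F (V n)) :
    Integrable (fun x : ℝ × Cn n => F (circleMap 0 1 x.1 • x.2))
      ((volume.restrict (Set.Ioc 0 (2 * π))).prod (V n)) := by
  have hcont : Continuous fun x : ℝ × Cn n => circleMap 0 1 x.1 • x.2 :=
    ((continuous_circleMap 0 1).comp continuous_fst).smul continuous_snd
  have hmp := MeasurePreserving.skew_product (g := fun θ (z : Cn n) => circleMap 0 1 θ • z)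
    (MeasurePreserving.id (volume.restrict (Set.Ioc 0 (2 * π)))) hcont.measurable
    (ae_of_all _ fun θ => (measurePreserving_unit_smul (n := n) (l := circleMap 0 1 θ)
      (by simp)).map_eq)
  exact hmp.integrable_comp_of_integrable (hF.comp_snd _)

lemma integrable_circleAverage {E : Type*} [NormedAddCommGroup E] [NormedSpace ℝ E]
    {F : Cn n → E} (hF : Integrable F (V n)) :
    Integrable (fun z => Real.circleAverage (fun l => F (l • z)) 0 1) (V n) := by
  simp only [Real.circleAverage_def, intervalIntegral.integral_of_le two_pi_pos.le]
  exact (integrable_comp_circleMap_smul hF).integral_prod_right.smul _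

lemma integral_circleAverage {E : Type*} [NormedAddCommGroup E] [NormedSpace ℝ E]
    [CompleteSpace E] {F : Cn n → E} (hF : Integrable F (V n)) :
    ∫ z, Real.circleAverage (fun l => F (l • z)) 0 1 ∂(V n) = ∫ z, F z ∂(V n) := by
  simp only [Real.circleAverage_def, intervalIntegral.integral_of_le two_pi_pos.le]
  rw [integral_smul, ← integral_integral_swap (integrable_comp_circleMap_smul hF)]
  have hrot (θ : ℝ) : ∫ z, F (circleMap 0 1 θ • z) ∂(V n) = ∫ z, F z ∂(V n) :=
    integral_unit_smul (by simp) F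
  simp only [hrot]
  rw [integral_const, smul_smul, measureReal_restrict_apply_univ,
    Real.volume_real_Ioc_of_le two_pi_pos.le, sub_zero, inv_mul_cancel₀ two_pi_pos.ne', one_smul]

lemma integral_W (γ : ℝ) (F : Cn n → ℂ) :
    ∫ z, F z ∂(W n γ) = ∫ z, (‖z‖ ^ (-γ) : ℝ) • F z ∂(V n) := by
  rw [W, integral_withDensity_eq_integral_toReal_smul (by fun_prop) (by simp)]
  refine integral_congr_ae (ae_of_all _ fun z => ?_)
  simp only [ENNReal.toReal_ofReal (rpow_nonneg (norm_nonneg z) (-γ))]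

lemma integrable_W (γ : ℝ) (F : Cn n → ℂ) :
    Integrable F (W n γ) ↔ Integrable (fun z => (‖z‖ ^ (-γ) : ℝ) • F z) (V n) := by
  rw [W, integrable_withDensity_iff_integrable_smul₀' (by fun_prop) (by simp)]
  refine integrable_congr (ae_of_all _ fun z => ?_)
  simp only [ENNReal.toReal_ofReal (rpow_nonneg (norm_nonneg z) (-γ))]

/-! ### Entire functions given by moments -/

/-- `f` is the sum of an everywhere convergent power series at the origin. Formally stronger than
`Differentiable ℂ f`, since for `n > 1` no Osgood lemma is at hand. -/
def IsEntire (f : Cn n → ℂ) : Prop :=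
  ∃ p : FormalMultilinearSeries ℂ (Cn n) ℂ, HasFPowerSeriesOnBall f p 0 ⊤

lemma homogPart_smul (f : Cn n → ℂ) (k : ℕ) (l : ℂ) (z : Cn n) :
    homogPart f k (l • z) = l ^ k * homogPart f k z := by
  unfold homogPart
  have := (iteratedFDeriv ℂ k f 0).map_smul_univ (fun _ => l) (fun _ => z)
  rw [this]
  simp [mul_div_assoc]

lemma differentiable_homogPart (f : Cn n → ℂ) (k : ℕ) : Differentiable ℂ (homogPart f k) := by
  have h : Differentiable ℂ (fun z : Cn n => iteratedFDeriv ℂ k f 0 fun _ => z) := fun z =>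
    DifferentiableAt.comp z
      (ContinuousMultilinearMap.hasFDerivAt (iteratedFDeriv ℂ k f 0) fun _ => z).differentiableAt
      (differentiableAt_pi.mpr fun _ => differentiableAt_id)
  simpa only [homogPart, div_eq_mul_inv] using! h.mul_const ((k.factorial : ℂ)⁻¹)

namespace IsEntire
variable {f : Cn n → ℂ}

lemma homogPart_eq {p : FormalMultilinearSeries ℂ (Cn n) ℂ} (hp : HasFPowerSeriesOnBall f p 0 ⊤)
    (k : ℕ) (z : Cn n) : homogPart f k z = p k fun _ => z := by
  have h := hp.factorial_smul z k
  have hk : (k.factorial : ℂ) ≠ 0 := by exact_mod_cast k.factorial_ne_zero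
  rw [homogPart, ← h, nsmul_eq_mul, mul_div_cancel_left₀ _ hk]

lemma differentiable (hf : IsEntire f) : Differentiable ℂ f := by
  obtain ⟨p, hp⟩ := hf
  intro z
  exact (hp.analyticAt_of_mem (by simp)).differentiableAt

lemma hasSum (hf : IsEntire f) (z : Cn n) : HasSum (fun k => homogPart f k z) (f z) := by
  obtain ⟨p, hp⟩ := hf
  have := hp.hasSum (y := z) (by simp)
  rw [zero_add] at this
  exact this.congr_fun fun k => homogPart_eq hp k z

lemma hasSum_smul (hf : IsEntire f) (l : ℂ) (z : Cn n) :
    HasSum (fun k => homogPart f k z * l ^ k) (f (l • z)) :=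
  (hf.hasSum (l • z)).congr_fun fun k => by rw [homogPart_smul, mul_comm]

lemma summable (hf : IsEntire f) (z : Cn n) : Summable fun k => ‖homogPart f k z‖ := by
  obtain ⟨p, hp⟩ := hf
  have h := p.summable_norm_apply (x := z) (by rw [top_le_iff.mp hp.r_le]; simp)
  exact h.congr fun k => by rw [homogPart_eq hp k z]

lemma circleAverage_conj_pow_mul (hf : IsEntire f) (k : ℕ) (z : Cn n) :
    Real.circleAverage (fun l => conj l ^ k * f (l • z)) 0 1 = homogPart f k z :=
  FockDuality.circleAverage_conj_pow_mul (F := fun l => f (l • z)) (hf.summable z)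
    (fun l _ => hf.hasSum_smul l z) k

lemma homogPart_eq_of_hasSum (hf : IsEntire f) {a : ℕ → ℂ} {z : Cn n}
    (ha : Summable fun k => ‖a k‖)
    (h : ∀ l : ℂ, ‖l‖ = 1 → HasSum (fun k => a k * l ^ k) (f (l • z))) (k : ℕ) :
    homogPart f k z = a k := by
  rw [← hf.circleAverage_conj_pow_mul k z,
    FockDuality.circleAverage_conj_pow_mul (F := fun l => f (l • z)) ha h k]

lemma homogPart_of_homogeneous (hf : IsEntire f) {j : ℕ}
    (hj : ∀ (l : ℂ) (z : Cn n), f (l • z) = l ^ j * f z) (k : ℕ) (z : Cn n) :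
    homogPart f k z = if k = j then f z else 0 := by
  refine hf.homogPart_eq_of_hasSum (a := fun k => if k = j then f z else 0)
    (summable_of_ne_finset_zero (s := {j}) fun k hk => by simp_all) (fun l _ => ?_) k
  rw [hj]
  have := hasSum_ite_eq j (f z * l ^ j)
  rw [mul_comm]
  exact this.congr_fun fun k => by split_ifs with h <;> simp [h]

end IsEntire

/-- The power series `∑ₖ (1/k!) ∑ₛ m(k, s) z_{s(1)} ⋯ z_{s(k)}`. -/
def momentSeries (m : (k : ℕ) → (Fin k → Fin n) → ℂ) : FormalMultilinearSeries ℂ (Cn n) ℂ :=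
  fun k => ((k.factorial : ℂ)⁻¹) • ∑ s, m k s •
    (ContinuousMultilinearMap.mkPiAlgebra ℂ (Fin k) ℂ).compContinuousLinearMap
      fun j => (EuclideanSpace.proj (s j) : Cn n →L[ℂ] ℂ)

lemma momentSeries_apply (m : (k : ℕ) → (Fin k → Fin n) → ℂ) (k : ℕ) (z : Cn n) :
    momentSeries m k (fun _ => z) = (k.factorial : ℂ)⁻¹ * ∑ s, m k s * ∏ j, z (s j) := by
  simp [momentSeries]

/-- The moments grow more slowly than `k! R^{-k}` for every `R`. -/
def MomentBound (m : (k : ℕ) → (Fin k → Fin n) → ℂ) : Prop :=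
  ∀ R : ℝ, 0 < R → ∃ C : ℝ, ∀ k s, ‖m k s‖ * R ^ k ≤ C * k.factorial

lemma norm_momentSeries_le (m : (k : ℕ) → (Fin k → Fin n) → ℂ) (k : ℕ) :
    ‖momentSeries m k‖ ≤ (k.factorial : ℝ)⁻¹ * ∑ s, ‖m k s‖ := by
  rw [momentSeries, norm_smul, norm_inv, Complex.norm_natCast]
  gcongr
  refine norm_sum_le_of_le _ fun s _ => ?_
  rw [norm_smul]
  refine mul_le_of_le_one_right (norm_nonneg _) ?_
  refine (ContinuousMultilinearMap.norm_compContinuousLinearMap_le _ _).trans ?_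
  rw [ContinuousMultilinearMap.norm_mkPiAlgebra, one_mul]
  refine Finset.prod_le_one (fun _ _ => norm_nonneg _) fun j _ => ?_
  refine ContinuousLinearMap.opNorm_le_bound _ zero_le_one fun z => ?_
  rw [one_mul]
  exact PiLp.norm_apply_le z (s j)

lemma MomentBound.radius_eq_top [NeZero n] {m : (k : ℕ) → (Fin k → Fin n) → ℂ}
    (hm : MomentBound m) : (momentSeries m).radius = ⊤ := by
  refine ENNReal.eq_top_of_forall_nnreal_le fun r => ?_
  have hn : (0 : ℝ) < n := by exact_mod_cast NeZero.pos n
  obtain ⟨C, hC⟩ := hm (n * (r + 1)) (by positivity)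
  refine (momentSeries m).le_radius_of_bound C fun k => ?_
  have hbound (s : Fin k → Fin n) : ‖m k s‖ ≤ C * k.factorial / (n * (r + 1)) ^ k := by
    rw [le_div_iff₀ (by positivity)]; exact hC k s
  calc ‖momentSeries m k‖ * (r : ℝ) ^ k
      ≤ ‖momentSeries m k‖ * (r + 1 : ℝ) ^ k := by gcongr; linarith
    _ ≤ ((k.factorial : ℝ)⁻¹ * ∑ _s : Fin k → Fin n, C * k.factorial / (n * (r + 1)) ^ k) *
          (r + 1) ^ k := by
        gcongr
        refine (norm_momentSeries_le m k).trans ?_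
        gcongr with s
        exact hbound s
    _ = C := by
        have : (r : ℝ) + 1 ≠ 0 := by positivity
        simp only [Finset.sum_const, Finset.card_univ, Fintype.card_pi, Fintype.card_fin,
          Finset.prod_const, nsmul_eq_mul, Nat.cast_pow, mul_pow]
        field_simp

lemma MomentBound.hasFPowerSeriesOnBall [NeZero n] {m : (k : ℕ) → (Fin k → Fin n) → ℂ}
    (hm : MomentBound m) : HasFPowerSeriesOnBall (momentSeries m).sum (momentSeries m) 0 ⊤ :=
  hm.radius_eq_top ▸ (momentSeries m).hasFPowerSeriesOnBall (by simp [hm.radius_eq_top])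

lemma MomentBound.isEntire [NeZero n] {m : (k : ℕ) → (Fin k → Fin n) → ℂ} (hm : MomentBound m) :
    IsEntire (momentSeries m).sum := ⟨_, hm.hasFPowerSeriesOnBall⟩

lemma MomentBound.homogPart_sum [NeZero n] {m : (k : ℕ) → (Fin k → Fin n) → ℂ}
    (hm : MomentBound m) (k : ℕ) (z : Cn n) :
    homogPart (momentSeries m).sum k z = (k.factorial : ℂ)⁻¹ * ∑ s, m k s * ∏ j, z (s j) := by
  rw [IsEntire.homogPart_eq hm.hasFPowerSeriesOnBall, momentSeries_apply]

/-- `|f(z)| e^{-|z|²/2} (1 + |z|)^{-α}`. -/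
def weightedAbs (α : ℝ) (f : Cn n → ℂ) (z : Cn n) : ℝ :=
  ‖f z‖ * (Real.exp (-‖z‖ ^ 2 / 2) * (1 + ‖z‖) ^ (-α))

lemma weightedAbs_nonneg (α : ℝ) (f : Cn n → ℂ) (z : Cn n) : 0 ≤ weightedAbs α f z := by
  unfold weightedAbs; positivity

lemma weightedAbs_eq_div (α : ℝ) (f : Cn n → ℂ) (z : Cn n) :
    weightedAbs α f z = ‖f z‖ / growth α ‖z‖ := by
  rw [weightedAbs, growth, rpow_neg (by positivity), neg_div, Real.exp_neg, ← mul_inv]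
  exact (div_eq_mul_inv _ _).symm

lemma weightedAbs_le_iff {α : ℝ} {f : Cn n → ℂ} {z : Cn n} {M : ℝ} :
    weightedAbs α f z ≤ M ↔ ‖f z‖ ≤ M * growth α ‖z‖ := by
  rw [weightedAbs_eq_div, div_le_iff₀ (growth_pos (norm_nonneg z))]

lemma continuous_weightedAbs (α : ℝ) {f : Cn n → ℂ} (hf : Continuous f) :
    Continuous (weightedAbs α f) := by
  unfold weightedAbs
  refine hf.norm.mul (Continuous.mul (by fun_prop) ?_)
  exact (continuous_const.add continuous_norm).rpow_const fun z =>
    Or.inl (show 1 + ‖z‖ ≠ 0 by positivity)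

lemma norm_gaussWeighted (f : Cn n → ℂ) (z : Cn n) :
    ‖gaussWeighted f z‖ = ‖f z‖ * Real.exp (-‖z‖ ^ 2 / 2) := by
  rw [gaussWeighted, norm_mul, Complex.norm_real, Real.norm_of_nonneg (Real.exp_pos _).le]

lemma norm_gaussWeightedInf (α : ℝ) (f : Cn n → ℂ) (z : Cn n) :
    ‖gaussWeightedInf α f z‖ = weightedAbs α f z := by
  rw [gaussWeightedInf, norm_mul, norm_gaussWeighted, Complex.norm_real,
    Real.norm_of_nonneg (by positivity), weightedAbs, mul_assoc]

lemma continuous_gaussWeighted {f : Cn n → ℂ} (hf : Continuous f) :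
    Continuous (gaussWeighted f) := by
  unfold gaussWeighted
  exact hf.mul (Complex.continuous_ofReal.comp (by fun_prop))

lemma continuous_gaussWeightedInf (α : ℝ) {f : Cn n → ℂ} (hf : Continuous f) :
    Continuous (gaussWeightedInf α f) := by
  unfold gaussWeightedInf
  refine (continuous_gaussWeighted hf).mul (Complex.continuous_ofReal.comp ?_)
  exact (continuous_const.add continuous_norm).rpow_const fun z =>
    Or.inl (show 1 + ‖z‖ ≠ 0 by positivity)

lemma weightedAbs_rpow_eq {p α : ℝ} (f : Cn n → ℂ) (z : Cn n) :
    weightedAbs α f z ^ p = (1 + ‖z‖) ^ (-(α * p)) * ‖gaussWeighted f z‖ ^ p := by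
  rw [weightedAbs, norm_gaussWeighted, ← mul_assoc, mul_rpow (by positivity) (by positivity),
    ← rpow_mul (by positivity), neg_mul, mul_comm]

lemma integrable_weightedV {α : ℝ} (g : Cn n → ℝ) :
    Integrable g (weightedV n α) ↔ Integrable (fun z => (1 + ‖z‖) ^ (-α) * g z) (V n) := by
  rw [weightedV, integrable_withDensity_iff_integrable_smul₀' (by fun_prop) (by simp)]
  refine integrable_congr (ae_of_all _ fun z => ?_)
  simp only
  rw [ENNReal.toReal_ofReal (by positivity), smul_eq_mul]

lemma integral_weightedV {α : ℝ} (g : Cn n → ℝ) :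
    ∫ z, g z ∂(weightedV n α) = ∫ z, (1 + ‖z‖) ^ (-α) * g z ∂(V n) := by
  rw [weightedV, integral_withDensity_eq_integral_toReal_smul (by fun_prop) (by simp)]
  refine integral_congr_ae (ae_of_all _ fun z => ?_)
  simp only
  rw [ENNReal.toReal_ofReal (by positivity), smul_eq_mul]

lemma mem_FockSpace_iff {p α : ℝ} (hp : 0 < p) {f : Cn n → ℂ} :
    f ∈ FockSpace n p (α * p) ↔
      Differentiable ℂ f ∧ Integrable (fun z => weightedAbs α f z ^ p) (V n) := by
  have : f ∈ FockSpace n p (α * p) ↔ Differentiable ℂ f ∧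
    MemLp (gaussWeighted f) (ENNReal.ofReal p) (weightedV n (α * p)) := Iff.rfl
  rw [this]
  refine and_congr_right fun hf => ?_
  rw [← integrable_norm_rpow_iff (continuous_gaussWeighted hf.continuous).aestronglyMeasurable
    (by simpa using hp) ENNReal.ofReal_ne_top, ENNReal.toReal_ofReal hp.le, integrable_weightedV]
  simp_rw [weightedAbs_rpow_eq]

lemma fockNorm_eq {p α : ℝ} (hp : 0 < p) (f : FockSpace n p (α * p)) :
    fockNorm f = (∫ z, weightedAbs α (f : Cn n → ℂ) z ^ p ∂(V n)) ^ p⁻¹ := by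
  rw [fockNorm, MemLp.eLpNorm_eq_integral_rpow_norm (by simpa using hp) ENNReal.ofReal_ne_top f.2.2,
    ENNReal.toReal_ofReal (by positivity), ENNReal.toReal_ofReal hp.le, integral_weightedV]
  simp_rw [weightedAbs_rpow_eq]

lemma fockNorm_nonneg {p α : ℝ} (f : FockSpace n p α) : 0 ≤ fockNorm f := ENNReal.toReal_nonneg

lemma fockNorm_rpow {p α : ℝ} (hp : 0 < p) (f : FockSpace n p (α * p)) :
    fockNorm f ^ p = ∫ z, weightedAbs α (f : Cn n → ℂ) z ^ p ∂(V n) := by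
  have hnonneg : 0 ≤ ∫ z, weightedAbs α (f : Cn n → ℂ) z ^ p ∂(V n) :=
    integral_nonneg fun z => rpow_nonneg (weightedAbs_nonneg _ _ _) _
  rw [fockNorm_eq hp, ← rpow_mul hnonneg, inv_mul_cancel₀ hp.ne', rpow_one]

lemma fockNorm_smul {p α : ℝ} (c : ℂ) (f : FockSpace n p α) :
    fockNorm (c • f) = ‖c‖ * fockNorm f := by
  have : gaussWeighted ((c • f : FockSpace n p α) : Cn n → ℂ) =
      c • gaussWeighted (f : Cn n → ℂ) := by
    funext z; simp [gaussWeighted, mul_assoc]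
  rw [fockNorm, this, eLpNorm_const_smul, ENNReal.toReal_mul, fockNorm]
  simp

lemma mem_FockSpaceInf_of_le {β M : ℝ} {g : Cn n → ℂ} (hg : Differentiable ℂ g)
    (hM : ∀ z, weightedAbs β g z ≤ M) : g ∈ FockSpaceInf n β := by
  refine ⟨hg, memLp_top_of_bound
    (continuous_gaussWeightedInf β hg.continuous).aestronglyMeasurable M (ae_of_all _ fun z => ?_)⟩
  rw [norm_gaussWeightedInf]; exact hM z

lemma weightedAbs_le_fockNormInf {β : ℝ} (g : FockSpaceInf n β) (z : Cn n) :
    weightedAbs β (g : Cn n → ℂ) z ≤ fockNormInf g := by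
  have hae : ∀ᵐ z ∂(V n), weightedAbs β (g : Cn n → ℂ) z ≤ fockNormInf g := by
    filter_upwards [ae_le_eLpNormEssSup (f := gaussWeightedInf β (g : Cn n → ℂ)) (μ := V n)]
      with z hz
    have hfin := g.2.2.eLpNorm_ne_top
    rw [← eLpNorm_exponent_top] at hz
    rw [← norm_gaussWeightedInf, fockNormInf, ← ENNReal.ofReal_le_iff_le_toReal hfin, ofReal_norm]
    exact hz
  have hclosed : IsClosed {z | weightedAbs β (g : Cn n → ℂ) z ≤ fockNormInf g} :=
    isClosed_le (continuous_weightedAbs β g.2.1.continuous) continuous_const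
  exact hclosed.closure_eq.subset (Measure.dense_of_ae hae z)

lemma fockNormInf_le {β M : ℝ} (hM : 0 ≤ M) (g : FockSpaceInf n β)
    (h : ∀ z, weightedAbs β (g : Cn n → ℂ) z ≤ M) : fockNormInf g ≤ M := by
  rw [fockNormInf, eLpNorm_exponent_top]
  refine ENNReal.toReal_le_of_le_ofReal hM (eLpNormEssSup_le_of_ae_bound (ae_of_all _ fun z => ?_))
  rw [norm_gaussWeightedInf]; exact h z

/-! ### Pointwise estimates -/

lemma circleAverage_mono_of_codiscreteWithin {g h : ℂ → ℝ} {c : ℂ} {R : ℝ} (hR : R ≠ 0)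
    (hg : CircleIntegrable g c R) (hh : CircleIntegrable h c R)
    (hle : ∀ᶠ l in codiscreteWithin (Metric.sphere c |R|), g l ≤ h l) :
    circleAverage g c R ≤ circleAverage h c R := by
  have hmin : g =ᶠ[codiscreteWithin (Metric.sphere c |R|)] fun l => min (g l) (h l) :=
    hle.mono fun l hl => (min_eq_left hl).symm
  rw [circleAverage_congr_codiscreteWithin hmin hR]
  exact circleAverage_mono (hg.congr_codiscreteWithin hmin) hh fun _ _ => min_le_right _ _

lemma log_norm_le_circleAverage {F : ℂ → ℂ} {c : ℂ} {R : ℝ} (hR : 0 < R)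
    (hF : AnalyticOnNhd ℂ F (Metric.closedBall c |R|)) (hc : F c ≠ 0) :
    Real.log ‖F c‖ ≤ circleAverage (fun l => Real.log ‖F l‖) c R := by
  rw [hF.circleAverage_log_norm hR.ne' hc]
  refine le_add_of_nonneg_left (finsum_nonneg fun u => ?_)
  by_cases hu : u ∈ Metric.closedBall c |R|
  · have hdiv := MeromorphicOn.AnalyticOnNhd.divisor_nonneg hF u
    refine mul_nonneg (by exact_mod_cast hdiv) ?_
    have hcu : ‖c - u‖ ≤ R := by
      simpa [dist_comm, abs_of_pos hR, dist_eq_norm] using Metric.mem_closedBall.mp hu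
    rcases eq_or_ne c u with rfl | hne
    · simp
    · rw [← div_eq_mul_inv]
      exact Real.log_nonneg ((one_le_div (norm_sub_pos_iff.mpr hne)).mpr hcu)
  · rw [Function.locallyFinsuppWithin.apply_eq_zero_of_notMem _ hu, Int.cast_zero, zero_mul]

/-- The tangent line inequality `1 + p (log |F l| - log |F c|) ≤ |F l|^p / |F c|^p` deduces this
from the subharmonicity of `log |F|`; it only has to hold off the zeros of `F`. -/
lemma norm_rpow_le_circleAverage {F : ℂ → ℂ} (hF : Differentiable ℂ F) {c : ℂ} {R p : ℝ}
    (hR : 0 < R) (hp : 0 < p) : ‖F c‖ ^ p ≤ circleAverage (fun l => ‖F l‖ ^ p) c R := by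
  by_cases hc : F c = 0
  · rw [hc, norm_zero, zero_rpow hp.ne']
    exact circleAverage_nonneg_of_nonneg fun l _ => by positivity
  have hpos : 0 < ‖F c‖ := norm_pos_iff.mpr hc
  have han : AnalyticOnNhd ℂ F Set.univ := fun z _ => hF.analyticAt z
  set b : ℝ := ‖F c‖ ^ p * p
  set a : ℝ := ‖F c‖ ^ p - b * Real.log ‖F c‖
  have htangent {l : ℂ} (hl : F l ≠ 0) : a + b * Real.log ‖F l‖ ≤ ‖F l‖ ^ p := by
    have hFl : 0 < ‖F l‖ := norm_pos_iff.mpr hl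
    have hlog := Real.log_le_sub_one_of_pos (show 0 < ‖F l‖ ^ p / ‖F c‖ ^ p by positivity)
    rw [Real.log_div (by positivity) (by positivity), Real.log_rpow hFl, Real.log_rpow hpos,
      le_sub_iff_add_le, le_div_iff₀ (by positivity)] at hlog
    linarith
  have hoff : ∀ᶠ l in codiscreteWithin (Metric.sphere c |R|), F l ≠ 0 := by
    filter_upwards [codiscreteWithin_mono (Set.subset_univ _)
      (han.preimage_zero_mem_codiscrete hc)] with l hl using by simpa using hl
  have hlogint : CircleIntegrable (fun l => b * Real.log ‖F l‖) c R :=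
    (MeromorphicOn.circleIntegrable_log_norm
      (han.mono (Set.subset_univ _)).meromorphicOn).const_smul (a := b)
  have hconst : CircleIntegrable (fun _ : ℂ => a) c R := circleIntegrable_const _ _ _
  have hpowint : CircleIntegrable (fun l => ‖F l‖ ^ p) c R :=
    (hF.continuous.norm.rpow_const fun _ => Or.inr hp.le).continuousOn.circleIntegrable hR.le
  calc ‖F c‖ ^ p = a + b * Real.log ‖F c‖ := by ring
    _ ≤ a + b * circleAverage (fun l => Real.log ‖F l‖) c R := by
        gcongr
        exact log_norm_le_circleAverage hR (han.mono (Set.subset_univ _)) hc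
    _ = circleAverage (fun l => a + b * Real.log ‖F l‖) c R := by
        rw [circleAverage_fun_add hconst hlogint, circleAverage_const, ← smul_eq_mul,
          ← circleAverage_fun_smul]
        rfl
    _ ≤ circleAverage (fun l => ‖F l‖ ^ p) c R :=
        circleAverage_mono_of_codiscreteWithin hR.ne' (hconst.add hlogint) hpowint
          (hoff.mono fun _ => htangent)

lemma differentiable_inner_right (w : Cn n) : Differentiable ℂ fun z : Cn n => inner ℂ w z :=
  (innerSL ℂ w).differentiable

/-- The translate of `f` by `z`, twisted so that it stays entire: up to the constant factor
`e^{-|z|²/2}` this is the Weyl operator of `z`, an isometry of the unweighted Fock spaces. -/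
def weylTranslate (z : Cn n) (f : Cn n → ℂ) (u : Cn n) : ℂ :=
  f (z + u) * Complex.exp (-inner ℂ z u)

lemma weylTranslate_zero (z : Cn n) (f : Cn n → ℂ) : weylTranslate z f 0 = f z := by
  simp [weylTranslate]

lemma differentiable_weylTranslate (z : Cn n) {f : Cn n → ℂ} (hf : Differentiable ℂ f) :
    Differentiable ℂ (weylTranslate z f) :=
  (hf.comp ((differentiable_const z).add differentiable_id)).mul
    (differentiable_inner_right z).neg.cexp

lemma norm_weylTranslate_mul_exp (z : Cn n) (f : Cn n → ℂ) (u : Cn n) :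
    ‖weylTranslate z f u‖ * Real.exp (-‖u‖ ^ 2 / 2) =
      Real.exp (‖z‖ ^ 2 / 2) * (‖f (z + u)‖ * Real.exp (-‖z + u‖ ^ 2 / 2)) := by
  have hexpand := norm_add_sq (𝕜 := ℂ) z u
  simp only [RCLike.re_to_complex] at hexpand
  rw [weylTranslate, norm_mul, Complex.norm_exp, mul_assoc, mul_left_comm (Real.exp _) ‖_‖,
    ← Real.exp_add, ← Real.exp_add, hexpand, Complex.neg_re]
  congr 2; ring

lemma weightedAbs_weylTranslate_le (α : ℝ) (z : Cn n) (f : Cn n → ℂ) (u : Cn n) :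
    weightedAbs |α| (weylTranslate z f) u ≤ growth α ‖z‖ * weightedAbs α f (z + u) := by
  have hpeetre : (1 + ‖u‖) ^ (-|α|) ≤ (1 + ‖z‖) ^ α * (1 + ‖z + u‖) ^ (-α) := by
    rw [rpow_neg (by positivity), rpow_neg (by positivity), ← div_eq_mul_inv,
      inv_le_comm₀ (by positivity) (by positivity), inv_div, div_le_iff₀' (by positivity)]
    exact one_add_rpow_le_mul α (norm_nonneg _) (norm_nonneg _)
      (by simpa using abs_norm_sub_norm_le (z + u) z)
  calc weightedAbs |α| (weylTranslate z f) u
      = Real.exp (‖z‖ ^ 2 / 2) * (‖f (z + u)‖ * Real.exp (-‖z + u‖ ^ 2 / 2)) *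
          (1 + ‖u‖) ^ (-|α|) := by
        rw [weightedAbs, ← mul_assoc, norm_weylTranslate_mul_exp]
    _ ≤ Real.exp (‖z‖ ^ 2 / 2) * (‖f (z + u)‖ * Real.exp (-‖z + u‖ ^ 2 / 2)) *
          ((1 + ‖z‖) ^ α * (1 + ‖z + u‖) ^ (-α)) := by gcongr
    _ = _ := by rw [growth, weightedAbs]; ring

lemma weightedAbs_weylTranslate_le' (α : ℝ) (z : Cn n) (f : Cn n → ℂ) (u : Cn n) :
    weightedAbs α (weylTranslate z f) u ≤ growth (-α) ‖z‖ * weightedAbs (-|α|) f (z + u) := by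
  have hpeetre : (1 + ‖u‖) ^ (-α) ≤ (1 + ‖z‖) ^ (-α) * (1 + ‖z + u‖) ^ |α| := by
    rw [← abs_neg α]
    exact one_add_rpow_le_mul (-α) (norm_nonneg _) (norm_nonneg _)
      (by simpa [add_comm] using abs_norm_sub_norm_le u (-z))
  calc weightedAbs α (weylTranslate z f) u
      = Real.exp (‖z‖ ^ 2 / 2) * (‖f (z + u)‖ * Real.exp (-‖z + u‖ ^ 2 / 2)) *
          (1 + ‖u‖) ^ (-α) := by
        rw [weightedAbs, ← mul_assoc, norm_weylTranslate_mul_exp]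
    _ ≤ Real.exp (‖z‖ ^ 2 / 2) * (‖f (z + u)‖ * Real.exp (-‖z + u‖ ^ 2 / 2)) *
          ((1 + ‖z‖) ^ (-α) * (1 + ‖z + u‖) ^ |α|) := by gcongr
    _ = _ := by rw [growth, weightedAbs, neg_neg]; ring

lemma integrable_weightedAbs_one_rpow [NeZero n] {p : ℝ} (hp : 0 < p) (s : ℝ) :
    Integrable (fun u : Cn n => weightedAbs s 1 u ^ p) (V n) := by
  refine (integrable_one_add_norm_rpow_mul_exp (c := p / 2) (by positivity) (-s * p)).congr
    (ae_of_all _ fun u => ?_)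
  simp only [weightedAbs, Pi.one_apply, norm_one, one_mul]
  rw [mul_rpow (by positivity) (by positivity), ← Real.exp_mul, ← rpow_mul (by positivity)]
  congr 2; ring

lemma integral_weightedAbs_one_rpow_pos [NeZero n] {p : ℝ} (hp : 0 < p) (s : ℝ) :
    0 < ∫ u : Cn n, weightedAbs s 1 u ^ p ∂(V n) := by
  have hpos (u : Cn n) : 0 < weightedAbs s 1 u ^ p := by
    simp only [weightedAbs, Pi.one_apply, norm_one, one_mul]; positivity
  rw [integral_pos_iff_support_of_nonneg (fun u => (hpos u).le)
    (integrable_weightedAbs_one_rpow hp s), Set.eq_univ_of_forall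
      (s := Function.support _) fun u => (hpos u).ne']
  exact Measure.measure_univ_pos.mpr (NeZero.ne (V n))

lemma norm_zero_rpow_mul_integral_le [NeZero n] {p s : ℝ} (hp : 0 < p) {f : Cn n → ℂ}
    (hf : Differentiable ℂ f) (hint : Integrable (fun u => weightedAbs s f u ^ p) (V n)) :
    ‖f 0‖ ^ p * ∫ u : Cn n, weightedAbs s 1 u ^ p ∂(V n) ≤ ∫ u, weightedAbs s f u ^ p ∂(V n) := by
  have hsub (u : Cn n) : ‖f 0‖ ^ p * weightedAbs s 1 u ^ p ≤
      circleAverage (fun l => weightedAbs s f (l • u) ^ p) 0 1 := by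
    have hrot : circleAverage (fun l => weightedAbs s f (l • u) ^ p) 0 1 =
        weightedAbs s 1 u ^ p * circleAverage (fun l => ‖f (l • u)‖ ^ p) 0 1 := by
      rw [← smul_eq_mul, ← circleAverage_fun_smul]
      refine circleAverage_congr_sphere fun l hl => ?_
      have hl1 : ‖l‖ = 1 := by simpa using hl
      simp only [weightedAbs, norm_smul, hl1, one_mul, smul_eq_mul, Pi.one_apply, norm_one]
      rw [mul_rpow (by positivity) (by positivity), mul_comm]
    have hmean := norm_rpow_le_circleAverage (F := fun l : ℂ => f (l • u)) (c := 0)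
      (hf.comp (differentiable_id.smul_const u)) one_pos hp
    rw [zero_smul] at hmean
    rw [hrot, mul_comm]
    exact mul_le_mul_of_nonneg_left hmean (rpow_nonneg (weightedAbs_nonneg _ _ _) _)
  rw [← integral_circleAverage hint, ← integral_const_mul]
  exact integral_mono ((integrable_weightedAbs_one_rpow hp s).const_mul _)
    (integrable_circleAverage hint) hsub

lemma weightedAbs_rpow_mul_integral_le [NeZero n] {p : ℝ} (α : ℝ) (hp : 0 < p) {f : Cn n → ℂ}
    (hf : Differentiable ℂ f) (hint : Integrable (fun z => weightedAbs α f z ^ p) (V n))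
    (z : Cn n) :
    weightedAbs α f z ^ p * ∫ u : Cn n, weightedAbs |α| 1 u ^ p ∂(V n) ≤
      ∫ u, weightedAbs α f u ^ p ∂(V n) := by
  let h := weylTranslate z f
  have hh : Differentiable ℂ h := differentiable_weylTranslate z hf
  have hg : 0 < growth α ‖z‖ := growth_pos (norm_nonneg z)
  have hle (u : Cn n) :
      weightedAbs |α| h u ^ p ≤ growth α ‖z‖ ^ p * weightedAbs α f (z + u) ^ p := by
    rw [← mul_rpow hg.le (weightedAbs_nonneg _ _ _)]
    exact rpow_le_rpow (weightedAbs_nonneg _ _ _) (weightedAbs_weylTranslate_le α z f u) hp.le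
  have hmaj := (hint.comp_add_left z).const_mul (growth α ‖z‖ ^ p)
  have hh_int : Integrable (fun u => weightedAbs |α| h u ^ p) (V n) := by
    refine hmaj.mono' ((continuous_weightedAbs _ hh.continuous).rpow_const
      fun _ => Or.inr hp.le).aestronglyMeasurable (ae_of_all _ fun u => ?_)
    rw [Real.norm_of_nonneg (rpow_nonneg (weightedAbs_nonneg _ _ _) _)]
    exact hle u
  have hmean := (norm_zero_rpow_mul_integral_le hp hh hh_int).trans (integral_mono hh_int hmaj hle)
  rw [integral_const_mul, integral_add_left_eq_self (fun u => weightedAbs α f u ^ p) z,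
    show h 0 = f z from weylTranslate_zero z f] at hmean
  rw [weightedAbs_eq_div, div_rpow (norm_nonneg _) hg.le, div_mul_eq_mul_div,
    div_le_iff₀' (by positivity)]
  exact hmean

theorem exists_weightedAbs_le_fockNorm [NeZero n] {p : ℝ} (α : ℝ) (hp : 0 < p) :
    ∃ C : ℝ, 0 < C ∧ ∀ (f : FockSpace n p (α * p)) (z : Cn n),
      weightedAbs α (f : Cn n → ℂ) z ≤ C * fockNorm f := by
  set κ : ℝ := ∫ u : Cn n, weightedAbs |α| 1 u ^ p ∂(V n)
  have hκ : 0 < κ := integral_weightedAbs_one_rpow_pos hp _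
  refine ⟨(κ⁻¹) ^ p⁻¹, by positivity, fun f z => ?_⟩
  obtain ⟨hf, hint⟩ := (mem_FockSpace_iff hp).mp f.2
  have hmean := weightedAbs_rpow_mul_integral_le α hp hf hint z
  rw [← fockNorm_rpow hp, ← le_div_iff₀ hκ] at hmean
  have hN := fockNorm_nonneg f
  rwa [← rpow_le_rpow_iff (weightedAbs_nonneg _ _ _) (by positivity) hp,
    mul_rpow (by positivity) hN, ← rpow_mul (by positivity), inv_mul_cancel₀ hp.ne', rpow_one,
    ← div_eq_inv_mul]

theorem exists_integral_weightedAbs_le_fockNorm [NeZero n] {p : ℝ} (α : ℝ) (hp : 0 < p)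
    (hp1 : p ≤ 1) :
    ∃ C : ℝ, 0 < C ∧ ∀ f : FockSpace n p (α * p),
      Integrable (weightedAbs α (f : Cn n → ℂ)) (V n) ∧
      ∫ z, weightedAbs α (f : Cn n → ℂ) z ∂(V n) ≤ C * fockNorm f := by
  obtain ⟨C, hC, hpoint⟩ := exists_weightedAbs_le_fockNorm (n := n) α hp
  refine ⟨C ^ (1 - p), by positivity, fun f => ?_⟩
  obtain ⟨hf, hint⟩ := (mem_FockSpace_iff hp).mp f.2
  have hN := fockNorm_nonneg f
  have hle (z : Cn n) : weightedAbs α (f : Cn n → ℂ) z ≤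
      (C * fockNorm f) ^ (1 - p) * weightedAbs α (f : Cn n → ℂ) z ^ p := by
    have hw := weightedAbs_nonneg α (f : Cn n → ℂ) z
    calc weightedAbs α (f : Cn n → ℂ) z
        = weightedAbs α (f : Cn n → ℂ) z ^ (1 - p) * weightedAbs α (f : Cn n → ℂ) z ^ p := by
          rw [← rpow_add' hw (by simp), sub_add_cancel, rpow_one]
      _ ≤ _ := mul_le_mul_of_nonneg_right (rpow_le_rpow hw (hpoint f z) (sub_nonneg.mpr hp1))
        (rpow_nonneg hw _)
  have hint1 : Integrable (weightedAbs α (f : Cn n → ℂ)) (V n) := by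
    refine (hint.const_mul ((C * fockNorm f) ^ (1 - p))).mono'
      (continuous_weightedAbs α hf.continuous).aestronglyMeasurable (ae_of_all _ fun z => ?_)
    rw [Real.norm_of_nonneg (weightedAbs_nonneg _ _ _)]
    exact hle z
  refine ⟨hint1, (integral_mono hint1 (hint.const_mul _) hle).trans_eq ?_⟩
  rw [integral_const_mul, ← fockNorm_rpow hp, mul_rpow hC.le hN, mul_assoc,
    ← rpow_add' hN (by simp), sub_add_cancel, rpow_one]

lemma exists_mem_FockSpace_of_weightedAbs_le {p α A : ℝ} (hp : 0 < p) (hA : 0 ≤ A)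
    {f : Cn n → ℂ} (hf : Differentiable ℂ f) {h : Cn n → ℝ} (hh : ∀ z, 0 ≤ h z)
    (hle : ∀ z, weightedAbs α f z ≤ A * h z) (hint : Integrable (fun z => h z ^ p) (V n)) :
    ∃ hm : f ∈ FockSpace n p (α * p),
      fockNorm (⟨f, hm⟩ : FockSpace n p (α * p)) ≤ A * (∫ z, h z ^ p ∂(V n)) ^ p⁻¹ := by
  have hle_rpow (z : Cn n) : weightedAbs α f z ^ p ≤ A ^ p * h z ^ p := by
    rw [← mul_rpow hA (hh z)]
    exact rpow_le_rpow (weightedAbs_nonneg _ _ _) (hle z) hp.le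
  have hfint : Integrable (fun z => weightedAbs α f z ^ p) (V n) := by
    refine (hint.const_mul (A ^ p)).mono' ((continuous_weightedAbs α hf.continuous).rpow_const
      fun _ => Or.inr hp.le).aestronglyMeasurable (ae_of_all _ fun z => ?_)
    rw [Real.norm_of_nonneg (rpow_nonneg (weightedAbs_nonneg _ _ _) _)]
    exact hle_rpow z
  refine ⟨(mem_FockSpace_iff hp).mpr ⟨hf, hfint⟩, ?_⟩
  have hI : 0 ≤ ∫ z, h z ^ p ∂(V n) := integral_nonneg fun z => rpow_nonneg (hh z) _
  calc _ = (∫ z, weightedAbs α f z ^ p ∂(V n)) ^ p⁻¹ := fockNorm_eq hp _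
    _ ≤ (∫ z, A ^ p * h z ^ p ∂(V n)) ^ p⁻¹ :=
        rpow_le_rpow (integral_nonneg fun z => rpow_nonneg (weightedAbs_nonneg _ _ _) _)
          (integral_mono hfint (hint.const_mul _) hle_rpow) (by positivity)
    _ = _ := by
        rw [integral_const_mul, mul_rpow (by positivity) hI, ← rpow_mul hA,
          mul_inv_cancel₀ hp.ne', rpow_one]

theorem exists_fockNorm_le_of_gaussian [NeZero n] {p : ℝ} (α : ℝ) (hp : 0 < p) {ρ : ℝ}
    (hρ : ρ < 1) :
    ∃ C : ℝ, 0 < C ∧ ∀ (f : Cn n → ℂ) (A : ℝ), Differentiable ℂ f → 0 ≤ A →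
      (∀ z, ‖f z‖ ≤ A * Real.exp (ρ * ‖z‖ ^ 2 / 2)) →
      ∃ hm : f ∈ FockSpace n p (α * p),
        fockNorm (⟨f, hm⟩ : FockSpace n p (α * p)) ≤ C * A := by
  let h : Cn n → ℝ := fun z => Real.exp (-(1 - ρ) / 2 * ‖z‖ ^ 2) * (1 + ‖z‖) ^ (-α)
  have hh (z : Cn n) : 0 ≤ h z := by simp only [h]; positivity
  have hint : Integrable (fun z => h z ^ p) (V n) := by
    refine (integrable_one_add_norm_rpow_mul_exp (c := p * (1 - ρ) / 2)
      (by have := sub_pos.mpr hρ; positivity) (-α * p)).congr (ae_of_all _ fun u => ?_)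
    simp only [h]
    rw [mul_rpow (by positivity) (by positivity), ← Real.exp_mul, ← rpow_mul (by positivity)]
    congr 2; ring
  have : 0 ≤ ∫ z, h z ^ p ∂(V n) := integral_nonneg fun z => rpow_nonneg (hh z) _
  refine ⟨(∫ z, h z ^ p ∂(V n)) ^ p⁻¹ + 1, by positivity, fun f A hf hA hle => ?_⟩
  have hsize (z : Cn n) : weightedAbs α f z ≤ A * h z := by
    have hexp : Real.exp (-(1 - ρ) / 2 * ‖z‖ ^ 2) =
        Real.exp (ρ * ‖z‖ ^ 2 / 2) * Real.exp (-‖z‖ ^ 2 / 2) := by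
      rw [← Real.exp_add]; congr 1; ring
    calc weightedAbs α f z
        ≤ A * Real.exp (ρ * ‖z‖ ^ 2 / 2) * (Real.exp (-‖z‖ ^ 2 / 2) * (1 + ‖z‖) ^ (-α)) := by
          rw [weightedAbs]; gcongr; exact hle z
      _ = _ := by simp only [h, hexp]; ring
  obtain ⟨hm, hnorm⟩ := exists_mem_FockSpace_of_weightedAbs_le hp hA hf hh hsize hint
  exact ⟨hm, hnorm.trans (by linarith)⟩

/-- The reproducing kernel `K_w(z) = e^{⟨z, w⟩}`; Mathlib's inner product is conjugate-linear in
its first argument. -/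
def kernel (w z : Cn n) : ℂ := Complex.exp (inner ℂ w z)

lemma differentiable_kernel (w : Cn n) : Differentiable ℂ (kernel w) :=
  (differentiable_inner_right w).cexp

lemma weylTranslate_neg_one (w : Cn n) : weylTranslate (-w) 1 = kernel w := by
  funext z
  simp [weylTranslate, kernel]

theorem exists_fockNorm_kernel_le [NeZero n] {p : ℝ} (α : ℝ) (hp : 0 < p) :
    ∃ C : ℝ, 0 < C ∧ ∀ w : Cn n, ∃ hm : kernel w ∈ FockSpace n p (α * p),
      fockNorm (⟨kernel w, hm⟩ : FockSpace n p (α * p)) ≤ C * growth (-α) ‖w‖ := by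
  have hI := integral_weightedAbs_one_rpow_pos (n := n) hp (-|α|)
  refine ⟨(∫ u : Cn n, weightedAbs (-|α|) 1 u ^ p ∂(V n)) ^ p⁻¹, by positivity, fun w => ?_⟩
  obtain ⟨hm, hnorm⟩ := exists_mem_FockSpace_of_weightedAbs_le (α := α) hp
    (growth_pos (norm_nonneg w)).le (differentiable_kernel w)
    (h := fun z => weightedAbs (-|α|) 1 (-w + z)) (fun z => weightedAbs_nonneg _ _ _)
    (fun z => by
      simpa only [weylTranslate_neg_one, norm_neg] using weightedAbs_weylTranslate_le' α (-w) 1 z)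
    ((integrable_weightedAbs_one_rpow hp _).comp_add_left (-w))
  rw [integral_add_left_eq_self (fun u => weightedAbs (-|α|) 1 u ^ p) (-w)] at hnorm
  exact ⟨hm, hnorm.trans_eq (mul_comm _ _)⟩

/-! ### The reproducing formula -/

lemma integral_mul_exp_neg_norm_sq {H : Cn n → ℂ} (hH : Differentiable ℂ H)
    (hint : Integrable (fun u => H u * (Real.exp (-‖u‖ ^ 2) : ℂ)) (V n)) :
    ∫ u, H u * (Real.exp (-‖u‖ ^ 2) : ℂ) ∂(V n) = H 0 := by
  have hmean (u : Cn n) :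
      circleAverage (fun l : ℂ => H (l • u) * (Real.exp (-‖l • u‖ ^ 2) : ℂ)) 0 1 =
        (Real.exp (-‖u‖ ^ 2) : ℂ) * H 0 := by
    have hline : Differentiable ℂ fun l : ℂ => H (l • u) := hH.comp (differentiable_id.smul_const u)
    have hcenter := (hline.diffContOnCl (s := Metric.ball (0 : ℂ) |1|)).circleAverage
    simp only [zero_smul] at hcenter
    rw [← hcenter, ← smul_eq_mul, ← circleAverage_fun_smul]
    refine circleAverage_congr_sphere fun l hl => ?_
    have hl1 : ‖l‖ = 1 := by simpa using hl
    simp only [norm_smul, hl1, one_mul, smul_eq_mul]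
    ring
  rw [← integral_circleAverage hint]
  simp_rw [hmean]
  rw [integral_mul_const, integral_complex_ofReal, integral_exp_neg_norm_sq, Complex.ofReal_one,
    one_mul]

lemma integrable_norm_mul_exp [NeZero n] {α M : ℝ} {f : Cn n → ℂ} (hf : Continuous f)
    (hM : ∀ z, weightedAbs α f z ≤ M) (R : ℝ) :
    Integrable (fun u => ‖f u‖ * Real.exp (R * ‖u‖) * Real.exp (-‖u‖ ^ 2)) (V n) := by
  have hM0 : 0 ≤ M := (weightedAbs_nonneg _ _ _).trans (hM 0)
  refine ((integrable_one_add_norm_rpow_mul_exp (c := 1 / 4) (by norm_num) α).const_mul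
    (M * Real.exp (R ^ 2))).mono' (Continuous.aestronglyMeasurable (by fun_prop))
    (ae_of_all _ fun u => ?_)
  have hlinear : Real.exp (R * ‖u‖) ≤ Real.exp (R ^ 2) * Real.exp (1 / 4 * ‖u‖ ^ 2) := by
    rw [← Real.exp_add, Real.exp_le_exp]
    nlinarith [sq_nonneg (R - ‖u‖ / 2)]
  have : 0 < growth α ‖u‖ := growth_pos (norm_nonneg u)
  rw [Real.norm_of_nonneg (by positivity)]
  calc _ ≤ M * growth α ‖u‖ * (Real.exp (R ^ 2) * Real.exp (1 / 4 * ‖u‖ ^ 2)) *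
        Real.exp (-‖u‖ ^ 2) := by gcongr; exact weightedAbs_le_iff.mp (hM u)
    _ = M * Real.exp (R ^ 2) * ((Real.exp (‖u‖ ^ 2 / 2) * Real.exp (1 / 4 * ‖u‖ ^ 2) *
        Real.exp (-‖u‖ ^ 2)) * (1 + ‖u‖) ^ α) := by rw [growth]; ring
    _ = _ := by
      rw [← Real.exp_add, ← Real.exp_add]
      congr 4; ring

lemma norm_kernel_le (w z : Cn n) : ‖kernel w z‖ ≤ Real.exp (‖w‖ * ‖z‖) := by
  rw [kernel, Complex.norm_exp, Real.exp_le_exp]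
  exact (Complex.re_le_norm _).trans (norm_inner_le_norm w z)

lemma integrable_reproducing [NeZero n] {α M : ℝ} {f : Cn n → ℂ} (hf : Continuous f)
    (hM : ∀ z, weightedAbs α f z ≤ M) (z : Cn n) :
    Integrable (fun u => f u * kernel u z * (Real.exp (-‖u‖ ^ 2) : ℂ)) (V n) := by
  have hcont : Continuous fun u : Cn n => kernel u z := by unfold kernel; fun_prop
  refine (integrable_norm_mul_exp hf hM ‖z‖).mono'
    (Continuous.aestronglyMeasurable (by fun_prop)) (ae_of_all _ fun u => ?_)
  rw [norm_mul, norm_mul, Complex.norm_real, Real.norm_of_nonneg (Real.exp_pos _).le]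
  gcongr
  rw [mul_comm]
  exact norm_kernel_le u z

lemma mul_kernel_mul_exp_eq_weylTranslate (f : Cn n → ℂ) (z v : Cn n) :
    f (z + v) * kernel (z + v) z * (Real.exp (-‖z + v‖ ^ 2) : ℂ) =
      weylTranslate z f v * (Real.exp (-‖v‖ ^ 2) : ℂ) := by
  have hnorm (w : Cn n) : ((‖w‖ ^ 2 : ℝ) : ℂ) = inner ℂ w w := by
    rw [inner_self_eq_norm_sq_to_K]; push_cast; rfl
  rw [kernel, weylTranslate, mul_assoc, mul_assoc, Complex.ofReal_exp, Complex.ofReal_exp,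
    ← Complex.exp_add, ← Complex.exp_add, Complex.ofReal_neg, Complex.ofReal_neg, hnorm, hnorm]
  congr 2
  simp only [inner_add_left, inner_add_right]
  ring

theorem integral_reproducing [NeZero n] {α M : ℝ} {f : Cn n → ℂ} (hf : Differentiable ℂ f)
    (hM : ∀ z, weightedAbs α f z ≤ M) (z : Cn n) :
    ∫ u, f u * kernel u z * (Real.exp (-‖u‖ ^ 2) : ℂ) ∂(V n) = f z := by
  have hint := (integrable_reproducing hf.continuous hM z).comp_add_left z
  rw [← integral_add_left_eq_self _ z]
  simp only [mul_kernel_mul_exp_eq_weylTranslate] at hint ⊢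
  rw [integral_mul_exp_neg_norm_sq (differentiable_weylTranslate z hf) hint, weylTranslate_zero]

/-- The moments `∫ f(u) conj(u_{s(1)} ⋯ u_{s(k)}) e^{-|u|²} dV(u)`, which determine the power
series of `f` by the reproducing formula. -/
def moment (f : Cn n → ℂ) (k : ℕ) (s : Fin k → Fin n) : ℂ :=
  ∫ u, f u * conj (∏ j, u (s j)) * (Real.exp (-‖u‖ ^ 2) : ℂ) ∂(V n)

lemma norm_prod_coord_le {k : ℕ} (s : Fin k → Fin n) (u : Cn n) : ‖∏ j, u (s j)‖ ≤ ‖u‖ ^ k := by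
  rw [norm_prod]
  calc ∏ j, ‖u (s j)‖ ≤ ∏ _j : Fin k, ‖u‖ := by gcongr with j; exact PiLp.norm_apply_le u (s j)
    _ = ‖u‖ ^ k := by simp

lemma pow_le_factorial_mul_exp (k : ℕ) {x : ℝ} (hx : 0 ≤ x) :
    x ^ k ≤ k.factorial * Real.exp x := by
  have h := Real.pow_div_factorial_le_exp x hx k
  rwa [div_le_iff₀' (by exact_mod_cast k.factorial_pos)] at h

lemma norm_moment_integrand_le (f : Cn n → ℂ) {k : ℕ} (s : Fin k → Fin n) {R : ℝ} (hR : 0 < R)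
    (u : Cn n) :
    ‖f u * conj (∏ j, u (s j)) * (Real.exp (-‖u‖ ^ 2) : ℂ)‖ ≤
      k.factorial / R ^ k * (‖f u‖ * Real.exp (R * ‖u‖) * Real.exp (-‖u‖ ^ 2)) := by
  have hcoord : ‖∏ j, u (s j)‖ ≤ k.factorial / R ^ k * Real.exp (R * ‖u‖) := by
    refine (norm_prod_coord_le s u).trans ?_
    rw [div_mul_eq_mul_div, le_div_iff₀ (by positivity), ← mul_pow, mul_comm ‖u‖]
    exact pow_le_factorial_mul_exp k (by positivity)
  rw [norm_mul, norm_mul, Complex.norm_real, Real.norm_of_nonneg (Real.exp_pos _).le,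
    RCLike.norm_conj]
  calc _ ≤ ‖f u‖ * (k.factorial / R ^ k * Real.exp (R * ‖u‖)) * Real.exp (-‖u‖ ^ 2) := by gcongr
    _ = _ := by ring

lemma integrable_moment [NeZero n] {α M : ℝ} {f : Cn n → ℂ} (hf : Continuous f)
    (hM : ∀ z, weightedAbs α f z ≤ M) (k : ℕ) (s : Fin k → Fin n) :
    Integrable (fun u => f u * conj (∏ j, u (s j)) * (Real.exp (-‖u‖ ^ 2) : ℂ)) (V n) :=
  ((integrable_norm_mul_exp hf hM 1).const_mul _).mono'
    (Continuous.aestronglyMeasurable (by fun_prop))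
    (ae_of_all _ (norm_moment_integrand_le f s one_pos))

lemma momentBound_moment [NeZero n] {α M : ℝ} {f : Cn n → ℂ} (hf : Continuous f)
    (hM : ∀ z, weightedAbs α f z ≤ M) : MomentBound (moment f) := by
  intro R hR
  refine ⟨∫ u, ‖f u‖ * Real.exp (R * ‖u‖) * Real.exp (-‖u‖ ^ 2) ∂(V n), fun k s => ?_⟩
  rw [← le_div_iff₀ (by positivity), mul_div_assoc, mul_comm, ← integral_const_mul]
  exact norm_integral_le_of_norm_le ((integrable_norm_mul_exp hf hM R).const_mul _)
    (ae_of_all _ (norm_moment_integrand_le f s hR))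

lemma inner_pow_eq_sum (u z : Cn n) (k : ℕ) :
    inner ℂ u z ^ k = ∑ s : Fin k → Fin n, conj (∏ j, u (s j)) * ∏ j, z (s j) := by
  have hcoord : inner ℂ u z = ∑ i, conj (u i) * z i := by simp [PiLp.inner_apply, mul_comm]
  simp only [hcoord, Fintype.sum_pow, map_prod, Finset.prod_mul_distrib]

lemma integral_mul_inner_pow [NeZero n] {α M : ℝ} {f : Cn n → ℂ} (hf : Continuous f)
    (hM : ∀ z, weightedAbs α f z ≤ M) (k : ℕ) (z : Cn n) :
    ∫ u, f u * (inner ℂ u z ^ k / k.factorial) * (Real.exp (-‖u‖ ^ 2) : ℂ) ∂(V n) =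
      momentSeries (moment f) k fun _ => z := by
  simp_rw [momentSeries_apply, moment, ← integral_mul_const]
  rw [← integral_finsetSum _ fun s _ => (integrable_moment hf hM k s).mul_const _,
    ← integral_const_mul]
  refine integral_congr_ae (ae_of_all _ fun u => ?_)
  simp only [inner_pow_eq_sum, Finset.sum_div, Finset.mul_sum, Finset.sum_mul]
  exact Finset.sum_congr rfl fun s _ => by ring

lemma hasSum_integral_mul_inner_pow [NeZero n] {α M : ℝ} {f : Cn n → ℂ} (hf : Continuous f)
    (hM : ∀ z, weightedAbs α f z ≤ M) (z : Cn n) :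
    HasSum (fun k : ℕ =>
      ∫ u, f u * (inner ℂ u z ^ k / k.factorial) * (Real.exp (-‖u‖ ^ 2) : ℂ) ∂(V n))
      (∫ u, f u * kernel u z * (Real.exp (-‖u‖ ^ 2) : ℂ) ∂(V n)) := by
  refine hasSum_integral_of_dominated_convergence
    (fun k u => ‖f u‖ * ((‖z‖ * ‖u‖) ^ k / k.factorial) * Real.exp (-‖u‖ ^ 2))
    (fun k => Continuous.aestronglyMeasurable (by fun_prop)) (fun k => ae_of_all _ fun u => ?_)
    (ae_of_all _ fun u => ((Real.summable_pow_div_factorial _).mul_left _).mul_right _) ?_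
    (ae_of_all _ fun u => ?_)
  · rw [norm_mul, norm_mul, norm_div, norm_pow, Complex.norm_real,
      Real.norm_of_nonneg (Real.exp_pos _).le, Complex.norm_natCast]
    gcongr
    rw [mul_comm]
    exact norm_inner_le_norm u z
  · have hexp (u : Cn n) :
        ∑' k : ℕ, ‖f u‖ * ((‖z‖ * ‖u‖) ^ k / k.factorial) * Real.exp (-‖u‖ ^ 2) =
          ‖f u‖ * Real.exp (‖z‖ * ‖u‖) * Real.exp (-‖u‖ ^ 2) := by
      rw [tsum_mul_right, tsum_mul_left, Real.exp_eq_exp_ℝ, NormedSpace.exp_eq_tsum_div]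
    simp_rw [hexp]
    exact integrable_norm_mul_exp hf hM ‖z‖
  · have hexp := NormedSpace.exp_series_hasSum_exp' (𝕂 := ℂ) (𝔸 := ℂ) (inner ℂ u z)
    rw [← Complex.exp_eq_exp_ℂ] at hexp
    refine ((hexp.mul_left (f u)).mul_right (Real.exp (-‖u‖ ^ 2) : ℂ)).congr_fun fun k => ?_
    rw [smul_eq_mul, div_eq_inv_mul]

lemma sum_momentSeries_moment [NeZero n] {α M : ℝ} {f : Cn n → ℂ} (hf : Differentiable ℂ f)
    (hM : ∀ z, weightedAbs α f z ≤ M) : (momentSeries (moment f)).sum = f := by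
  funext z
  have hsum := hasSum_integral_mul_inner_pow hf.continuous hM z
  simp only [integral_mul_inner_pow hf.continuous hM, integral_reproducing hf hM] at hsum
  exact hsum.tsum_eq

theorem isEntire_of_weightedAbs_le [NeZero n] {α M : ℝ} {f : Cn n → ℂ} (hf : Differentiable ℂ f)
    (hM : ∀ z, weightedAbs α f z ≤ M) : IsEntire f := by
  rw [← sum_momentSeries_moment hf hM]
  exact (momentBound_moment hf.continuous hM).isEntire

lemma homogPart_eq_sum_moment [NeZero n] {α M : ℝ} {f : Cn n → ℂ} (hf : Differentiable ℂ f)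
    (hM : ∀ z, weightedAbs α f z ≤ M) (k : ℕ) (z : Cn n) :
    homogPart f k z = (k.factorial : ℂ)⁻¹ * ∑ s, moment f k s * ∏ j, z (s j) := by
  rw [← (momentBound_moment hf.continuous hM).homogPart_sum, sum_momentSeries_moment hf hM]

/-! ### Low and high frequency parts -/

/-- `∑_{k < j} fₖ`; the statement's `lowPart` with the number of terms as the parameter. -/
def truncLow (j : ℕ) (f : Cn n → ℂ) (z : Cn n) : ℂ := ∑ k ∈ Finset.range j, homogPart f k z

/-- `f - ∑_{k < j} fₖ`; the statement's `highPart` with the number of subtracted terms as the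
parameter. -/
def truncHigh (j : ℕ) (f : Cn n → ℂ) (z : Cn n) : ℂ := f z - truncLow j f z

lemma truncLow_zero (f : Cn n → ℂ) : truncLow 0 f = 0 := by ext; simp [truncLow]

lemma truncHigh_zero (f : Cn n → ℂ) : truncHigh 0 f = f := by
  ext; simp [truncHigh, truncLow_zero]

lemma differentiable_truncLow (j : ℕ) (f : Cn n → ℂ) : Differentiable ℂ (truncLow j f) :=
  Differentiable.fun_sum fun k _ => differentiable_homogPart f k

lemma differentiable_truncHigh (j : ℕ) {f : Cn n → ℂ} (hf : Differentiable ℂ f) :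
    Differentiable ℂ (truncHigh j f) := hf.sub (differentiable_truncLow j f)

/-- The number of homogeneous parts that are treated separately in the pairing `⟨·, ·⟩_γ`. -/
def cutoff (n : ℕ) (γ : ℝ) : ℕ := if γ < 2 * (n : ℝ) then 0 else ⌊|γ / 2|⌋₊ + 1

lemma cutoff_add_pos [NeZero n] (γ : ℝ) : 0 < cutoff n γ + (n - γ / 2) := by
  unfold cutoff
  split_ifs with h
  · rw [Nat.cast_zero, zero_add]; linarith
  · have hn : (0 : ℝ) < n := by exact_mod_cast NeZero.pos n
    have hfloor := Nat.lt_floor_add_one |γ / 2|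
    have habs := le_abs_self (γ / 2)
    push_cast
    linarith

lemma rawPairing_zero_left (γ : ℝ) (g : Cn n → ℂ) : rawPairing γ 0 g = 0 := by
  simp [rawPairing, pairIntegrand]

lemma pairing_eq_cutoff (γ : ℝ) (f g : Cn n → ℂ) :
    pairing γ f g = rawPairing 0 (truncLow (cutoff n γ) f) (truncLow (cutoff n γ) g)
      + rawPairing γ (truncHigh (cutoff n γ) f) (truncHigh (cutoff n γ) g) := by
  unfold pairing cutoff
  split_ifs
  · rw [truncLow_zero, truncHigh_zero, truncHigh_zero, rawPairing_zero_left, zero_add]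
  · rfl

lemma pairingConverges_iff_cutoff (γ : ℝ) (f g : Cn n → ℂ) :
    PairingConverges γ f g ↔
      Integrable (pairIntegrand (truncLow (cutoff n γ) f) (truncLow (cutoff n γ) g)) (W n 0) ∧
      Integrable (pairIntegrand (truncHigh (cutoff n γ) f) (truncHigh (cutoff n γ) g)) (W n γ) := by
  unfold PairingConverges cutoff
  by_cases h : γ < 2 * (n : ℝ)
  · have hzero : pairIntegrand (0 : Cn n → ℂ) 0 = 0 := by ext; simp [pairIntegrand]
    simp only [h, true_implies, not_le.mpr h, false_implies, and_true, if_true, truncLow_zero,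
      truncHigh_zero, hzero]
    exact (and_iff_right (integrable_zero _ _ _)).symm
  · simp only [h, false_implies, not_lt.mp h, true_implies, true_and, if_false]
    rfl

/-! ### Convergence and continuity of the pairing -/

lemma exists_unit_smul [NeZero n] (z : Cn n) : ∃ ζ : Cn n, ‖ζ‖ = 1 ∧ z = (‖z‖ : ℂ) • ζ := by
  rcases eq_or_ne z 0 with rfl | hz
  · obtain ⟨ζ, hζ⟩ := exists_norm_eq (Cn n) zero_le_one
    exact ⟨ζ, hζ, by simp⟩
  · have hz' : (‖z‖ : ℂ) ≠ 0 := by simpa using hz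
    refine ⟨(‖z‖ : ℂ)⁻¹ • z, ?_, by rw [smul_inv_smul₀ hz']⟩
    rw [norm_smul, norm_inv, Complex.norm_real, norm_norm,
      inv_mul_cancel₀ (norm_ne_zero_iff.mpr hz)]

section Truncation
variable {α M : ℝ} {f : Cn n → ℂ}

lemma norm_homogPart_le (hf : IsEntire f) (hM : ∀ z, weightedAbs α f z ≤ M) (k : ℕ) (z : Cn n) :
    ‖homogPart f k z‖ ≤ M * growth α ‖z‖ := by
  refine norm_coeff_le (F := fun l => f (l • z)) (hf.summable z) (fun l _ => hf.hasSum_smul l z)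
    (fun l hl => ?_) k
  have := weightedAbs_le_iff.mp (hM (l • z))
  rwa [norm_smul, hl, one_mul] at this

lemma norm_homogPart_le_pow [NeZero n] (hf : IsEntire f) (hM : ∀ z, weightedAbs α f z ≤ M)
    {R : ℝ} (hR : 0 < R) (k : ℕ) (z : Cn n) :
    ‖homogPart f k z‖ ≤ M * growth α R * (‖z‖ / R) ^ k := by
  obtain ⟨ζ, hζ, hz⟩ := exists_unit_smul z
  have hscale : z = ((‖z‖ / R : ℝ) : ℂ) • ((R : ℂ) • ζ) := by
    rw [smul_smul, ← Complex.ofReal_mul, div_mul_cancel₀ _ hR.ne']; exact hz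
  have hsphere := norm_homogPart_le hf hM k ((R : ℂ) • ζ)
  rw [norm_smul, hζ, Complex.norm_real, Real.norm_of_nonneg hR.le, mul_one] at hsphere
  rw [hscale, homogPart_smul, norm_mul, norm_pow, Complex.norm_real,
    Real.norm_of_nonneg (show 0 ≤ ‖z‖ / R by positivity), mul_comm, ← hscale]
  gcongr

lemma norm_truncLow_le [NeZero n] (hf : IsEntire f) (hM : ∀ z, weightedAbs α f z ≤ M) (j : ℕ)
    (z : Cn n) : ‖truncLow j f z‖ ≤ j * growth α 1 * M * (1 + ‖z‖) ^ j := by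
  have hM0 : 0 ≤ M := (weightedAbs_nonneg _ _ _).trans (hM 0)
  have hg : 0 < growth α 1 := growth_pos zero_le_one
  have hterm (k : ℕ) (hk : k ∈ Finset.range j) :
      ‖homogPart f k z‖ ≤ M * growth α 1 * (1 + ‖z‖) ^ j := by
    refine (norm_homogPart_le_pow hf hM one_pos k z).trans ?_
    rw [div_one]
    gcongr
    calc ‖z‖ ^ k ≤ (1 + ‖z‖) ^ k := by gcongr; linarith
      _ ≤ (1 + ‖z‖) ^ j :=
        pow_le_pow_right₀ (by linarith [norm_nonneg z]) (Finset.mem_range.mp hk).le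
  refine (norm_sum_le_of_le _ hterm).trans_eq ?_
  rw [Finset.sum_const, Finset.card_range, nsmul_eq_mul]
  ring

lemma norm_truncHigh_le_pow [NeZero n] (hf : IsEntire f) (hM : ∀ z, weightedAbs α f z ≤ M)
    (j : ℕ) {z : Cn n} (hz : ‖z‖ ≤ 1) :
    ‖truncHigh j f z‖ ≤ 2 * growth α 2 * M * ‖z‖ ^ j := by
  have hM0 : 0 ≤ M := (weightedAbs_nonneg _ _ _).trans (hM 0)
  have hg : 0 < growth α 2 := growth_pos zero_le_two
  have htail : HasSum (fun k => homogPart f (k + j) z) (truncHigh j f z) := by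
    rw [truncHigh, truncLow]
    exact (hasSum_nat_add_iff' j).mpr (hf.hasSum z)
  have hterm (k : ℕ) : ‖homogPart f (k + j) z‖ ≤ M * growth α 2 * ‖z‖ ^ j * (1 / 2) ^ k := by
    refine (norm_homogPart_le_pow hf hM two_pos (k + j) z).trans ?_
    rw [mul_assoc (M * growth α 2)]
    gcongr
    rw [pow_add, mul_comm]
    gcongr
    linarith [norm_nonneg z]
  have hgeom :=
    tsum_of_norm_bounded (hasSum_geometric_two.mul_left (M * growth α 2 * ‖z‖ ^ j)) hterm
  rw [htail.tsum_eq] at hgeom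
  linarith

lemma exists_weightedAbs_truncLow_le [NeZero n] (α δ : ℝ) (j : ℕ) :
    ∃ C : ℝ, 0 ≤ C ∧ ∀ (f : Cn n → ℂ) (M : ℝ), IsEntire f → (∀ z, weightedAbs α f z ≤ M) →
      ∀ z, weightedAbs δ (truncLow j f) z ≤ C * M * Real.exp (-(1 / 4) * ‖z‖ ^ 2) := by
  obtain ⟨C, hC, hexp⟩ := exists_one_add_rpow_le_exp (j - δ) (ε := 1 / 4) (by norm_num)
  have hg : 0 < growth α 1 := growth_pos zero_le_one
  refine ⟨j * growth α 1 * C, by positivity, fun f M hf hM z => ?_⟩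
  have hM0 : 0 ≤ M := (weightedAbs_nonneg _ _ _).trans (hM 0)
  calc weightedAbs δ (truncLow j f) z
      ≤ j * growth α 1 * M * (1 + ‖z‖) ^ j *
          (Real.exp (-‖z‖ ^ 2 / 2) * (1 + ‖z‖) ^ (-δ)) := by
        rw [weightedAbs]; gcongr; exact norm_truncLow_le hf hM j z
    _ = j * growth α 1 * M * (Real.exp (-‖z‖ ^ 2 / 2) * (1 + ‖z‖) ^ (j - δ)) := by
        rw [sub_eq_add_neg, rpow_add (by positivity), rpow_natCast]; ring
    _ ≤ j * growth α 1 * M * (Real.exp (-‖z‖ ^ 2 / 2) * (C * Real.exp (1 / 4 * ‖z‖ ^ 2))) := by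
        gcongr; exact hexp _ (norm_nonneg z)
    _ = j * growth α 1 * C * M * (Real.exp (-‖z‖ ^ 2 / 2) * Real.exp (1 / 4 * ‖z‖ ^ 2)) := by ring
    _ = _ := by rw [← Real.exp_add]; congr 2; ring

lemma exists_weightedAbs_truncHigh_le [NeZero n] (α : ℝ) (j : ℕ) :
    ∃ C : ℝ, 0 ≤ C ∧ ∀ (f : Cn n → ℂ) (M : ℝ), IsEntire f → (∀ z, weightedAbs α f z ≤ M) →
      ∀ z, weightedAbs α (truncHigh j f) z ≤
        weightedAbs α f z + C * M * Real.exp (-(1 / 4) * ‖z‖ ^ 2) := by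
  obtain ⟨C, hC, hlow⟩ := exists_weightedAbs_truncLow_le (n := n) α α j
  refine ⟨C, hC, fun f M hf hM z => le_trans ?_ (add_le_add_right (hlow f M hf hM z) _)⟩
  rw [weightedAbs, weightedAbs, weightedAbs, ← add_mul]
  gcongr
  exact norm_sub_le _ _

end Truncation

lemma integrable_exp_neg_quarter_norm_sq [NeZero n] :
    Integrable (fun z : Cn n => Real.exp (-(1 / 4) * ‖z‖ ^ 2)) (V n) := by
  simpa only [rpow_zero, mul_one] using
    integrable_one_add_norm_rpow_mul_exp (μ := V n) (c := 1 / 4) (by norm_num) 0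

lemma norm_pairIntegrand (f g : Cn n → ℂ) (z : Cn n) :
    ‖pairIntegrand f g z‖ = ‖f z‖ * ‖g z‖ * Real.exp (-‖z‖ ^ 2) := by
  rw [pairIntegrand, norm_mul, norm_mul, RCLike.norm_conj, Complex.norm_real,
    Real.norm_of_nonneg (Real.exp_pos _).le]

lemma continuous_pairIntegrand {f g : Cn n → ℂ} (hf : Continuous f) (hg : Continuous g) :
    Continuous (pairIntegrand f g) := by
  unfold pairIntegrand
  fun_prop

lemma one_add_rpow_mul_norm_pairIntegrand (α β : ℝ) (f g : Cn n → ℂ) (z : Cn n) :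
    (1 + ‖z‖) ^ (-(α + β)) * ‖pairIntegrand f g z‖ = weightedAbs α f z * weightedAbs β g z := by
  have hexp : Real.exp (-‖z‖ ^ 2) = Real.exp (-‖z‖ ^ 2 / 2) * Real.exp (-‖z‖ ^ 2 / 2) := by
    rw [← Real.exp_add, add_halves]
  rw [norm_pairIntegrand, weightedAbs, weightedAbs, neg_add, rpow_add (by positivity), hexp]
  ring

lemma rpow_neg_le_one_add_rpow_neg (γ : ℝ) {x : ℝ} (hx : 1 ≤ x) :
    x ^ (-γ) ≤ 2 ^ |γ| * (1 + x) ^ (-γ) := by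
  have := one_add_rpow_le_mul (x := x - 1) (y := x) (d := 1) (-γ) (by linarith) (by linarith)
    (by simp)
  rwa [add_sub_cancel, abs_neg, one_add_one_eq_two, mul_comm] at this

lemma rpow_neg_mul_norm_pairIntegrand_le_of_norm_le_one {A A' : ℝ} (γ : ℝ) {j : ℕ}
    {f g : Cn n → ℂ} {z : Cn n} (hf : ‖f z‖ ≤ A * ‖z‖ ^ j) (hg : ‖g z‖ ≤ A' * ‖z‖ ^ j)
    (hA : 0 ≤ A) (hA' : 0 ≤ A') :
    ‖z‖ ^ (-γ) * ‖pairIntegrand f g z‖ ≤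
      A * A' * (‖z‖ ^ (2 * j - γ) * Real.exp (-1 * ‖z‖ ^ 2)) := by
  have hweight : ‖z‖ ^ (-γ) * (‖z‖ ^ j * ‖z‖ ^ j) ≤ ‖z‖ ^ (2 * j - γ) := by
    rcases (norm_nonneg z).eq_or_lt with hz | hz
    · rcases Nat.eq_zero_or_pos j with rfl | hj
      · simp
      · rw [← hz, zero_pow hj.ne', mul_zero, mul_zero]; positivity
    · rw [sub_eq_neg_add, rpow_add hz, two_mul, rpow_add hz, rpow_natCast]
  calc ‖z‖ ^ (-γ) * ‖pairIntegrand f g z‖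
      ≤ ‖z‖ ^ (-γ) * (A * ‖z‖ ^ j * (A' * ‖z‖ ^ j) * Real.exp (-‖z‖ ^ 2)) := by
        rw [norm_pairIntegrand]; gcongr
    _ = A * A' * (‖z‖ ^ (-γ) * (‖z‖ ^ j * ‖z‖ ^ j) * Real.exp (-1 * ‖z‖ ^ 2)) := by
        rw [neg_one_mul]; ring
    _ ≤ _ := by gcongr

lemma rpow_neg_mul_norm_pairIntegrand_le_of_one_le_norm (α β : ℝ) (f g : Cn n → ℂ) {z : Cn n}
    (hz : 1 ≤ ‖z‖) :
    ‖z‖ ^ (-(α + β)) * ‖pairIntegrand f g z‖ ≤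
      2 ^ |α + β| * (weightedAbs α f z * weightedAbs β g z) := by
  rw [← one_add_rpow_mul_norm_pairIntegrand, ← mul_assoc]
  gcongr
  exact rpow_neg_le_one_add_rpow_neg _ hz

/-- A weight that is singular at the origin is compensated there by a zero of both factors, and is
comparable with the regular weight elsewhere. -/
lemma norm_rawPairing_le [NeZero n] {α β A A' B : ℝ} {j : ℕ}
    (hj : 0 < j + (n - (α + β) / 2)) {f g : Cn n → ℂ} (hf : Continuous f) (hg : Continuous g)
    (hf0 : ∀ z, ‖z‖ ≤ 1 → ‖f z‖ ≤ A * ‖z‖ ^ j) (hg0 : ∀ z, ‖z‖ ≤ 1 → ‖g z‖ ≤ A' * ‖z‖ ^ j)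
    (hA : 0 ≤ A) (hA' : 0 ≤ A') (hint : Integrable (weightedAbs α f) (V n))
    (hB : ∀ z, weightedAbs β g z ≤ B) :
    Integrable (pairIntegrand f g) (W n (α + β)) ∧
      ‖rawPairing (α + β) f g‖ ≤
        A * A' * ∫ z : Cn n, ‖z‖ ^ (2 * j - (α + β)) * Real.exp (-1 * ‖z‖ ^ 2) ∂(V n) +
          2 ^ |α + β| * B * ∫ z, weightedAbs α f z ∂(V n) := by
  set γ := α + β
  have hB0 : 0 ≤ B := (weightedAbs_nonneg _ _ _).trans (hB 0)
  have hle (z : Cn n) : ‖(‖z‖ ^ (-γ) : ℝ) • pairIntegrand f g z‖ ≤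
      A * A' * (‖z‖ ^ (2 * j - γ) * Real.exp (-1 * ‖z‖ ^ 2)) +
        2 ^ |γ| * B * weightedAbs α f z := by
    have := weightedAbs_nonneg α f z
    rw [norm_smul, Real.norm_of_nonneg (by positivity)]
    rcases le_total ‖z‖ 1 with hz | hz
    · exact le_add_of_le_of_nonneg (rpow_neg_mul_norm_pairIntegrand_le_of_norm_le_one γ (hf0 z hz)
        (hg0 z hz) hA hA') (by positivity)
    · refine le_add_of_nonneg_of_le (by positivity)
        ((rpow_neg_mul_norm_pairIntegrand_le_of_one_le_norm α β f g hz).trans ?_)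
      rw [mul_comm (weightedAbs α f z), mul_assoc]
      gcongr
      exact hB z
  have hsing : Integrable (fun z : Cn n => ‖z‖ ^ (2 * j - γ) * Real.exp (-1 * ‖z‖ ^ 2)) (V n) :=
    integrable_norm_rpow_mul_exp one_pos (by rw [cast_finrank_Cn]; linarith)
  have hdom := (hsing.const_mul (A * A')).add (hint.const_mul (2 ^ |γ| * B))
  rw [rawPairing, integral_W, integrable_W, ← integral_const_mul, ← integral_const_mul,
    ← integral_add (hsing.const_mul _) (hint.const_mul _)]
  have hmeas : Measurable fun z : Cn n => ‖z‖ ^ (-γ) := by fun_prop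
  exact ⟨hdom.mono' (hmeas.aestronglyMeasurable.smul
    (continuous_pairIntegrand hf hg).aestronglyMeasurable) (ae_of_all _ hle),
    norm_integral_le_of_norm_le hdom (ae_of_all _ hle)⟩

lemma exists_norm_rawPairing_truncLow_le [NeZero n] (α β : ℝ) (j : ℕ) :
    ∃ K : ℝ, 0 ≤ K ∧ ∀ (f g : Cn n → ℂ) (M B : ℝ), IsEntire f → IsEntire g →
      (∀ z, weightedAbs α f z ≤ M) → (∀ z, weightedAbs β g z ≤ B) →
      Integrable (pairIntegrand (truncLow j f) (truncLow j g)) (W n 0) ∧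
      ‖rawPairing 0 (truncLow j f) (truncLow j g)‖ ≤ K * B * M := by
  obtain ⟨C, hC, hlow⟩ := exists_weightedAbs_truncLow_le (n := n) α 0 j
  obtain ⟨C', hC', hlow'⟩ := exists_weightedAbs_truncLow_le (n := n) β 0 j
  have : 0 ≤ ∫ z : Cn n, Real.exp (-(1 / 4) * ‖z‖ ^ 2) ∂(V n) :=
    integral_nonneg fun z => by positivity
  refine ⟨C * C' * ∫ z : Cn n, Real.exp (-(1 / 4) * ‖z‖ ^ 2) ∂(V n), by positivity,
    fun f g M B hf hg hM hB => ?_⟩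
  have hM0 : 0 ≤ M := (weightedAbs_nonneg _ _ _).trans (hM 0)
  have hB0 : 0 ≤ B := (weightedAbs_nonneg _ _ _).trans (hB 0)
  have hle (z : Cn n) : ‖pairIntegrand (truncLow j f) (truncLow j g) z‖ ≤
      C * M * (C' * B) * Real.exp (-(1 / 4) * ‖z‖ ^ 2) := by
    have hsmall : Real.exp (-(1 / 4) * ‖z‖ ^ 2) ≤ 1 :=
      Real.exp_le_one_iff.mpr (by nlinarith [sq_nonneg ‖z‖])
    have hprod := one_add_rpow_mul_norm_pairIntegrand 0 0 (truncLow j f) (truncLow j g) z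
    rw [add_zero, neg_zero, rpow_zero, one_mul] at hprod
    calc _ ≤ C * M * Real.exp (-(1 / 4) * ‖z‖ ^ 2) * (C' * B * 1) := by
          rw [hprod]
          exact mul_le_mul (hlow f M hf hM z)
            ((hlow' g B hg hB z).trans (by gcongr)) (weightedAbs_nonneg _ _ _) (by positivity)
      _ = _ := by ring
  have hdom := integrable_exp_neg_quarter_norm_sq.const_mul (μ := V n) (C * M * (C' * B))
  rw [rawPairing, integral_W, integrable_W]
  simp only [neg_zero, rpow_zero, one_smul]
  refine ⟨hdom.mono' (continuous_pairIntegrand (differentiable_truncLow j f).continuous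
    (differentiable_truncLow j g).continuous).aestronglyMeasurable (ae_of_all _ hle),
    (norm_integral_le_of_norm_le hdom (ae_of_all _ hle)).trans_eq ?_⟩
  rw [integral_const_mul]
  ring

lemma exists_integral_weightedAbs_truncHigh_le [NeZero n] (α : ℝ) (j : ℕ) :
    ∃ C : ℝ, 0 ≤ C ∧ ∀ (f : Cn n → ℂ) (M : ℝ), IsEntire f → (∀ z, weightedAbs α f z ≤ M) →
      Integrable (weightedAbs α f) (V n) →
      Integrable (weightedAbs α (truncHigh j f)) (V n) ∧
      ∫ z, weightedAbs α (truncHigh j f) z ∂(V n) ≤ C * (M + ∫ z, weightedAbs α f z ∂(V n)) := by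
  obtain ⟨C, hC, hhigh⟩ := exists_weightedAbs_truncHigh_le (n := n) α j
  set E := ∫ z : Cn n, Real.exp (-(1 / 4) * ‖z‖ ^ 2) ∂(V n)
  have hE : 0 ≤ E := integral_nonneg fun z => by positivity
  refine ⟨1 + C * E, by positivity, fun f M hf hM hint => ?_⟩
  have hM0 : 0 ≤ M := (weightedAbs_nonneg _ _ _).trans (hM 0)
  have hI : 0 ≤ ∫ z, weightedAbs α f z ∂(V n) := integral_nonneg (weightedAbs_nonneg α f)
  have hgauss := (integrable_exp_neg_quarter_norm_sq (n := n)).const_mul (C * M)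
  have hh_int : Integrable (weightedAbs α (truncHigh j f)) (V n) := by
    refine (hint.add hgauss).mono' (continuous_weightedAbs α
      (differentiable_truncHigh j hf.differentiable).continuous).aestronglyMeasurable
      (ae_of_all _ fun z => ?_)
    rw [Real.norm_of_nonneg (weightedAbs_nonneg _ _ _)]
    exact hhigh f M hf hM z
  refine ⟨hh_int, (integral_mono hh_int (hint.add hgauss) (hhigh f M hf hM)).trans ?_⟩
  rw [integral_add' hint hgauss, integral_const_mul]
  nlinarith [mul_nonneg (mul_nonneg hC hE) hI]

lemma exists_norm_rawPairing_truncHigh_le [NeZero n] {α β : ℝ} {j : ℕ}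
    (hj : 0 < j + (n - (α + β) / 2)) :
    ∃ K : ℝ, 0 ≤ K ∧ ∀ (f g : Cn n → ℂ) (M B : ℝ), IsEntire f → IsEntire g →
      (∀ z, weightedAbs α f z ≤ M) → Integrable (weightedAbs α f) (V n) →
      (∀ z, weightedAbs β g z ≤ B) →
      Integrable (pairIntegrand (truncHigh j f) (truncHigh j g)) (W n (α + β)) ∧
      ‖rawPairing (α + β) (truncHigh j f) (truncHigh j g)‖ ≤
        K * B * (M + ∫ z, weightedAbs α f z ∂(V n)) := by
  obtain ⟨C, hC, hhigh⟩ := exists_integral_weightedAbs_truncHigh_le (n := n) α j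
  obtain ⟨C', hC', hhigh'⟩ := exists_weightedAbs_truncHigh_le (n := n) β j
  have hα : 0 < growth α 2 := growth_pos zero_le_two
  have hβ : 0 < growth β 2 := growth_pos zero_le_two
  set D := ∫ z : Cn n, ‖z‖ ^ (2 * j - (α + β)) * Real.exp (-1 * ‖z‖ ^ 2) ∂(V n)
  have : 0 ≤ D := integral_nonneg fun z => by positivity
  refine ⟨4 * growth α 2 * growth β 2 * D + 2 ^ |α + β| * (1 + C') * C, by positivity,
    fun f g M B hf hg hM hint hB => ?_⟩
  have hM0 : 0 ≤ M := (weightedAbs_nonneg _ _ _).trans (hM 0)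
  have hB0 : 0 ≤ B := (weightedAbs_nonneg _ _ _).trans (hB 0)
  have hI : 0 ≤ ∫ z, weightedAbs α f z ∂(V n) := integral_nonneg (weightedAbs_nonneg α f)
  obtain ⟨hfint, hfI⟩ := hhigh f M hf hM hint
  have hgB (z : Cn n) : weightedAbs β (truncHigh j g) z ≤ (1 + C') * B := by
    have hsmall : Real.exp (-(1 / 4) * ‖z‖ ^ 2) ≤ 1 :=
      Real.exp_le_one_iff.mpr (by nlinarith [sq_nonneg ‖z‖])
    calc _ ≤ B + C' * B * 1 := (hhigh' g B hg hB z).trans (by gcongr; exact hB z)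
      _ = _ := by ring
  obtain ⟨hconv, hle⟩ := norm_rawPairing_le hj
    (differentiable_truncHigh j hf.differentiable).continuous
    (differentiable_truncHigh j hg.differentiable).continuous
    (fun z hz => norm_truncHigh_le_pow hf hM j hz) (fun z hz => norm_truncHigh_le_pow hg hB j hz)
    (by positivity) (by positivity) hfint hgB
  refine ⟨hconv, hle.trans ?_⟩
  calc _ ≤ 2 * growth α 2 * (M + ∫ z, weightedAbs α f z ∂(V n)) * (2 * growth β 2 * B) * D +
        2 ^ |α + β| * ((1 + C') * B) * (C * (M + ∫ z, weightedAbs α f z ∂(V n))) := by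
        gcongr
        linarith
    _ = _ := by ring

theorem exists_norm_pairing_le [NeZero n] (α β : ℝ) :
    ∃ K : ℝ, 0 < K ∧ ∀ (f g : Cn n → ℂ) (M B : ℝ), Differentiable ℂ f → Differentiable ℂ g →
      (∀ z, weightedAbs α f z ≤ M) → Integrable (weightedAbs α f) (V n) →
      (∀ z, weightedAbs β g z ≤ B) →
      PairingConverges (α + β) f g ∧
      ‖pairing (α + β) f g‖ ≤ K * B * (M + ∫ z, weightedAbs α f z ∂(V n)) := by
  obtain ⟨K, hK, hlow⟩ := exists_norm_rawPairing_truncLow_le (n := n) α β (cutoff n (α + β))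
  obtain ⟨K', hK', hhigh⟩ := exists_norm_rawPairing_truncHigh_le (cutoff_add_pos (n := n) (α + β))
  refine ⟨K + K' + 1, by positivity, fun f g M B hf hg hM hint hB => ?_⟩
  have hB0 : 0 ≤ B := (weightedAbs_nonneg _ _ _).trans (hB 0)
  have hM0 : 0 ≤ M := (weightedAbs_nonneg _ _ _).trans (hM 0)
  have hI : 0 ≤ ∫ z, weightedAbs α f z ∂(V n) := integral_nonneg (weightedAbs_nonneg α f)
  have hfe := isEntire_of_weightedAbs_le hf hM
  have hge := isEntire_of_weightedAbs_le hg hB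
  obtain ⟨hlconv, hlle⟩ := hlow f g M B hfe hge hM hB
  obtain ⟨hhconv, hhle⟩ := hhigh f g M B hfe hge hM hint hB
  refine ⟨(pairingConverges_iff_cutoff _ _ _).mpr ⟨hlconv, hhconv⟩, ?_⟩
  rw [pairing_eq_cutoff]
  calc _ ≤ K * B * M + K' * B * (M + ∫ z, weightedAbs α f z ∂(V n)) :=
        (norm_add_le _ _).trans (add_le_add hlle hhle)
    _ ≤ K * B * (M + ∫ z, weightedAbs α f z ∂(V n)) +
          K' * B * (M + ∫ z, weightedAbs α f z ∂(V n)) := by gcongr; linarith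
    _ = (K + K') * B * (M + ∫ z, weightedAbs α f z ∂(V n)) := by ring
    _ ≤ _ := by nlinarith [mul_nonneg hB0 (add_nonneg hM0 hI)]

/-! ### Homogeneous parts of the kernel -/

/-- `⟨z, w⟩ᵏ / k!`, the homogeneous part of degree `k` of the reproducing kernel. -/
def kernelPart (w : Cn n) (k : ℕ) (z : Cn n) : ℂ := inner ℂ w z ^ k / k.factorial

lemma differentiable_kernelPart (w : Cn n) (k : ℕ) : Differentiable ℂ (kernelPart w k) := by
  simpa only [kernelPart, div_eq_mul_inv] using!
    ((differentiable_inner_right w).pow k).mul_const ((k.factorial : ℂ)⁻¹)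

lemma kernelPart_smul (w : Cn n) (k : ℕ) (l : ℂ) (z : Cn n) :
    kernelPart w k (l • z) = l ^ k * kernelPart w k z := by
  rw [kernelPart, kernelPart, inner_smul_right, mul_pow, mul_div_assoc]

lemma kernelPart_smul_left (w : Cn n) (k : ℕ) (l : ℂ) (z : Cn n) :
    kernelPart (l • w) k z = conj l ^ k * kernelPart w k z := by
  rw [kernelPart, kernelPart, inner_smul_left, mul_pow, mul_div_assoc]

lemma hasSum_kernelPart (w z : Cn n) : HasSum (fun k => kernelPart w k z) (kernel w z) := by
  have hexp := NormedSpace.exp_series_hasSum_exp' (𝕂 := ℂ) (𝔸 := ℂ) (inner ℂ w z)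
  rw [← Complex.exp_eq_exp_ℂ] at hexp
  exact hexp.congr_fun fun k => by rw [kernelPart, smul_eq_mul, div_eq_inv_mul]

lemma norm_kernelPart_le (w : Cn n) (k : ℕ) (z : Cn n) :
    ‖kernelPart w k z‖ ≤ Real.exp (4 * ‖w‖ ^ 2) * (1 / 2) ^ k * Real.exp (1 / 2 * ‖z‖ ^ 2 / 2) := by
  have hfactorial := Real.pow_div_factorial_le_exp (2 * (‖w‖ * ‖z‖)) (by positivity) k
  have hexp : Real.exp (2 * (‖w‖ * ‖z‖)) ≤
      Real.exp (4 * ‖w‖ ^ 2) * Real.exp (1 / 2 * ‖z‖ ^ 2 / 2) := by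
    rw [← Real.exp_add, Real.exp_le_exp]
    nlinarith [sq_nonneg (2 * ‖w‖ - ‖z‖ / 2)]
  calc _ ≤ (‖w‖ * ‖z‖) ^ k / k.factorial := by
        rw [kernelPart, norm_div, norm_pow, Complex.norm_natCast]
        gcongr
        exact norm_inner_le_norm w z
    _ = (1 / 2) ^ k * ((2 * (‖w‖ * ‖z‖)) ^ k / k.factorial) := by
        rw [← mul_div_assoc, ← mul_pow]; congr 2; ring
    _ ≤ (1 / 2) ^ k * (Real.exp (4 * ‖w‖ ^ 2) * Real.exp (1 / 2 * ‖z‖ ^ 2 / 2)) := by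
        gcongr; exact hfactorial.trans hexp
    _ = _ := by ring

lemma summable_norm_kernelPart (w z : Cn n) : Summable fun k => ‖kernelPart w k z‖ :=
  Summable.of_nonneg_of_le (fun _ => norm_nonneg _) (fun k => norm_kernelPart_le w k z)
    ((summable_geometric_two.mul_left _).mul_right _)

lemma norm_kernel_sub_sum_le (w : Cn n) (N : ℕ) (z : Cn n) :
    ‖kernel w z - ∑ k ∈ Finset.range N, kernelPart w k z‖ ≤
      2 * Real.exp (4 * ‖w‖ ^ 2) * (1 / 2) ^ N * Real.exp (1 / 2 * ‖z‖ ^ 2 / 2) := by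
  have htail := (hasSum_nat_add_iff' N).mpr (hasSum_kernelPart w z)
  have hterm (k : ℕ) : ‖kernelPart w (k + N) z‖ ≤
      (Real.exp (4 * ‖w‖ ^ 2) * (1 / 2) ^ N * Real.exp (1 / 2 * ‖z‖ ^ 2 / 2)) * (1 / 2) ^ k := by
    refine (norm_kernelPart_le w (k + N) z).trans_eq ?_
    rw [pow_add]; ring
  have hgeom := tsum_of_norm_bounded (hasSum_geometric_two.mul_left _) hterm
  rw [htail.tsum_eq] at hgeom
  linarith

lemma exists_weightedAbs_kernelPart_le [NeZero n] (α : ℝ) (w : Cn n) (k : ℕ) :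
    ∃ M : ℝ, (∀ z, weightedAbs α (kernelPart w k) z ≤ M) ∧
      Integrable (weightedAbs α (kernelPart w k)) (V n) := by
  obtain ⟨_, -, hgauss⟩ := exists_fockNorm_le_of_gaussian (n := n) α one_pos (ρ := 1 / 2)
    (by norm_num)
  obtain ⟨hm, -⟩ := hgauss _ _ (differentiable_kernelPart w k) (by positivity)
    (norm_kernelPart_le w k)
  obtain ⟨C, -, hsup⟩ := exists_weightedAbs_le_fockNorm (n := n) α one_pos
  obtain ⟨_, -, hint⟩ := exists_integral_weightedAbs_le_fockNorm (n := n) α one_pos le_rfl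
  exact ⟨C * fockNorm ⟨_, hm⟩, hsup ⟨_, hm⟩, (hint ⟨_, hm⟩).1⟩

lemma isEntire_kernelPart [NeZero n] (w : Cn n) (k : ℕ) : IsEntire (kernelPart w k) :=
  isEntire_of_weightedAbs_le (differentiable_kernelPart w k)
    (exists_weightedAbs_kernelPart_le 0 w k).choose_spec.1

lemma truncLow_kernelPart [NeZero n] (w : Cn n) (j k : ℕ) :
    truncLow j (kernelPart w k) = if k < j then kernelPart w k else 0 := by
  ext z
  simp only [truncLow, (isEntire_kernelPart w k).homogPart_of_homogeneous (kernelPart_smul w k),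
    Finset.sum_ite_eq', Finset.mem_range]
  split_ifs <;> rfl

lemma truncHigh_kernelPart [NeZero n] (w : Cn n) (j k : ℕ) :
    truncHigh j (kernelPart w k) = if k < j then 0 else kernelPart w k := by
  ext z
  rw [truncHigh, truncLow_kernelPart]
  split_ifs <;> simp

/-! ### Orthogonality -/

lemma circleAverage_conj (f : ℂ → ℂ) :
    Real.circleAverage (fun l => conj (f l)) 0 1 = conj (Real.circleAverage f 0 1) := by
  have h2π : (0 : ℝ) ≤ 2 * π := by positivity
  simp_rw [Real.circleAverage_def, intervalIntegral.integral_of_le h2π]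
  rw [integral_conj, Complex.real_smul, Complex.real_smul, map_mul, Complex.conj_ofReal]

/-- By rotation invariance, pairing with a homogeneous function of degree `k` only sees the part of
degree `k`. -/
lemma rawPairing_eq_of_circleAverage {γ : ℝ} {k : ℕ} {P H h : Cn n → ℂ}
    (hP : ∀ (l : ℂ) (z : Cn n), P (l • z) = l ^ k * P z)
    (hH : ∀ z, Real.circleAverage (fun l => conj l ^ k * H (l • z)) 0 1 = h z)
    (hi : Integrable (pairIntegrand P H) (W n γ)) : rawPairing γ P H = rawPairing γ P h := by
  rw [integrable_W] at hi
  rw [rawPairing, rawPairing, integral_W, integral_W, ← integral_circleAverage hi]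
  refine integral_congr_ae (ae_of_all _ fun z => ?_)
  have hrotate : Set.EqOn
      (fun l : ℂ => (‖l • z‖ ^ (-γ) : ℝ) • pairIntegrand P H (l • z))
      (fun l : ℂ => (((‖z‖ ^ (-γ) : ℝ) : ℂ) * P z * (Real.exp (-‖z‖ ^ 2) : ℂ)) •
        conj (conj l ^ k * H (l • z))) (Metric.sphere 0 |1|) := fun l hl => by
    have hl : ‖l‖ = 1 := by simpa using hl
    simp only [pairIntegrand, norm_smul, hl, one_mul, hP, smul_eq_mul, Complex.real_smul, map_mul,
      map_pow, Complex.conj_conj]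
    ring
  beta_reduce
  rw [Real.circleAverage_congr_sphere hrotate, Real.circleAverage_fun_smul, circleAverage_conj, hH,
    pairIntegrand, smul_eq_mul, Complex.real_smul]
  ring

lemma hasSum_truncLow_smul (f : Cn n → ℂ) (j : ℕ) (l : ℂ) (z : Cn n) :
    HasSum (fun k => (if k < j then homogPart f k z else 0) * l ^ k) (truncLow j f (l • z)) := by
  have hsum : truncLow j f (l • z) =
      ∑ k ∈ Finset.range j, (if k < j then homogPart f k z else 0) * l ^ k :=
    Finset.sum_congr rfl fun k hk => by
      rw [if_pos (Finset.mem_range.mp hk), homogPart_smul, mul_comm]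
  rw [hsum]
  exact hasSum_sum_of_ne_finset_zero fun k hk => by
    rw [if_neg (Finset.mem_range.not.mp hk), zero_mul]

lemma circleAverage_truncLow (f : Cn n → ℂ) (j k : ℕ) (z : Cn n) :
    Real.circleAverage (fun l => conj l ^ k * truncLow j f (l • z)) 0 1 =
      if k < j then homogPart f k z else 0 := by
  refine circleAverage_conj_pow_mul (F := fun l => truncLow j f (l • z))
    (a := fun k => if k < j then homogPart f k z else 0)
    (summable_of_ne_finset_zero (s := Finset.range j) fun k hk => ?_)
    (fun l _ => hasSum_truncLow_smul f j l z) k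
  rw [if_neg (Finset.mem_range.not.mp hk), norm_zero]

lemma IsEntire.circleAverage_truncHigh {f : Cn n → ℂ} (hf : IsEntire f) (j k : ℕ) (z : Cn n) :
    Real.circleAverage (fun l => conj l ^ k * truncHigh j f (l • z)) 0 1 =
      if k < j then 0 else homogPart f k z := by
  refine FockDuality.circleAverage_conj_pow_mul (F := fun l => truncHigh j f (l • z))
    (a := fun k => if k < j then 0 else homogPart f k z) ?_ (fun l _ => ?_) k
  · refine Summable.of_nonneg_of_le (fun _ => norm_nonneg _) (fun k => ?_) (hf.summable z)
    split_ifs <;> simp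
  · refine ((hf.hasSum_smul l z).sub (hasSum_truncLow_smul f j l z)).congr_fun fun k => ?_
    split_ifs <;> simp

section Homogeneous
variable {k : ℕ} {P Q : Cn n → ℂ}

lemma rawPairing_homogeneous_eq_integral_sphere [NeZero n] {γ : ℝ} (hk : 0 < k + (n - γ / 2))
    (hP : ∀ (l : ℂ) (z : Cn n), P (l • z) = l ^ k * P z)
    (hQ : ∀ (l : ℂ) (z : Cn n), Q (l • z) = l ^ k * Q z) :
    rawPairing γ P Q =
      (∫ ζ : Metric.sphere (0 : Cn n) 1, P ζ * conj (Q ζ) ∂(V n).toSphere) *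
        ((Real.Gamma (k + (n - γ / 2)) / 2 : ℝ) : ℂ) := by
  have hPQ (r : ℝ) (z : Cn n) :
      P (r • z) * conj (Q (r • z)) = (r : ℂ) ^ (2 * k) * (P z * conj (Q z)) := by
    rw [← Complex.coe_smul, hP, hQ, map_mul, map_pow, Complex.conj_ofReal]
    ring
  rw [← integral_radial_moment hk, ← finrank_Cn, ← integral_radial_smul_homogeneous
    (F := fun z => P z * conj (Q z)) (fun r z _ => hPQ r z)
    (fun r => r ^ (-γ) * Real.exp (-r ^ 2)), rawPairing, integral_W]
  refine integral_congr_ae (ae_of_all _ fun z => ?_)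
  simp only [pairIntegrand, Complex.real_smul]
  push_cast
  ring

lemma rawPairing_homogeneous [NeZero n] {γ : ℝ} (hk : 0 < k + (n - γ / 2))
    (hP : ∀ (l : ℂ) (z : Cn n), P (l • z) = l ^ k * P z)
    (hQ : ∀ (l : ℂ) (z : Cn n), Q (l • z) = l ^ k * Q z) :
    rawPairing γ P Q =
      ((Real.Gamma (k + (n - γ / 2)) / Real.Gamma (k + n) : ℝ) : ℂ) * rawPairing 0 P Q := by
  have hk0 : (0 : ℝ) < k + n := by
    have : (0 : ℝ) < n := by exact_mod_cast NeZero.pos n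
    positivity
  have hΓ : (Real.Gamma (k + n) : ℂ) ≠ 0 := by exact_mod_cast (Real.Gamma_pos_of_pos hk0).ne'
  rw [rawPairing_homogeneous_eq_integral_sphere hk hP hQ,
    rawPairing_homogeneous_eq_integral_sphere (by simpa using hk0) hP hQ, zero_div, sub_zero]
  push_cast
  field_simp

end Homogeneous

lemma pairIntegrand_conj_symm (P Q : Cn n → ℂ) (z : Cn n) :
    pairIntegrand P Q z = conj (pairIntegrand Q P z) := by
  simp only [pairIntegrand, map_mul, Complex.conj_conj, Complex.conj_ofReal]
  ring

lemma rawPairing_conj_symm (γ : ℝ) (P Q : Cn n → ℂ) :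
    rawPairing γ P Q = conj (rawPairing γ Q P) := by
  simp only [rawPairing, ← integral_conj, ← pairIntegrand_conj_symm]

lemma conj_kernel (w z : Cn n) : conj (kernel w z) = kernel z w := by
  rw [kernel, kernel, ← Complex.exp_conj, inner_conj_symm]

section KernelPairing
variable {β B : ℝ} {g : Cn n → ℂ}

lemma rawPairing_kernel [NeZero n] (hg : Differentiable ℂ g) (hB : ∀ z, weightedAbs β g z ≤ B)
    (w : Cn n) :
    Integrable (pairIntegrand g (kernel w)) (W n 0) ∧ rawPairing 0 g (kernel w) = g w := by
  rw [integrable_W, rawPairing, integral_W]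
  simp only [neg_zero, rpow_zero, one_smul, pairIntegrand, conj_kernel]
  exact ⟨integrable_reproducing hg.continuous hB w, integral_reproducing hg hB w⟩

lemma circleAverage_kernel (w : Cn n) (k : ℕ) (z : Cn n) :
    Real.circleAverage (fun l => conj l ^ k * kernel w (l • z)) 0 1 = kernelPart w k z :=
  circleAverage_conj_pow_mul (F := fun l => kernel w (l • z)) (a := fun k => kernelPart w k z)
    (summable_norm_kernelPart w z)
    (fun l _ => (hasSum_kernelPart w (l • z)).congr_fun fun k => by
      rw [kernelPart_smul, mul_comm]) k

lemma rawPairing_kernelPart_homogPart [NeZero n] (hg : Differentiable ℂ g)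
    (hB : ∀ z, weightedAbs β g z ≤ B) (w : Cn n) (k : ℕ) :
    rawPairing 0 (kernelPart w k) (homogPart g k) = conj (homogPart g k w) := by
  have hge := isEntire_of_weightedAbs_le hg hB
  obtain ⟨hint, heval⟩ := rawPairing_kernel (differentiable_homogPart g k) (β := β) (B := B)
    (fun z => weightedAbs_le_iff.mpr (norm_homogPart_le hge hB k z)) w
  rw [rawPairing_conj_symm,
    ← rawPairing_eq_of_circleAverage (homogPart_smul g k) (circleAverage_kernel w k) hint, heval]

theorem pairing_kernelPart [NeZero n] (γ : ℝ) (hg : Differentiable ℂ g)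
    (hB : ∀ z, weightedAbs β g z ≤ B) (w : Cn n) (k : ℕ) :
    pairing γ (kernelPart w k) g =
      (gammaMultiplier (cutoff n γ) (n - γ / 2) n k : ℂ) * conj (homogPart g k w) := by
  set j := cutoff n γ with hj
  have hge := isEntire_of_weightedAbs_le hg hB
  obtain ⟨M, hM, hint⟩ := exists_weightedAbs_kernelPart_le (γ - β) w k
  obtain ⟨_, -, hpair⟩ := exists_norm_pairing_le (n := n) (γ - β) β
  obtain ⟨hlow, hhigh⟩ := (pairingConverges_iff_cutoff _ _ _).mp
    (hpair _ g M B (differentiable_kernelPart w k) hg hM hint hB).1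
  rw [sub_add_cancel, ← hj, truncHigh_kernelPart] at hhigh
  rw [sub_add_cancel, ← hj, truncLow_kernelPart] at hlow
  rw [pairing_eq_cutoff, ← hj, truncLow_kernelPart, truncHigh_kernelPart, gammaMultiplier]
  by_cases hkj : k < j
  · simp only [hkj, if_true] at hlow ⊢
    rw [rawPairing_zero_left, add_zero, rawPairing_eq_of_circleAverage (kernelPart_smul w k)
      (h := homogPart g k) (fun z => by rw [circleAverage_truncLow, if_pos hkj]) hlow,
      rawPairing_kernelPart_homogPart hg hB, Complex.ofReal_one, one_mul]
  · simp only [hkj, if_false] at hhigh ⊢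
    have hk : 0 < k + (n - γ / 2) := by
      have hjk : (j : ℝ) ≤ k := by exact_mod_cast not_lt.mp hkj
      linarith [cutoff_add_pos (n := n) γ]
    rw [rawPairing_zero_left, zero_add, rawPairing_eq_of_circleAverage (kernelPart_smul w k)
      (h := homogPart g k) (fun z => by rw [hge.circleAverage_truncHigh, if_neg hkj]) hhigh,
      rawPairing_homogeneous hk (kernelPart_smul w k) (homogPart_smul g k),
      rawPairing_kernelPart_homogPart hg hB]

end KernelPairing

/-! ### The function representing a functional -/

lemma gammaMultiplier_succ {j : ℕ} {A B : ℝ} (hA : 0 < j + A) (hB : 0 < j + B) {k : ℕ}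
    (hk : j ≤ k) :
    gammaMultiplier j A B (k + 1) = gammaMultiplier j A B k * ((k + A) / (k + B)) := by
  have hjk : (j : ℝ) ≤ k := by exact_mod_cast hk
  have hkA : (k : ℝ) + A ≠ 0 := by linarith
  have hkB : (k : ℝ) + B ≠ 0 := by linarith
  rw [gammaMultiplier, gammaMultiplier, if_neg (by omega), if_neg (by omega), Nat.cast_succ,
    add_right_comm _ 1 A, add_right_comm _ 1 B, Real.Gamma_add_one hkA, Real.Gamma_add_one hkB,
    mul_div_mul_comm, mul_comm]

lemma exists_gammaMultiplier_le_pow {j : ℕ} {A B : ℝ} (hA : 0 < j + A) (hB : 0 < j + B) :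
    ∃ C Q : ℝ, 0 < C ∧ 0 < Q ∧ ∀ k, gammaMultiplier j A B k ≤ C * Q ^ k := by
  have hmj := gammaMultiplier_pos hA hB j
  set Q := 1 + |A - B| / (j + B)
  have hQ : 1 ≤ Q := le_add_of_nonneg_right (by positivity)
  have hratio {k : ℕ} (hk : j ≤ k) : (k + A) / (k + B) ≤ Q := by
    have hjk : (j : ℝ) ≤ k := by exact_mod_cast hk
    have hkB : 0 < (k : ℝ) + B := by linarith
    calc (k + A) / (k + B) = 1 + (A - B) / (k + B) := by field_simp; ring
      _ ≤ 1 + |A - B| / (j + B) := by gcongr; exact le_abs_self _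
  refine ⟨1 + gammaMultiplier j A B j, Q, by positivity, by positivity, fun k => ?_⟩
  rcases lt_or_ge k j with hk | hk
  · rw [gammaMultiplier, if_pos hk]
    exact one_le_mul_of_one_le_of_one_le (by linarith) (one_le_pow₀ hQ)
  induction k, hk using Nat.le_induction with
  | base =>
    exact (le_add_of_nonneg_left zero_le_one).trans
      (le_mul_of_one_le_right (by positivity) (one_le_pow₀ hQ))
  | succ k hk ih =>
    rw [gammaMultiplier_succ hA hB hk, pow_succ, ← mul_assoc]
    exact mul_le_mul_of_nonneg ih (hratio hk) (gammaMultiplier_pos hA hB k).le (by positivity)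

/-- The multiplier inverting the action of the pairing on homogeneous parts. -/
def inverseMultiplier (n : ℕ) (γ : ℝ) : ℕ → ℝ := gammaMultiplier (cutoff n γ) n (n - γ / 2)

lemma exists_abs_inverseMultiplier_le_pow [NeZero n] (γ : ℝ) :
    ∃ C Q : ℝ, 0 < C ∧ 0 < Q ∧ ∀ k, |inverseMultiplier n γ k| ≤ C * Q ^ k := by
  have hcut := cutoff_add_pos (n := n) γ
  have hcut' : (0 : ℝ) < cutoff n γ + n := by
    have : (0 : ℝ) < n := by exact_mod_cast NeZero.pos n
    positivity
  obtain ⟨C, Q, hC, hQ, hle⟩ := exists_gammaMultiplier_le_pow hcut' hcut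
  exact ⟨C, Q, hC, hQ, fun k => (abs_of_pos (gammaMultiplier_pos hcut' hcut k)).trans_le (hle k)⟩

lemma gammaMultiplier_mul_inverseMultiplier [NeZero n] (γ : ℝ) (k : ℕ) :
    gammaMultiplier (cutoff n γ) (n - γ / 2) n k * inverseMultiplier n γ k = 1 :=
  gammaMultiplier_mul_swap (cutoff_add_pos γ) (by
    have : (0 : ℝ) < n := by exact_mod_cast NeZero.pos n
    positivity) k

lemma differentiable_coord_prod {k : ℕ} (s : Fin k → Fin n) :
    Differentiable ℂ fun z : Cn n => ∏ j, z (s j) :=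
  fun z => (HasFDerivAt.finsetProd (u := Finset.univ) (g := fun j (z : Cn n) => z (s j))
    fun j _ => (EuclideanSpace.proj (s j) : Cn n →L[ℂ] ℂ).hasFDerivAt (x := z)).differentiableAt

lemma norm_coord_prod_le_gaussian {R : ℝ} (hR : 0 < R) {k : ℕ} (s : Fin k → Fin n) (z : Cn n) :
    ‖∏ j, z (s j)‖ ≤ k.factorial / R ^ k * Real.exp (R ^ 2) * Real.exp (1 / 2 * ‖z‖ ^ 2 / 2) := by
  have hexp : Real.exp (R * ‖z‖) ≤ Real.exp (R ^ 2) * Real.exp (1 / 2 * ‖z‖ ^ 2 / 2) := by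
    rw [← Real.exp_add, Real.exp_le_exp]
    nlinarith [sq_nonneg (R - ‖z‖ / 2)]
  calc ‖∏ j, z (s j)‖ ≤ (R * ‖z‖) ^ k / R ^ k := by
        rw [mul_pow, mul_div_cancel_left₀ _ (by positivity)]; exact norm_prod_coord_le s z
    _ ≤ k.factorial * (Real.exp (R ^ 2) * Real.exp (1 / 2 * ‖z‖ ^ 2 / 2)) / R ^ k := by
        gcongr
        exact (pow_le_factorial_mul_exp k (by positivity)).trans (by gcongr)
    _ = _ := by ring

section Functional
variable [NeZero n] {p α N : ℝ}

lemma kernelPart_mem (α : ℝ) (hp : 0 < p) (w : Cn n) (k : ℕ) :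
    kernelPart w k ∈ FockSpace n p (α * p) := by
  obtain ⟨_, -, hgauss⟩ := exists_fockNorm_le_of_gaussian (n := n) α hp (ρ := 1 / 2) (by norm_num)
  exact (hgauss _ _ (differentiable_kernelPart w k) (by positivity) (norm_kernelPart_le w k)).1

lemma kernel_mem (α : ℝ) (hp : 0 < p) (w : Cn n) : kernel w ∈ FockSpace n p (α * p) := by
  obtain ⟨_, -, hkernel⟩ := exists_fockNorm_kernel_le (n := n) α hp
  exact (hkernel w).1

/-- A linear functional evaluated on the homogeneous parts of the kernel. -/
def kernelCoeff (hp : 0 < p) (ν : FockSpace n p (α * p) →ₗ[ℂ] ℂ) (w : Cn n) (k : ℕ) : ℂ :=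
  ν ⟨kernelPart w k, kernelPart_mem α hp w k⟩

lemma kernelCoeff_smul (hp : 0 < p) (ν : FockSpace n p (α * p) →ₗ[ℂ] ℂ) (l : ℂ) (w : Cn n)
    (k : ℕ) : kernelCoeff hp ν (l • w) k = conj l ^ k * kernelCoeff hp ν w k := by
  have hsmul : (⟨kernelPart (l • w) k, kernelPart_mem α hp (l • w) k⟩ : FockSpace n p (α * p)) =
      conj l ^ k • ⟨kernelPart w k, kernelPart_mem α hp w k⟩ := by
    ext z
    exact kernelPart_smul_left w k l z
  rw [kernelCoeff, hsmul, map_smul, smul_eq_mul, kernelCoeff]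

section Bounded
variable {ν : FockSpace n p (α * p) →ₗ[ℂ] ℂ}

lemma exists_norm_kernelCoeff_le (hp : 0 < p) (hN : 0 ≤ N)
    (hν : ∀ f, ‖ν f‖ ≤ N * fockNorm f) (w : Cn n) :
    ∃ C : ℝ, ∀ k, ‖kernelCoeff hp ν w k‖ ≤ C * (1 / 2) ^ k := by
  obtain ⟨C, -, hgauss⟩ := exists_fockNorm_le_of_gaussian (n := n) α hp (ρ := 1 / 2) (by norm_num)
  refine ⟨N * (C * Real.exp (4 * ‖w‖ ^ 2)), fun k => ?_⟩
  obtain ⟨_, hle⟩ := hgauss _ _ (differentiable_kernelPart w k) (by positivity)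
    (norm_kernelPart_le w k)
  calc _ ≤ N * (C * (Real.exp (4 * ‖w‖ ^ 2) * (1 / 2) ^ k)) := (hν _).trans (by gcongr)
    _ = _ := by ring

lemma exists_norm_map_kernel_sub_sum_le (hp : 0 < p) (hN : 0 ≤ N)
    (hν : ∀ f, ‖ν f‖ ≤ N * fockNorm f) (w : Cn n) :
    ∃ C : ℝ, ∀ m : ℕ, ‖ν ⟨kernel w, kernel_mem α hp w⟩ -
      ∑ k ∈ Finset.range m, kernelCoeff hp ν w k‖ ≤ C * (1 / 2) ^ m := by
  obtain ⟨C, -, hgauss⟩ := exists_fockNorm_le_of_gaussian (n := n) α hp (ρ := 1 / 2) (by norm_num)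
  refine ⟨N * (C * (2 * Real.exp (4 * ‖w‖ ^ 2))), fun m => ?_⟩
  obtain ⟨hmem, hle⟩ := hgauss (fun z => kernel w z - ∑ k ∈ Finset.range m, kernelPart w k z) _
    ((differentiable_kernel w).sub
      (Differentiable.fun_sum fun k _ => differentiable_kernelPart w k))
    (by positivity) (norm_kernel_sub_sum_le w m)
  have hsub : (⟨_, hmem⟩ : FockSpace n p (α * p)) = ⟨kernel w, kernel_mem α hp w⟩ -
      ∑ k ∈ Finset.range m, ⟨kernelPart w k, kernelPart_mem α hp w k⟩ := by
    ext z
    simp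
  calc _ = ‖ν ⟨_, hmem⟩‖ := by rw [hsub, map_sub, map_sum]; rfl
    _ ≤ N * (C * (2 * Real.exp (4 * ‖w‖ ^ 2) * (1 / 2) ^ m)) := (hν _).trans (by gcongr)
    _ = _ := by ring

lemma hasSum_kernelCoeff (hp : 0 < p) (hN : 0 ≤ N) (hν : ∀ f, ‖ν f‖ ≤ N * fockNorm f) (w : Cn n) :
    HasSum (kernelCoeff hp ν w) (ν ⟨kernel w, kernel_mem α hp w⟩) := by
  obtain ⟨C₀, hcoeff⟩ := exists_norm_kernelCoeff_le hp hN hν w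
  obtain ⟨C, hle⟩ := exists_norm_map_kernel_sub_sum_le hp hN hν w
  have hsummable : Summable (kernelCoeff hp ν w) :=
    Summable.of_norm_bounded (summable_geometric_two.mul_left C₀) hcoeff
  have hgeom : Tendsto (fun m : ℕ => C * (1 / 2 : ℝ) ^ m) atTop (𝓝 0) := by
    simpa using (tendsto_pow_atTop_nhds_zero_of_lt_one one_half_pos.le one_half_lt_one).const_mul C
  rw [hsummable.hasSum_iff_tendsto_nat, tendsto_iff_norm_sub_tendsto_zero]
  exact squeeze_zero (fun _ => norm_nonneg _) (fun m => (norm_sub_rev _ _).trans_le (hle m)) hgeom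

lemma tsum_conj_kernelCoeff (hp : 0 < p) (hN : 0 ≤ N) (hν : ∀ f, ‖ν f‖ ≤ N * fockNorm f)
    (ζ : Cn n) (l : ℂ) :
    ∑' k, conj (kernelCoeff hp ν ζ k) * l ^ k =
      conj (ν ⟨kernel (l • ζ), kernel_mem α hp (l • ζ)⟩) := by
  rw [← (hasSum_kernelCoeff hp hN hν (l • ζ)).tsum_eq, Complex.conj_tsum]
  refine tsum_congr fun k => ?_
  rw [kernelCoeff_smul, map_mul, map_pow, Complex.conj_conj, mul_comm]

end Bounded

lemma exists_hasGrowth_conj_kernelCoeff (α : ℝ) (hp : 0 < p) :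
    ∃ C : ℝ, 0 < C ∧ ∀ (ν : FockSpace n p (α * p) →ₗ[ℂ] ℂ) (N : ℝ), 0 ≤ N →
      (∀ f, ‖ν f‖ ≤ N * fockNorm f) → ∀ ζ : Cn n, ‖ζ‖ = 1 →
      HasGrowth (fun k => conj (kernelCoeff hp ν ζ k)) (-α) (C * N) := by
  obtain ⟨C, hC, hkernel⟩ := exists_fockNorm_kernel_le (n := n) α hp
  refine ⟨C, hC, fun ν N hN hν ζ hζ => ⟨fun r hr => ?_, fun l => ?_⟩⟩
  · obtain ⟨C₀, hcoeff⟩ := exists_norm_kernelCoeff_le hp hN hν ((r : ℂ) • ζ)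
    refine Summable.of_nonneg_of_le (fun k => by positivity) (fun k => ?_)
      (summable_geometric_two.mul_left C₀)
    refine le_of_eq_of_le ?_ (hcoeff k)
    rw [kernelCoeff_smul, norm_mul, norm_pow, RCLike.norm_conj, RCLike.norm_conj,
      Complex.norm_real, Real.norm_of_nonneg hr, mul_comm]
  · obtain ⟨_, hle⟩ := hkernel (l • ζ)
    rw [norm_smul, hζ, mul_one] at hle
    rw [tsum_conj_kernelCoeff hp hN hν, RCLike.norm_conj]
    calc _ ≤ N * (C * growth (-α) ‖l‖) := (hν _).trans (by gcongr)
      _ = _ := by ring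

theorem exists_norm_tsum_inverseMultiplier_le (hp : 0 < p) (α β : ℝ) :
    ∃ C : ℝ, 0 < C ∧ ∀ (ν : FockSpace n p (α * p) →ₗ[ℂ] ℂ) (N : ℝ), 0 ≤ N →
      (∀ f, ‖ν f‖ ≤ N * fockNorm f) → ∀ z : Cn n,
      ‖∑' k, (inverseMultiplier n (α + β) k : ℂ) * conj (kernelCoeff hp ν z k)‖ ≤
        C * N * growth β ‖z‖ := by
  obtain ⟨C₁, hC₁, hcoeff⟩ := exists_hasGrowth_conj_kernelCoeff (n := n) α hp
  obtain ⟨C₂, hC₂, hmult⟩ :=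
    isGrowthMultiplier_gammaMultiplier (cutoff n (α + β)) n (n - (α + β) / 2) (-α)
  have hexponent : -α + 2 * ((n : ℝ) - (n - (α + β) / 2)) = β := by ring
  refine ⟨C₂ * C₁, by positivity, fun ν N hN hν z => ?_⟩
  obtain ⟨ζ, hζ, hz⟩ := exists_unit_smul z
  have hgrowth := (hmult _ _ (hcoeff ν N hN hν ζ hζ)).bound ‖z‖
  rw [hexponent, Complex.norm_real, norm_norm, ← mul_assoc] at hgrowth
  refine le_of_eq_of_le (congrArg _ (tsum_congr fun k => ?_)) hgrowth
  conv_lhs => rw [hz, kernelCoeff_smul, map_mul, map_pow, Complex.conj_conj]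
  rw [inverseMultiplier]
  ring

lemma coord_prod_mem (α : ℝ) (hp : 0 < p) {k : ℕ} (s : Fin k → Fin n) :
    (fun z : Cn n => ∏ j, z (s j)) ∈ FockSpace n p (α * p) := by
  obtain ⟨_, -, hgauss⟩ := exists_fockNorm_le_of_gaussian (n := n) α hp (ρ := 1 / 2) (by norm_num)
  exact (hgauss _ _ (differentiable_coord_prod s) (by positivity)
    (norm_coord_prod_le_gaussian one_pos s)).1

lemma kernelCoeff_eq_sum (hp : 0 < p) (ν : FockSpace n p (α * p) →ₗ[ℂ] ℂ) (w : Cn n) (k : ℕ) :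
    kernelCoeff hp ν w k = (k.factorial : ℂ)⁻¹ *
      ∑ s : Fin k → Fin n, conj (∏ j, w (s j)) * ν ⟨_, coord_prod_mem α hp s⟩ := by
  have hexpand : (⟨kernelPart w k, kernelPart_mem α hp w k⟩ : FockSpace n p (α * p)) =
      (k.factorial : ℂ)⁻¹ • ∑ s : Fin k → Fin n,
        conj (∏ j, w (s j)) • ⟨_, coord_prod_mem α hp s⟩ := by
    ext z
    change kernelPart w k z = _
    rw [kernelPart, inner_pow_eq_sum, div_eq_inv_mul]
    simp
  rw [kernelCoeff, hexpand, map_smul, map_sum, smul_eq_mul]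
  simp_rw [map_smul, smul_eq_mul]

/-- The moments of the function representing `ν` under the pairing `⟨·, ·⟩_γ`. -/
def representingMoment (γ : ℝ) (hp : 0 < p) (ν : FockSpace n p (α * p) →ₗ[ℂ] ℂ) (k : ℕ)
    (s : Fin k → Fin n) : ℂ :=
  (inverseMultiplier n γ k : ℂ) * conj (ν ⟨_, coord_prod_mem α hp s⟩)

lemma momentBound_representingMoment (γ : ℝ) (hp : 0 < p) {ν : FockSpace n p (α * p) →ₗ[ℂ] ℂ}
    (hN : 0 ≤ N) (hν : ∀ f, ‖ν f‖ ≤ N * fockNorm f) : MomentBound (representingMoment γ hp ν) := by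
  obtain ⟨C₁, Q, hC₁, hQ, hmult⟩ := exists_abs_inverseMultiplier_le_pow (n := n) γ
  obtain ⟨C, -, hgauss⟩ := exists_fockNorm_le_of_gaussian (n := n) α hp (ρ := 1 / 2) (by norm_num)
  refine fun R hR => ⟨C₁ * (N * (C * Real.exp ((Q * R) ^ 2))), fun k s => ?_⟩
  have hQR : 0 < Q * R := by positivity
  obtain ⟨_, hle⟩ := hgauss _ _ (differentiable_coord_prod s) (by positivity)
    (norm_coord_prod_le_gaussian hQR s)
  rw [representingMoment, norm_mul, RCLike.norm_conj, Complex.norm_real, Real.norm_eq_abs]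
  calc _ ≤ C₁ * Q ^ k * (N * (C * (k.factorial / (Q * R) ^ k * Real.exp ((Q * R) ^ 2)))) *
        R ^ k := by
        gcongr
        exacts [hmult k, (hν _).trans (by gcongr)]
    _ = _ := by
        rw [mul_pow]
        field_simp

lemma homogPart_sum_representingMoment (γ : ℝ) (hp : 0 < p)
    {ν : FockSpace n p (α * p) →ₗ[ℂ] ℂ} (hN : 0 ≤ N) (hν : ∀ f, ‖ν f‖ ≤ N * fockNorm f) (k : ℕ)
    (z : Cn n) :
    homogPart (momentSeries (representingMoment γ hp ν)).sum k z =
      (inverseMultiplier n γ k : ℂ) * conj (kernelCoeff hp ν z k) := by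
  rw [(momentBound_representingMoment γ hp hN hν).homogPart_sum, kernelCoeff_eq_sum, map_mul,
    map_inv₀, map_sum, Complex.conj_natCast, mul_left_comm, Finset.mul_sum]
  simp_rw [representingMoment, map_mul, Complex.conj_conj, Finset.mul_sum]
  refine Finset.sum_congr rfl fun s _ => ?_
  ring

theorem exists_pairing_kernelPart_eq (hp : 0 < p) (α β : ℝ)
    {ν : FockSpace n p (α * p) →ₗ[ℂ] ℂ} (hN : 0 ≤ N) (hν : ∀ f, ‖ν f‖ ≤ N * fockNorm f) :
    ∃ g : FockSpaceInf n β, ∀ w k,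
      pairing (α + β) (kernelPart w k) (g : Cn n → ℂ) = kernelCoeff hp ν w k := by
  have hg := (momentBound_representingMoment (α + β) hp hN hν).isEntire
  have hparts := homogPart_sum_representingMoment (α + β) hp hN hν
  obtain ⟨C, -, htsum⟩ := exists_norm_tsum_inverseMultiplier_le (n := n) hp α β
  have hgrowth (z : Cn n) :
      weightedAbs β (momentSeries (representingMoment (α + β) hp ν)).sum z ≤ C * N := by
    rw [weightedAbs_le_iff, ← (hg.hasSum z).tsum_eq]
    simp_rw [hparts]
    exact htsum ν N hN hν z
  refine ⟨⟨_, mem_FockSpaceInf_of_le hg.differentiable hgrowth⟩, fun w k => ?_⟩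
  rw [pairing_kernelPart _ hg.differentiable hgrowth, hparts, map_mul, Complex.conj_ofReal,
    Complex.conj_conj, ← mul_assoc, ← Complex.ofReal_mul, gammaMultiplier_mul_inverseMultiplier,
    Complex.ofReal_one, one_mul]

end Functional

/-! ### Functionals vanishing on the homogeneous parts of the kernel -/

section HomogeneousParts
variable [NeZero n] {p α M : ℝ} {f : Cn n → ℂ}

lemma homogPart_eq_sum_coord_prod (hp : 0 < p) (hf : Differentiable ℂ f)
    (hM : ∀ z, weightedAbs α f z ≤ M) (k : ℕ) :
    homogPart f k = (((k.factorial : ℂ)⁻¹ • ∑ s : Fin k → Fin n,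
      moment f k s • ⟨_, coord_prod_mem α hp s⟩ : FockSpace n p (α * p)) : Cn n → ℂ) := by
  funext z
  rw [homogPart_eq_sum_moment hf hM]
  simp

lemma homogPart_mem (hp : 0 < p) (hf : Differentiable ℂ f) (hM : ∀ z, weightedAbs α f z ≤ M)
    (k : ℕ) : homogPart f k ∈ FockSpace n p (α * p) := by
  rw [homogPart_eq_sum_coord_prod hp hf hM]
  exact Subtype.coe_prop _

lemma map_homogPart_eq_integral (hp : 0 < p) (hf : Differentiable ℂ f)
    (hM : ∀ z, weightedAbs α f z ≤ M) (ν : FockSpace n p (α * p) →ₗ[ℂ] ℂ) (k : ℕ) :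
    ν ⟨homogPart f k, homogPart_mem hp hf hM k⟩ =
      ∫ u, f u * kernelCoeff hp ν u k * (Real.exp (-‖u‖ ^ 2) : ℂ) ∂(V n) := by
  have hexpand : (⟨homogPart f k, homogPart_mem hp hf hM k⟩ : FockSpace n p (α * p)) =
      (k.factorial : ℂ)⁻¹ • ∑ s : Fin k → Fin n, moment f k s • ⟨_, coord_prod_mem α hp s⟩ :=
    Subtype.ext (homogPart_eq_sum_coord_prod hp hf hM k)
  rw [hexpand, map_smul, map_sum, smul_eq_mul]
  simp_rw [map_smul, smul_eq_mul, moment, ← integral_mul_const]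
  rw [← integral_finsetSum _ fun s _ => (integrable_moment hf.continuous hM k s).mul_const _,
    ← integral_const_mul]
  refine integral_congr_ae (ae_of_all _ fun u => ?_)
  simp only [kernelCoeff_eq_sum, Finset.mul_sum, Finset.sum_mul]
  exact Finset.sum_congr rfl fun s _ => by ring

end HomogeneousParts

lemma exists_growth_mul_le (α : ℝ) {ρ : ℝ} (hρ : 0 < ρ) (hρ1 : ρ < 1) :
    ∃ C : ℝ, 0 < C ∧ ∀ x : ℝ, 0 ≤ x → growth α (ρ * x) ≤ C * Real.exp (ρ * x ^ 2 / 2) := by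
  obtain ⟨C, hC, hpow⟩ := exists_one_add_rpow_le_exp α (ε := (1 - ρ) / 2) (by linarith)
  have hsq (x : ℝ) : (ρ * x) ^ 2 / 2 + (1 - ρ) / 2 * (ρ * x) ^ 2 ≤ ρ * x ^ 2 / 2 := by
    have hle : ρ * (2 - ρ) ≤ 1 := by nlinarith [sq_nonneg (1 - ρ)]
    have : ρ * x ^ 2 * (ρ * (2 - ρ)) ≤ ρ * x ^ 2 * 1 := by gcongr
    linarith
  refine ⟨C, hC, fun x hx => ?_⟩
  calc growth α (ρ * x)
      ≤ Real.exp ((ρ * x) ^ 2 / 2) * (C * Real.exp ((1 - ρ) / 2 * (ρ * x) ^ 2)) := by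
        unfold growth; gcongr; exact hpow _ (by positivity)
    _ = C * Real.exp ((ρ * x) ^ 2 / 2 + (1 - ρ) / 2 * (ρ * x) ^ 2) := by
        rw [Real.exp_add]; ring
    _ ≤ _ := by gcongr; exact hsq x

lemma norm_dilate_sub_sum_le {f : Cn n → ℂ} (hf : IsEntire f) {α M C r ρ : ℝ}
    (hM : ∀ z, weightedAbs α f z ≤ M) (hr : 0 < r) (hrρ : r < ρ)
    (hC : ∀ x : ℝ, 0 ≤ x → growth α (ρ * x) ≤ C * Real.exp (ρ * x ^ 2 / 2)) (m : ℕ) (z : Cn n) :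
    ‖f ((r : ℂ) • z) - ∑ k ∈ Finset.range m, (r : ℂ) ^ k * homogPart f k z‖ ≤
      M * C / (1 - r / ρ) * (r / ρ) ^ m * Real.exp (ρ * ‖z‖ ^ 2 / 2) := by
  have hρ : 0 < ρ := hr.trans hrρ
  have hM0 : 0 ≤ M := (weightedAbs_nonneg _ _ _).trans (hM 0)
  have hpart (k : ℕ) : ρ ^ k * ‖homogPart f k z‖ ≤ M * (C * Real.exp (ρ * ‖z‖ ^ 2 / 2)) := by
    have hle := norm_homogPart_le hf hM k ((ρ : ℂ) • z)
    rw [homogPart_smul, norm_mul, norm_pow, norm_smul, Complex.norm_real,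
      Real.norm_of_nonneg hρ.le] at hle
    exact hle.trans (by gcongr; exact hC _ (norm_nonneg z))
  have htail := dist_le_of_le_geometric_of_tendsto (r / ρ) (M * (C * Real.exp (ρ * ‖z‖ ^ 2 / 2)))
    ((div_lt_one hρ).mpr hrρ) (f := fun m => ∑ k ∈ Finset.range m, homogPart f k z * (r : ℂ) ^ k)
    (fun k => ?_) (hf.hasSum_smul (r : ℂ) z).tendsto_sum_nat m
  · rw [dist_comm, dist_eq_norm] at htail
    simp_rw [mul_comm ((r : ℂ) ^ _)]
    refine htail.trans_eq ?_
    ring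
  · rw [dist_comm, dist_eq_norm, Finset.sum_range_succ, add_sub_cancel_left, norm_mul, norm_pow,
      Complex.norm_real, Real.norm_of_nonneg hr.le]
    calc _ = ρ ^ k * ‖homogPart f k z‖ * (r / ρ) ^ k := by
          rw [div_pow]; field_simp
      _ ≤ _ := mul_le_mul_of_nonneg_right (hpart k) (by positivity)

section Dilation
variable [NeZero n] {p α M : ℝ} {f : Cn n → ℂ} {r : ℝ}

lemma exists_fockNorm_dilate_sub_sum_le (hp : 0 < p) (hf : Differentiable ℂ f)
    (hM : ∀ z, weightedAbs α f z ≤ M) (hr : 0 < r) (hr1 : r < 1) :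
    ∃ C q : ℝ, 0 ≤ q ∧ q < 1 ∧ ∀ m : ℕ,
      ∃ hmem : (fun z => f ((r : ℂ) • z) - ∑ k ∈ Finset.range m, (r : ℂ) ^ k * homogPart f k z) ∈
        FockSpace n p (α * p), fockNorm ⟨_, hmem⟩ ≤ C * q ^ m := by
  obtain ⟨ρ, hrρ, hρ1⟩ := exists_between hr1
  have hρ : 0 < ρ := hr.trans hrρ
  have hM0 : 0 ≤ M := (weightedAbs_nonneg _ _ _).trans (hM 0)
  have hq : r / ρ < 1 := (div_lt_one hρ).mpr hrρ
  have : 0 < 1 - r / ρ := sub_pos.mpr hq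
  obtain ⟨C₁, hC₁, hgrowth⟩ := exists_growth_mul_le α hρ hρ1
  obtain ⟨C₂, -, hgauss⟩ := exists_fockNorm_le_of_gaussian (n := n) α hp hρ1
  refine ⟨C₂ * (M * C₁ / (1 - r / ρ)), r / ρ, by positivity, hq, fun m => ?_⟩
  obtain ⟨hmem, hle⟩ := hgauss _ (M * C₁ / (1 - r / ρ) * (r / ρ) ^ m)
    ((hf.comp (differentiable_fun_id.const_smul (r : ℂ))).sub
      (Differentiable.fun_sum (u := Finset.range m) fun k _ =>
        (differentiable_homogPart f k).const_mul ((r : ℂ) ^ k)))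
    (by positivity)
    (norm_dilate_sub_sum_le (isEntire_of_weightedAbs_le hf hM) hM hr hrρ hgrowth m)
  exact ⟨hmem, hle.trans_eq (mul_assoc _ _ _).symm⟩

lemma dilate_mem (hp : 0 < p) (hf : Differentiable ℂ f) (hM : ∀ z, weightedAbs α f z ≤ M)
    (hr : 0 < r) (hr1 : r < 1) : (fun z => f ((r : ℂ) • z)) ∈ FockSpace n p (α * p) := by
  obtain ⟨_, _, -, -, hdilate⟩ := exists_fockNorm_dilate_sub_sum_le hp hf hM hr hr1
  simpa using (hdilate 0).1

lemma map_dilate_eq_zero {N : ℝ} (hp : 0 < p) (hf : Differentiable ℂ f)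
    (hM : ∀ z, weightedAbs α f z ≤ M) {ν : FockSpace n p (α * p) →ₗ[ℂ] ℂ} (hN : 0 ≤ N)
    (hν : ∀ f, ‖ν f‖ ≤ N * fockNorm f) (hzero : ∀ w k, kernelCoeff hp ν w k = 0)
    (hr : 0 < r) (hr1 : r < 1) : ν ⟨_, dilate_mem hp hf hM hr hr1⟩ = 0 := by
  obtain ⟨C, q, hq0, hq1, hdilate⟩ := exists_fockNorm_dilate_sub_sum_le hp hf hM hr hr1
  have hpart (k : ℕ) : ν ⟨homogPart f k, homogPart_mem hp hf hM k⟩ = 0 := by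
    rw [map_homogPart_eq_integral hp hf hM]
    simp [hzero]
  have hbound (m : ℕ) : ‖ν ⟨_, dilate_mem hp hf hM hr hr1⟩‖ ≤ N * C * q ^ m := by
    obtain ⟨hmem, hle⟩ := hdilate m
    have hsub : (⟨_, hmem⟩ : FockSpace n p (α * p)) = ⟨_, dilate_mem hp hf hM hr hr1⟩ -
        ∑ k ∈ Finset.range m, (r : ℂ) ^ k • ⟨_, homogPart_mem hp hf hM k⟩ := by
      ext z
      simp
    calc _ = ‖ν ⟨_, hmem⟩‖ := by
          rw [hsub, map_sub, map_sum,
            Finset.sum_eq_zero fun k _ => by rw [map_smul, hpart, smul_zero], sub_zero]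
      _ ≤ N * (C * q ^ m) := (hν _).trans (by gcongr)
      _ = _ := (mul_assoc _ _ _).symm
  have hlim := (tendsto_pow_atTop_nhds_zero_of_lt_one hq0 hq1).const_mul (N * C)
  rw [mul_zero] at hlim
  exact norm_le_zero_iff.mp (ge_of_tendsto' hlim hbound)

end Dilation

/-- A version of Pratt's lemma. -/
lemma tendsto_integral_zero_of_le {X ι : Type*} [MeasurableSpace X] {μ : Measure X} {l : Filter ι}
    [l.IsCountablyGenerated] {d G : ι → X → ℝ} {H : X → ℝ}
    (hd_nonneg : ∀ᶠ i in l, ∀ x, 0 ≤ d i x) (hle : ∀ᶠ i in l, ∀ x, d i x ≤ G i x)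
    (hd : ∀ᶠ i in l, Integrable (d i) μ) (hG : ∀ᶠ i in l, Integrable (G i) μ)
    (hH_nonneg : ∀ x, 0 ≤ H x) (hH : Integrable H μ)
    (hd_lim : ∀ x, Tendsto (fun i => d i x) l (𝓝 0))
    (hG_lim : ∀ x, Tendsto (fun i => G i x) l (𝓝 (H x)))
    (hG_int : Tendsto (fun i => ∫ x, G i x ∂μ) l (𝓝 (∫ x, H x ∂μ))) :
    Tendsto (fun i => ∫ x, d i x ∂μ) l (𝓝 0) := by
  have hmin : Tendsto (fun i => ∫ x, min (G i x - d i x) (H x) ∂μ) l (𝓝 (∫ x, H x ∂μ)) := by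
    refine tendsto_integral_filter_of_dominated_convergence H ?_ ?_ hH ?_
    · filter_upwards [hd, hG] with i hdi hGi
      exact ((hGi.sub hdi).inf hH).aestronglyMeasurable
    · filter_upwards [hle] with i hi
      refine ae_of_all _ fun x => ?_
      rw [Real.norm_of_nonneg (le_min (sub_nonneg.mpr (hi x)) (hH_nonneg x))]
      exact min_le_right _ _
    · refine ae_of_all _ fun x => ?_
      simpa using ((hG_lim x).sub (hd_lim x)).min (tendsto_const_nhds (x := H x))
  have hdiff := hG_int.sub hmin
  rw [sub_self] at hdiff
  refine tendsto_of_tendsto_of_tendsto_of_le_of_le' tendsto_const_nhds hdiff ?_ ?_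
  · filter_upwards [hd_nonneg] with i hi
    exact integral_nonneg hi
  · filter_upwards [hd, hG] with i hdi hGi
    have hmini : Integrable (fun x => min (G i x - d i x) (H x)) μ := (hGi.sub hdi).inf hH
    rw [← integral_sub hGi hmini]
    refine integral_mono hdi (hGi.sub hmini) fun x => ?_
    have := min_le_left (G i x - d i x) (H x)
    simp only
    linarith

section DilationLimit
variable {p α r : ℝ} {f : Cn n → ℂ}

lemma one_add_rpow_neg_le_dilate (α : ℝ) (hr : 0 < r) (hr1 : r < 1) {x : ℝ} (hx : 0 ≤ x) :
    (1 + x) ^ (-α) ≤ r ^ (-|α|) * (1 + r * x) ^ (-α) := by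
  rcases le_total 0 α with hα | hα
  · calc (1 + x) ^ (-α) ≤ (1 + r * x) ^ (-α) :=
          rpow_le_rpow_of_nonpos (by positivity) (by nlinarith) (by linarith)
      _ ≤ _ := le_mul_of_one_le_left (by positivity)
          (one_le_rpow_of_pos_of_le_one_of_nonpos hr hr1.le (by simp))
  · have hinv : r ^ (-|α|) = r⁻¹ ^ (-α) := by
      rw [abs_of_nonpos hα, neg_neg, inv_rpow hr.le, rpow_neg hr.le, inv_inv]
    rw [hinv, ← mul_rpow (by positivity) (by positivity)]
    refine rpow_le_rpow (by positivity) ?_ (by linarith)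
    rw [← div_eq_inv_mul, le_div_iff₀ hr]
    nlinarith

lemma weightedAbs_dilate_le (hr : 0 < r) (hr1 : r < 1) (z : Cn n) :
    weightedAbs α (fun z => f ((r : ℂ) • z)) z ≤ r ^ (-|α|) * weightedAbs α f ((r : ℂ) • z) := by
  have hexp : Real.exp (-‖z‖ ^ 2 / 2) ≤ Real.exp (-(r * ‖z‖) ^ 2 / 2) := by
    have : r * ‖z‖ ≤ ‖z‖ := mul_le_of_le_one_left (norm_nonneg z) hr1.le
    gcongr
  unfold weightedAbs
  rw [norm_smul, Complex.norm_real, Real.norm_of_nonneg hr.le]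
  calc _ ≤ ‖f ((r : ℂ) • z)‖ *
        (Real.exp (-(r * ‖z‖) ^ 2 / 2) * (r ^ (-|α|) * (1 + r * ‖z‖) ^ (-α))) := by
        gcongr
        exact one_add_rpow_neg_le_dilate α hr hr1 (norm_nonneg z)
    _ = _ := by ring

/-- The function dominating `weightedAbs α (f(r ·) - f) ^ p`. -/
def dilateMajorant (p α : ℝ) (f : Cn n → ℂ) (r : ℝ) (z : Cn n) : ℝ :=
  (r ^ (-|α|) * weightedAbs α f ((r : ℂ) • z)) ^ p + weightedAbs α f z ^ p

lemma weightedAbs_dilate_sub_rpow_le (hp : 0 < p) (hp1 : p ≤ 1) (hr : 0 < r) (hr1 : r < 1)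
    (z : Cn n) :
    weightedAbs α (fun z => f ((r : ℂ) • z) - f z) z ^ p ≤ dilateMajorant p α f r z := by
  have hz := weightedAbs_nonneg α f z
  have hrz := weightedAbs_nonneg α f ((r : ℂ) • z)
  have htriangle : weightedAbs α (fun z => f ((r : ℂ) • z) - f z) z ≤
      r ^ (-|α|) * weightedAbs α f ((r : ℂ) • z) + weightedAbs α f z := by
    refine le_trans ?_ (add_le_add_left (weightedAbs_dilate_le hr hr1 z) _)
    unfold weightedAbs
    rw [← add_mul]
    gcongr
    exact norm_sub_le _ _
  exact (rpow_le_rpow (weightedAbs_nonneg _ _ _) htriangle hp.le).trans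
    (rpow_add_le_add_rpow (by positivity) hz hp.le hp1)

lemma integrable_scaled_dilate_rpow (hf : Integrable (fun z => weightedAbs α f z ^ p) (V n))
    (hr : 0 < r) :
    Integrable (fun z => (r ^ (-|α|) * weightedAbs α f ((r : ℂ) • z)) ^ p) (V n) := by
  have hdilate : Integrable (fun z => weightedAbs α f ((r : ℂ) • z) ^ p) (V n) :=
    hf.comp_smul (μ := V n) hr.ne'
  exact (hdilate.const_mul ((r ^ (-|α|)) ^ p)).congr (ae_of_all _ fun z =>
    (mul_rpow (by positivity) (weightedAbs_nonneg _ _ _)).symm)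

lemma integral_dilateMajorant (hf : Integrable (fun z => weightedAbs α f z ^ p) (V n))
    (hr : 0 < r) :
    ∫ z, dilateMajorant p α f r z ∂(V n) =
      (r ^ (-|α|)) ^ p * ((r ^ (2 * n))⁻¹ * ∫ z, weightedAbs α f z ^ p ∂(V n)) +
        ∫ z, weightedAbs α f z ^ p ∂(V n) := by
  have hscale := Measure.integral_comp_smul_of_nonneg (V n) (fun z => weightedAbs α f z ^ p) r
    (hR := hr.le)
  rw [finrank_Cn, smul_eq_mul] at hscale
  unfold dilateMajorant
  rw [integral_add (integrable_scaled_dilate_rpow hf hr) hf, ← hscale, ← integral_const_mul]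
  congr 1
  exact integral_congr_ae (ae_of_all _ fun z =>
    mul_rpow (rpow_nonneg hr.le _) (weightedAbs_nonneg _ _ _))

lemma tendsto_rpow_one_nhdsWithin_Iio (s : ℝ) :
    Tendsto (fun r : ℝ => r ^ s) (𝓝[<] 1) (𝓝 1) := by
  simpa using ((Real.continuousAt_rpow_const 1 s (Or.inl one_ne_zero)).tendsto).mono_left
    nhdsWithin_le_nhds

lemma tendsto_integral_dilateMajorant (hp : 0 < p)
    (hf : Integrable (fun z => weightedAbs α f z ^ p) (V n)) :
    Tendsto (fun r => ∫ z, dilateMajorant p α f r z ∂(V n)) (𝓝[<] 1)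
      (𝓝 (∫ z, (weightedAbs α f z ^ p + weightedAbs α f z ^ p) ∂(V n))) := by
  have hev : ∀ᶠ r : ℝ in 𝓝[<] 1, 0 < r ∧ r < 1 := Ioo_mem_nhdsLT one_pos
  refine Tendsto.congr' (hev.mono fun r hr => (integral_dilateMajorant hf hr.1).symm) ?_
  have hpow : Tendsto (fun r : ℝ => (r ^ (2 * n))⁻¹) (𝓝[<] 1) (𝓝 1) := by
    have : ContinuousAt (fun r : ℝ => (r ^ (2 * n))⁻¹) 1 :=
      ContinuousAt.inv₀ (by fun_prop) (by simp)
    simpa using this.tendsto.mono_left nhdsWithin_le_nhds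
  have hfactor := (tendsto_rpow_one_nhdsWithin_Iio (-|α|)).rpow_const (p := p) (Or.inr hp.le)
  rw [integral_add hf hf]
  simpa using (hfactor.mul (hpow.mul_const (∫ z, weightedAbs α f z ^ p ∂(V n)))).add_const
    (∫ z, weightedAbs α f z ^ p ∂(V n))

lemma tendsto_dilate (z : Cn n) : Tendsto (fun r : ℝ => (r : ℂ) • z) (𝓝[<] 1) (𝓝 z) := by
  have : Continuous fun r : ℝ => (r : ℂ) • z := by fun_prop
  simpa using (this.tendsto 1).mono_left nhdsWithin_le_nhds

lemma tendsto_dilateMajorant (hp : 0 < p) (hf : Continuous f) (z : Cn n) :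
    Tendsto (fun r => dilateMajorant p α f r z) (𝓝[<] 1)
      (𝓝 (weightedAbs α f z ^ p + weightedAbs α f z ^ p)) := by
  have hscaled := (tendsto_rpow_one_nhdsWithin_Iio (-|α|)).mul
    (((continuous_weightedAbs α hf).tendsto z).comp (tendsto_dilate z))
  rw [one_mul] at hscaled
  exact (hscaled.rpow_const (Or.inr hp.le)).add_const _

lemma tendsto_weightedAbs_dilate_sub_rpow (hp : 0 < p) (hf : Continuous f) (z : Cn n) :
    Tendsto (fun r : ℝ => weightedAbs α (fun z => f ((r : ℂ) • z) - f z) z ^ p)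
      (𝓝[<] 1) (𝓝 0) := by
  have hdiff : Tendsto (fun r : ℝ => weightedAbs α (fun z => f ((r : ℂ) • z) - f z) z)
      (𝓝[<] 1) (𝓝 0) := by
    unfold weightedAbs
    have := (((hf.tendsto z).comp (tendsto_dilate z)).sub_const (f z)).norm.mul_const
      (Real.exp (-‖z‖ ^ 2 / 2) * (1 + ‖z‖) ^ (-α))
    simpa using! this
  simpa [hp.ne'] using hdiff.rpow_const (p := p) (Or.inr hp.le)

theorem tendsto_integral_weightedAbs_dilate_sub (hp : 0 < p) (hp1 : p ≤ 1)
    (hf : Continuous f) (hint : Integrable (fun z => weightedAbs α f z ^ p) (V n)) :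
    Tendsto (fun r : ℝ => ∫ z, weightedAbs α (fun z => f ((r : ℂ) • z) - f z) z ^ p ∂(V n))
      (𝓝[<] 1) (𝓝 0) := by
  have hev : ∀ᶠ r : ℝ in 𝓝[<] 1, 0 < r ∧ r < 1 := Ioo_mem_nhdsLT one_pos
  have hle : ∀ᶠ r : ℝ in 𝓝[<] 1, ∀ z : Cn n,
      weightedAbs α (fun z => f ((r : ℂ) • z) - f z) z ^ p ≤ dilateMajorant p α f r z :=
    hev.mono fun r hr => weightedAbs_dilate_sub_rpow_le hp hp1 hr.1 hr.2
  have hmajorant : ∀ᶠ r : ℝ in 𝓝[<] 1, Integrable (dilateMajorant p α f r) (V n) :=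
    hev.mono fun r hr => (integrable_scaled_dilate_rpow hint hr.1).add hint
  have hnonneg (g : Cn n → ℂ) (z : Cn n) : 0 ≤ weightedAbs α g z ^ p :=
    rpow_nonneg (weightedAbs_nonneg _ _ _) _
  refine tendsto_integral_zero_of_le (.of_forall fun r z => hnonneg _ z) hle ?_ hmajorant
    (fun z => add_nonneg (hnonneg f z) (hnonneg f z)) (hint.add hint)
    (tendsto_weightedAbs_dilate_sub_rpow hp hf) (tendsto_dilateMajorant hp hf)
    (tendsto_integral_dilateMajorant hp hint)
  filter_upwards [hle, hmajorant] with r hler hintr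
  refine hintr.mono' ((continuous_weightedAbs α (by fun_prop)).rpow_const
    fun _ => Or.inr hp.le).aestronglyMeasurable (ae_of_all _ fun z => ?_)
  rw [Real.norm_of_nonneg (hnonneg _ z)]
  exact hler z

end DilationLimit

theorem eq_zero_of_kernelCoeff_eq_zero [NeZero n] {p α N : ℝ} (hp : 0 < p) (hp1 : p ≤ 1)
    {ν : FockSpace n p (α * p) →ₗ[ℂ] ℂ} (hN : 0 ≤ N) (hν : ∀ f, ‖ν f‖ ≤ N * fockNorm f)
    (hzero : ∀ w k, kernelCoeff hp ν w k = 0) : ν = 0 := by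
  ext f
  obtain ⟨_, -, hpoint⟩ := exists_weightedAbs_le_fockNorm (n := n) α hp
  obtain ⟨hf, hint⟩ := (mem_FockSpace_iff hp).mp f.2
  have hlim := ((tendsto_integral_weightedAbs_dilate_sub hp hp1 hf.continuous hint).rpow_const
    (p := p⁻¹) (Or.inr (by positivity))).const_mul N
  rw [zero_rpow (by positivity), mul_zero] at hlim
  rw [LinearMap.zero_apply, ← norm_le_zero_iff]
  refine ge_of_tendsto hlim ?_
  filter_upwards [Ioo_mem_nhdsLT one_pos] with r hr
  have hbound := hν (⟨_, dilate_mem hp hf (hpoint f) hr.1 hr.2⟩ - f)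
  rwa [map_sub, map_dilate_eq_zero hp hf (hpoint f) hN hν hzero hr.1 hr.2, zero_sub,
    norm_neg, fockNorm_eq hp] at hbound

/-! ### The duality map -/

section Sesquilinear
variable {γ : ℝ} {f f₁ f₂ g g₁ g₂ : Cn n → ℂ}

lemma IsEntire.contDiffAt_zero (hf : IsEntire f) (k : ℕ) : ContDiffAt ℂ k f 0 := by
  obtain ⟨_, hP⟩ := hf
  exact hP.analyticAt.contDiffAt

lemma homogPart_add (hf : IsEntire f) (hg : IsEntire g) (k : ℕ) (z : Cn n) :
    homogPart (f + g) k z = homogPart f k z + homogPart g k z := by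
  simp only [homogPart, iteratedFDeriv_add_apply (hf.contDiffAt_zero k) (hg.contDiffAt_zero k),
    add_apply, add_div]

lemma homogPart_const_smul (hf : IsEntire f) (c : ℂ) (k : ℕ) (z : Cn n) :
    homogPart (c • f) k z = c * homogPart f k z := by
  simp only [homogPart, iteratedFDeriv_const_smul_apply (hf.contDiffAt_zero k),
    smul_apply, smul_eq_mul, mul_div_assoc]

lemma truncLow_add (hf : IsEntire f) (hg : IsEntire g) (j : ℕ) :
    truncLow j (f + g) = truncLow j f + truncLow j g := by
  funext z
  simp [truncLow, homogPart_add hf hg, Finset.sum_add_distrib]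

lemma truncHigh_add (hf : IsEntire f) (hg : IsEntire g) (j : ℕ) :
    truncHigh j (f + g) = truncHigh j f + truncHigh j g := by
  funext z
  simp only [truncHigh, truncLow_add hf hg, Pi.add_apply]
  ring

lemma truncLow_const_smul (hf : IsEntire f) (c : ℂ) (j : ℕ) :
    truncLow j (c • f) = c • truncLow j f := by
  funext z
  simp [truncLow, homogPart_const_smul hf, Finset.mul_sum]

lemma truncHigh_const_smul (hf : IsEntire f) (c : ℂ) (j : ℕ) :
    truncHigh j (c • f) = c • truncHigh j f := by
  funext z
  simp only [truncHigh, truncLow_const_smul hf, Pi.smul_apply, smul_eq_mul, mul_sub]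

lemma rawPairing_add_left (h₁ : Integrable (pairIntegrand f₁ g) (W n γ))
    (h₂ : Integrable (pairIntegrand f₂ g) (W n γ)) :
    rawPairing γ (f₁ + f₂) g = rawPairing γ f₁ g + rawPairing γ f₂ g := by
  rw [rawPairing, rawPairing, rawPairing, ← integral_add h₁ h₂]
  simp only [pairIntegrand, Pi.add_apply, add_mul]

lemma rawPairing_const_smul_left (γ : ℝ) (c : ℂ) (f g : Cn n → ℂ) :
    rawPairing γ (c • f) g = c * rawPairing γ f g := by
  simp only [rawPairing, ← integral_const_mul, pairIntegrand, Pi.smul_apply, smul_eq_mul, mul_assoc]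

lemma pairing_conj_symm (γ : ℝ) (f g : Cn n → ℂ) : pairing γ f g = conj (pairing γ g f) := by
  simp only [pairing_eq_cutoff, map_add, ← rawPairing_conj_symm]

lemma integrable_pairIntegrand_symm {μ : Measure (Cn n)} (h : Integrable (pairIntegrand f g) μ) :
    Integrable (pairIntegrand g f) μ :=
  (Complex.conjCLE.toContinuousLinearMap.integrable_comp h).congr
    (ae_of_all _ fun z => (pairIntegrand_conj_symm g f z).symm)

lemma pairingConverges_symm (h : PairingConverges γ f g) : PairingConverges γ g f :=
  ⟨fun hγ => integrable_pairIntegrand_symm (h.1 hγ), fun hγ =>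
    ⟨integrable_pairIntegrand_symm (h.2 hγ).1, integrable_pairIntegrand_symm (h.2 hγ).2⟩⟩

lemma pairing_add_left (hf₁ : IsEntire f₁) (hf₂ : IsEntire f₂) (h₁ : PairingConverges γ f₁ g)
    (h₂ : PairingConverges γ f₂ g) : pairing γ (f₁ + f₂) g = pairing γ f₁ g + pairing γ f₂ g := by
  obtain ⟨hlow₁, hhigh₁⟩ := (pairingConverges_iff_cutoff _ _ _).mp h₁
  obtain ⟨hlow₂, hhigh₂⟩ := (pairingConverges_iff_cutoff _ _ _).mp h₂
  simp only [pairing_eq_cutoff, truncLow_add hf₁ hf₂, truncHigh_add hf₁ hf₂,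
    rawPairing_add_left hlow₁ hlow₂, rawPairing_add_left hhigh₁ hhigh₂]
  ring

lemma pairing_const_smul_left (hf : IsEntire f) (γ : ℝ) (c : ℂ) (g : Cn n → ℂ) :
    pairing γ (c • f) g = c * pairing γ f g := by
  simp only [pairing_eq_cutoff, truncLow_const_smul hf, truncHigh_const_smul hf,
    rawPairing_const_smul_left, mul_add]

lemma pairing_add_right (hg₁ : IsEntire g₁) (hg₂ : IsEntire g₂) (h₁ : PairingConverges γ f g₁)
    (h₂ : PairingConverges γ f g₂) : pairing γ f (g₁ + g₂) = pairing γ f g₁ + pairing γ f g₂ := by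
  rw [pairing_conj_symm, pairing_add_left hg₁ hg₂ (pairingConverges_symm h₁)
    (pairingConverges_symm h₂), map_add, ← pairing_conj_symm, ← pairing_conj_symm]

lemma pairing_const_smul_right (hg : IsEntire g) (γ : ℝ) (c : ℂ) (f : Cn n → ℂ) :
    pairing γ f (c • g) = conj c * pairing γ f g := by
  rw [pairing_conj_symm, pairing_const_smul_left hg, map_mul, ← pairing_conj_symm]

end Sesquilinear

section DualNorm
variable {p α : ℝ} {ν : FockDual n p α}

lemma fockNormInf_nonneg {β : ℝ} (g : FockSpaceInf n β) : 0 ≤ fockNormInf g :=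
  ENNReal.toReal_nonneg

lemma fockNorm_zero : fockNorm (0 : FockSpace n p α) = 0 := by
  simpa using fockNorm_smul (0 : ℂ) (0 : FockSpace n p α)

lemma dualNorm_le {M : ℝ} (h : ∀ f, ‖ν.1 f‖ ≤ M * fockNorm f) (hM : 0 ≤ M) : dualNorm ν ≤ M := by
  refine csSup_le ⟨0, 0, by simp [fockNorm_zero], by simp⟩ ?_
  rintro x ⟨f, hf, rfl⟩
  exact (h f).trans (mul_le_of_le_one_right hM hf)

lemma dualNorm_nonneg (ν : FockDual n p α) : 0 ≤ dualNorm ν := by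
  refine Real.sSup_nonneg ?_
  rintro x ⟨f, -, rfl⟩
  exact norm_nonneg _

lemma norm_apply_le_dualNorm (ν : FockDual n p α) (f : FockSpace n p α) :
    ‖ν.1 f‖ ≤ dualNorm ν * fockNorm f := by
  obtain ⟨C, hC⟩ := ν.2
  rcases (fockNorm_nonneg f).eq_or_lt with hf | hf
  · simpa [← hf] using hC f
  have hbdd : BddAbove {x : ℝ | ∃ f : FockSpace n p α, fockNorm f ≤ 1 ∧ x = ‖ν.1 f‖} := by
    refine ⟨|C|, ?_⟩
    rintro x ⟨g, hg, rfl⟩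
    calc _ ≤ C * fockNorm g := hC g
      _ ≤ |C| * 1 := mul_le_mul (le_abs_self C) hg (fockNorm_nonneg g) (abs_nonneg C)
      _ = _ := mul_one _
  have hunit : ‖ν.1 (((fockNorm f)⁻¹ : ℂ) • f)‖ ≤ dualNorm ν := by
    refine le_csSup hbdd ⟨_, ?_, rfl⟩
    rw [fockNorm_smul, norm_inv, Complex.norm_real, Real.norm_of_nonneg hf.le,
      inv_mul_cancel₀ hf.ne']
  rwa [map_smul, norm_smul, norm_inv, Complex.norm_real, Real.norm_of_nonneg hf.le,
    inv_mul_le_iff₀ hf, mul_comm] at hunit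

end DualNorm

section Duality
variable [NeZero n] {p β : ℝ}

lemma isEntire_of_mem_FockSpace {α : ℝ} (hp : 0 < p) (f : FockSpace n p (α * p)) :
    IsEntire (f : Cn n → ℂ) := by
  obtain ⟨_, -, hpoint⟩ := exists_weightedAbs_le_fockNorm (n := n) α hp
  exact isEntire_of_weightedAbs_le f.2.1 (hpoint f)

lemma isEntire_of_mem_FockSpaceInf (g : FockSpaceInf n β) : IsEntire (g : Cn n → ℂ) :=
  isEntire_of_weightedAbs_le g.2.1 (weightedAbs_le_fockNormInf g)

theorem exists_norm_pairing_le_fockNorm (hp : 0 < p) (hp1 : p ≤ 1) (α β : ℝ) :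
    ∃ C : ℝ, 0 < C ∧ ∀ (f : FockSpace n p (α * p)) (g : FockSpaceInf n β),
      PairingConverges (α + β) (f : Cn n → ℂ) (g : Cn n → ℂ) ∧
      ‖pairing (α + β) (f : Cn n → ℂ) (g : Cn n → ℂ)‖ ≤ C * fockNormInf g * fockNorm f := by
  obtain ⟨K, hK, hpairing⟩ := exists_norm_pairing_le (n := n) α β
  obtain ⟨C₁, hC₁, hpoint⟩ := exists_weightedAbs_le_fockNorm (n := n) α hp
  obtain ⟨C₂, hC₂, hembed⟩ := exists_integral_weightedAbs_le_fockNorm (n := n) α hp hp1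
  refine ⟨K * (C₁ + C₂), by positivity, fun f g => ?_⟩
  obtain ⟨hint, hintegral⟩ := hembed f
  obtain ⟨hconv, hle⟩ :=
    hpairing f g _ _ f.2.1 g.2.1 (hpoint f) hint (weightedAbs_le_fockNormInf g)
  have := fockNormInf_nonneg g
  refine ⟨hconv, ?_⟩
  calc _ ≤ K * fockNormInf g * (C₁ * fockNorm f + C₂ * fockNorm f) := hle.trans (by gcongr)
    _ = _ := by ring

lemma pairingConverges_of_mem (hp : 0 < p) (hp1 : p ≤ 1) {α : ℝ} (f : FockSpace n p (α * p))
    (g : FockSpaceInf n β) : PairingConverges (α + β) (f : Cn n → ℂ) (g : Cn n → ℂ) := by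
  obtain ⟨_, -, hpairing⟩ := exists_norm_pairing_le_fockNorm (n := n) hp hp1 α β
  exact (hpairing f g).1

/-- The functional `⟨·, g⟩_{α + β}` on `F^p_{αp}`. -/
def pairingFunctional (hp : 0 < p) (hp1 : p ≤ 1) (α : ℝ) (g : FockSpaceInf n β) :
    FockSpace n p (α * p) →ₗ[ℂ] ℂ where
  toFun f := pairing (α + β) (f : Cn n → ℂ) g
  map_add' f₁ f₂ :=
    pairing_add_left (isEntire_of_mem_FockSpace hp f₁) (isEntire_of_mem_FockSpace hp f₂)
      (pairingConverges_of_mem hp hp1 f₁ g) (pairingConverges_of_mem hp hp1 f₂ g)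
  map_smul' c f := pairing_const_smul_left (isEntire_of_mem_FockSpace hp f) _ c g

/-- The map `g ↦ ⟨·, g⟩_{α + β}` from `F^∞_β` to the dual of `F^p_{αp}`. -/
def pairingMap (hp : 0 < p) (hp1 : p ≤ 1) (α β : ℝ) :
    FockSpaceInf n β →ₛₗ[starRingEnd ℂ] FockDual n p (α * p) where
  toFun g := ⟨pairingFunctional hp hp1 α g, by
    obtain ⟨C, -, hpairing⟩ := exists_norm_pairing_le_fockNorm (n := n) hp hp1 α β
    exact ⟨C * fockNormInf g, fun f => (hpairing f g).2⟩⟩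
  map_add' g₁ g₂ := by
    ext f
    exact pairing_add_right (isEntire_of_mem_FockSpaceInf g₁) (isEntire_of_mem_FockSpaceInf g₂)
      (pairingConverges_of_mem hp hp1 f g₁) (pairingConverges_of_mem hp hp1 f g₂)
  map_smul' c g := by
    ext f
    exact pairing_const_smul_right (isEntire_of_mem_FockSpaceInf g) _ c f

lemma pairingMap_apply (hp : 0 < p) (hp1 : p ≤ 1) (α : ℝ) (g : FockSpaceInf n β)
    (f : FockSpace n p (α * p)) :
    (pairingMap hp hp1 α β g).1 f = pairing (α + β) (f : Cn n → ℂ) g := rfl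

lemma homogPart_eq_conj_kernelCoeff_pairingMap (hp : 0 < p) (hp1 : p ≤ 1) (α : ℝ)
    (g : FockSpaceInf n β) (w : Cn n) (k : ℕ) :
    homogPart (g : Cn n → ℂ) k w = (inverseMultiplier n (α + β) k : ℂ) *
      conj (kernelCoeff hp (pairingMap hp hp1 α β g).1 w k) := by
  rw [kernelCoeff, pairingMap_apply, pairing_kernelPart _ g.2.1 (weightedAbs_le_fockNormInf g),
    map_mul, Complex.conj_ofReal, Complex.conj_conj, ← mul_assoc, ← Complex.ofReal_mul,
    mul_comm (inverseMultiplier _ _ _), gammaMultiplier_mul_inverseMultiplier, Complex.ofReal_one,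
    one_mul]

theorem exists_fockNormInf_le_dualNorm (hp : 0 < p) (hp1 : p ≤ 1) (α β : ℝ) :
    ∃ C : ℝ, 0 < C ∧ ∀ g : FockSpaceInf n β,
      fockNormInf g ≤ C * dualNorm (pairingMap hp hp1 α β g) := by
  obtain ⟨C, hC, htsum⟩ := exists_norm_tsum_inverseMultiplier_le (n := n) hp α β
  refine ⟨C, hC, fun g => ?_⟩
  have hnonneg := dualNorm_nonneg (pairingMap hp hp1 α β g)
  refine fockNormInf_le (by positivity) g fun z => ?_
  rw [weightedAbs_le_iff, ← ((isEntire_of_mem_FockSpaceInf g).hasSum z).tsum_eq]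
  simp_rw [homogPart_eq_conj_kernelCoeff_pairingMap hp hp1 α g]
  exact htsum _ _ hnonneg (norm_apply_le_dualNorm _) z

theorem pairingMap_injective (hp : 0 < p) (hp1 : p ≤ 1) (α β : ℝ) :
    Function.Injective (pairingMap (n := n) hp hp1 α β) := by
  rw [injective_iff_map_eq_zero]
  intro g hg
  ext z
  rw [← ((isEntire_of_mem_FockSpaceInf g).hasSum z).tsum_eq]
  simp_rw [homogPart_eq_conj_kernelCoeff_pairingMap hp hp1 α g, hg]
  simp [kernelCoeff]

theorem pairingMap_surjective (hp : 0 < p) (hp1 : p ≤ 1) (α β : ℝ) :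
    Function.Surjective (pairingMap (n := n) hp hp1 α β) := by
  intro ν
  obtain ⟨g, hg⟩ :=
    exists_pairing_kernelPart_eq hp α β (dualNorm_nonneg ν) (norm_apply_le_dualNorm ν)
  refine ⟨g, sub_eq_zero.mp (Subtype.ext ?_)⟩
  exact eq_zero_of_kernelCoeff_eq_zero hp hp1 (dualNorm_nonneg _)
    (norm_apply_le_dualNorm (pairingMap hp hp1 α β g - ν)) fun w k => sub_eq_zero.mpr (hg w k)

end Duality

end FockDuality

end

theorem theorem5p7 (n : ℕ) (hn : 1 ≤ n) (p α β : ℝ) (hp0 : 0 < p) (hp1 : p ≤ 1) :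
    (∀ f ∈ FockDuality.FockSpace n p (α * p), ∀ g ∈ FockDuality.FockSpaceInf n β,
      FockDuality.PairingConverges (α + β) f g) ∧
    ∃ Φ : FockDuality.FockSpaceInf n β ≃ₛₗ[starRingEnd ℂ] FockDuality.FockDual n p (α * p),
      (∀ (g : FockDuality.FockSpaceInf n β) (f : FockDuality.FockSpace n p (α * p)),
        (Φ g).1 f = FockDuality.pairing (α + β) (f : FockDuality.Cn n → ℂ) g) ∧
      ∃ c C : ℝ, 0 < c ∧ 0 < C ∧ ∀ g : FockDuality.FockSpaceInf n β,
        c * FockDuality.fockNormInf g ≤ FockDuality.dualNorm (Φ g) ∧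
        FockDuality.dualNorm (Φ g) ≤ C * FockDuality.fockNormInf g := by
  have : NeZero n := ⟨by omega⟩
  obtain ⟨C, hC, hupper⟩ :=
    FockDuality.exists_norm_pairing_le_fockNorm (n := n) hp0 hp1 α β
  obtain ⟨C', hC', hlower⟩ :=
    FockDuality.exists_fockNormInf_le_dualNorm (n := n) hp0 hp1 α β
  refine ⟨fun f hf g hg => FockDuality.pairingConverges_of_mem hp0 hp1 ⟨f, hf⟩ ⟨g, hg⟩,
    LinearEquiv.ofBijective (FockDuality.pairingMap hp0 hp1 α β)
      ⟨FockDuality.pairingMap_injective hp0 hp1 α β, FockDuality.pairingMap_surjective hp0 hp1 α β⟩,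
    fun g f => rfl, C'⁻¹, C, by positivity, hC, fun g => ⟨?_, ?_⟩⟩
  · rw [inv_mul_le_iff₀ hC']
    exact hlower g
  · exact FockDuality.dualNorm_le (fun f => (hupper f g).2)
      (mul_nonneg hC.le (FockDuality.fockNormInf_nonneg g))
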